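/- Let $\mathbb K$ be $\mathbb R$ or $\mathbb C$ and let $\mathfrak g=(\mathfrak g,d,[\cdot,\cdot])$ be a finite-dimensional $\mathbb Z$-graded dg Lie algebra. All modules are finite-dimensional and graded. **Setting.** $C(\mathfrak g)=S(\mathfrak g^\vee[-1])$ is the Chevalley–Eilenberg dg algebra, where $\xi[-1]$ has degree $1-p$ if $\xi$ is supported on $\mathfrak g^p$. For $x\in\mathfrak g$, $\iota_{x[1]}$ is the derivation of degree $|x|-1$ with $\iota_{x[1]}\xi[-1]=\xi(x)$. The differential $d_{CE}=d_0+d_1$ is the derivation of degree $1$ with $\iota_{x[1]}d_0\xi[-1]=(-1)^{|x|}\xi(dx)$ and $\iota_{x[1]}\iota_{y[1]}d_1\xi[-1]=(-1)^{|y|}\xi([x,y])$. Put $C^k(\mathfrak g,M)=S^k(\mathfrak g^\vee[-1])\otimes M$ and $C(\mathfrak g,M)=\bigoplus_kC^k(\mathfrak g,M)$. For $b=\omega\otimes x\in C(\mathfrak g,\mathfrak g)$ let $\iota_{b}(\alpha\otimes m)=\omega\,\iota_{x[1]}(\alpha)\otimes m$, extended linearly in $b$. A *locally finite $\infty$-$\mathfrak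 g$-module* is a graded vector space $M$ with degree $1$ maps $d_k^M:M\to C^k(\mathfrak g,M)$, $k\ge0$, only finitely many of which are nonzero on each $m\in M$, such that $d_{tot}^M=d_{CE}\otimes\mathrm{id}+\sum_k \mathrm{id}\otimes d_k^M$ squares to zero on $C(\mathfrak g,M)$. An *$\infty$-morphism* $\phi:M\rightsquigarrow N$ is a locally finite family of degree $0$ maps $\phi_k:M\to C^k(\mathfrak g,N)$ whose $C(\mathfrak g)$-linear extension $C(\mathfrak g,\phi):C(\mathfrak g,M)\to C(\mathfrak g,N)$ commutes with the total differentials; write $\phi(m)=\sum_k\phi_k(m)$. These compose through their $C(\mathfrak g)$-linear extensions. The adjoint module $\mathfrak g$ has $d_0^{\mathfrak g}=d$, $\iota_{y[1]}d_1^{\mathfrak g}x=[y,x]$ and $d_k^{\mathfrak g}=0$ for $k\ge2$. Objects of $\mathbf{wLP}_{\mathfrak g}$ (weak Loday–Pirashvili modules) are $\infty$-morphisms $f:M\rightsquigarrow\mathfrak g$; morphisms from $f:M\rightsquigarrow\mathfrak g$ to $f':M'\rightsquigarrow\mathfrak g$ are $\infty$-morphisms $\phi:M\rightsquigarrow M'$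 with $f'\circ\phi=f$. Two $\infty$-morphisms $f,f':M\rightsquigarrow\mathfrak g$ are *homotopic* if there is an $\infty$-morphism $H:M\rightsquigarrow J(\mathfrak g)$ with $\varepsilon_0\circ H=f$, $\varepsilon_1\circ H=f'$. Here $J(\mathfrak g)=\mathfrak g\oplus\mathfrak g\,t\oplus\mathfrak g\,dt$ ($|t|=0$, $|dt|=1$), $\varepsilon_0(x_0+tx_1+dt\,y)=x_0$, $\varepsilon_1(x_0+tx_1+dt\,y)=x_0+x_1$, and $$d_k(x_0+tx_1+dt\,y)=d_k^{\mathfrak g}x_0+t\,d_k^{\mathfrak g}x_1-(-1)^{*}dt\,d_k^{\mathfrak g}y+\delta_{k,0}\,dt\,x_1,$$ where $(-1)^{*}$ multiplies $\alpha\otimes y'$ by $(-1)^{|\alpha|}$. A *Leibniz$_\infty[1]$ $C(\mathfrak g)$-algebra* is a graded $C(\mathfrak g)$-module $U$ with $\mathbb K$-multilinear maps $\lambda_n:U^{\otimes n}\to U$, $n\ge1$, of degree $1$, such that for all $n\ge1$ and homogeneous $x_i$ $$\sum_{1\le j\le k\le n}\ \sum_{\sigma\in\mathrm{sh}(k-j,j-1)}\epsilon(\sigma)(-1)^{|x_{\sigma(1)}|+\dots+|x_{\sigma(k-j)}|}\lambda_{n-j+1}\big(x_{\sigma(1)},\dots,x_{\sigma(k-j)},\lambda_j(x_{\sigma(k-j+1)},\dots,x_{\sigma(k-1)},x_k),x_{k+1},\dots,x_n\big)=0,$$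 $(U,\lambda_1)$ is a dg $C(\mathfrak g)$-module, and $\lambda_n$ is $C(\mathfrak g)$-multilinear (with Koszul signs) for $n\ge2$. A *morphism* $(U,\lambda)\to(W,\nu)$ is a family of $C(\mathfrak g)$-multilinear maps $\Phi_n:U^{\otimes n}\to W$, $n\ge1$, of degree $0$ with $$\sum_{B_1,\dots,B_r}\pm\,\nu_r\big(\Phi_{|B_1|}(x_{B_1}),\dots,\Phi_{|B_r|}(x_{B_r})\big)=\sum_{j,k,\sigma}\epsilon(\sigma)(-1)^{|x_{\sigma(1)}|+\dots+|x_{\sigma(k-j)}|}\Phi_{n-j+1}\big(x_{\sigma(1)},\dots,\lambda_j(\dots,x_k),x_{k+1},\dots,x_n\big)$$ for all $n\ge1$ and homogeneous $x_i$. The left sum runs over partitions of $\{1,\dots,n\}$ into nonempty blocks ordered by $\max B_1<\dots<\max B_r$, with Koszul signs. Composition is given by the same sum: $(\Psi\circ\Phi)_n=\sum\pm\Psi_r(\Phi_{|B_1|},\dots,\Phi_{|B_r|})$. The identity has first component $\mathrm{id}$ and all others zero. Let $\mathbf{Leib}^{\infty[1]}_{C(\mathfrak g)}$ be the resulting category.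 **Theorem.** For every weak Loday–Pirashvili module $f:M\rightsquigarrow\mathfrak g$ there is a Leibniz$_\infty[1]$ $C(\mathfrak g)$-algebra structure $\{\lambda_n\}_{n\ge1}$ on $C(\mathfrak g,M[1])$ whose unary bracket $\lambda_1$ is the total differential $d_{tot}^{M[1]}$ (that is, $d_{tot}^M$ under the identification of $C(\mathfrak g,M[1])$ with $C(\mathfrak g,M)$, $\alpha\otimes m[1]\leftrightarrow\alpha\otimes m$), and whose higher brackets are, for $n\ge2$ and homogeneous $m_1,\dots,m_n\in M$, $$\lambda_n(m_1[1],\dots,m_n[1])=(-1)^{\sum_{i<n}(|m_i|-1)}\,\iota_{f(m_1)}\cdots\iota_{f(m_{n-1})}\Big(\sum_{k\ge1}d_k^Mm_n\Big)[1].$$ This assignment extends to a functor $\mathcal G^\infty_{\mathfrak g}:\mathbf{wLP}_{\mathfrak g}\to\mathbf{Leib}^{\infty[1]}_{C(\mathfrak g)}$: a morphism $\phi$ from $f:M\rightsquigarrow\mathfrak g$ to $f':M'\rightsquigarrow\mathfrak g$ is sent to the morphism with first component $C(\mathfrak g,\phi)$ and $$\mathcal G^\infty_{\mathfrak g}(\phi)_{n}(m_1[1],\dots,m_{n}[1])=\iota_{f(m_1)}\cdots\iota_{f(m_{n-1})}\,\phi(m_{n})[1],\qquad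 n\ge2.$$ The functor is homotopy invariant: if $f,f':M\rightsquigarrow\mathfrak g$ are homotopic weak Loday–Pirashvili modules, then the two Leibniz$_\infty[1]$ $C(\mathfrak g)$-algebra structures on $C(\mathfrak g,M[1])$ are isomorphic, by an isomorphism whose first component is the identity. -/

import Mathlib

open scoped TensorProduct

universe u v w

noncomputable section

/-- A differential graded Lie algebra over `K` with underlying vector space `L`
(cohomological grading by `ℤ`). -/
structure DGLieAlgebra (K : Type u) [Field K] (L : Type v) [AddCommGroup L] [Module K L] where
  /-- the homogeneous pieces -/
  gr : ℤ → Submodule K L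
  internal : DirectSum.IsInternal gr
  d : L →ₗ[K] L
  bracket : L →ₗ[K] L →ₗ[K] L
  d_mem : ∀ {p : ℤ} {x : L}, x ∈ gr p → d x ∈ gr (p + 1)
  d_d : ∀ x : L, d (d x) = 0
  bracket_mem : ∀ {p q : ℤ} {x y : L}, x ∈ gr p → y ∈ gr q → bracket x y ∈ gr (p + q)
  skew : ∀ {p q : ℤ} {x y : L}, x ∈ gr p → y ∈ gr q →
    bracket x y = -((p * q).negOnePow • bracket y x)
  jacobi : ∀ {p q r : ℤ} {x y z : L}, x ∈ gr p → y ∈ gr q → z ∈ gr r →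
    (p * r).negOnePow • bracket x (bracket y z) + (q * p).negOnePow • bracket y (bracket z x) +
      (r * q).negOnePow • bracket z (bracket x y) = 0
  leibniz : ∀ {p q : ℤ} {x y : L}, x ∈ gr p → y ∈ gr q →
    d (bracket x y) = bracket (d x) y + p.negOnePow • bracket x (d y)

namespace DGLieAlgebra

variable {K : Type u} [Field K] {L : Type v} [AddCommGroup L] [Module K L] (g : DGLieAlgebra K L)

/-- Linear forms on `L` supported on the degree `p` piece. The corresponding elements `ξ[-1]` of
`L^∨[-1]` have degree `1 - p`. -/
def dualGr (p : ℤ) : Submodule K (Module.Dual K L) where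
  carrier := {ξ | ∀ q : ℤ, q ≠ p → ∀ x ∈ g.gr q, ξ x = 0}
  add_mem' := fun ha hb q hq x hx => by simp [ha q hq x hx, hb q hq x hx]
  zero_mem' := fun q hq x hx => by simp
  smul_mem' := fun c ξ h q hq x hx => by simp [h q hq x hx]

/-- Graded commutativity relations between the generators `ξ[-1]`. -/
inductive CERel : TensorAlgebra K (Module.Dual K L) → TensorAlgebra K (Module.Dual K L) → Prop
  | comm {p q : ℤ} {ξ η : Module.Dual K L} (hξ : ξ ∈ g.dualGr p) (hη : η ∈ g.dualGr q) :
      CERel (TensorAlgebra.ι K ξ * TensorAlgebra.ι K η)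
        (((1 - p) * (1 - q)).negOnePow • (TensorAlgebra.ι K η * TensorAlgebra.ι K ξ))

/-- The graded algebra `C(𝔤) = S(𝔤^∨[-1])`: the tensor algebra of `𝔤^∨[-1]` modulo graded
commutativity. -/
def CE : Type (max u v) := RingQuot g.CERel

instance : Ring g.CE := inferInstanceAs (Ring (RingQuot g.CERel))
instance : Algebra K g.CE := inferInstanceAs (Algebra K (RingQuot g.CERel))

/-- The quotient map. -/
def ceMk : TensorAlgebra K (Module.Dual K L) →ₐ[K] g.CE := RingQuot.mkAlgHom K g.CERel

/-- The generator `ξ[-1]`. -/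
def ceGen : Module.Dual K L →ₗ[K] g.CE := g.ceMk.toLinearMap ∘ₗ TensorAlgebra.ι K

theorem ceGen_comm {p q : ℤ} {ξ η : Module.Dual K L} (hξ : ξ ∈ g.dualGr p)
    (hη : η ∈ g.dualGr q) :
    g.ceGen ξ * g.ceGen η = ((1 - p) * (1 - q)).negOnePow • (g.ceGen η * g.ceGen ξ) := by
  have h := RingQuot.mkAlgHom_rel K (CERel.comm hξ hη)
  rw [Units.smul_def, map_zsmul, map_mul, map_mul, ← Units.smul_def] at h
  exact h

/-- The elements of weight `k` and degree `n` in `C(𝔤)`: linear combinations of products of `k`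
homogeneous generators of total degree `n`. -/
def biGr (k : ℕ) (n : ℤ) : Submodule K g.CE :=
  Submodule.span K {a | ∃ l : List (ℤ × Module.Dual K L), (∀ c ∈ l, c.2 ∈ g.dualGr c.1) ∧
    l.length = k ∧ (l.map fun c => 1 - c.1).sum = n ∧ a = (l.map fun c => g.ceGen c.2).prod}

/-- The degree `n` part of `C(𝔤)`. -/
def ceGr (n : ℤ) : Submodule K g.CE := ⨆ k, g.biGr k n

/-- The weight `k` part `C^k(𝔤) = S^k(𝔤^∨[-1])`. -/
def ceWt (k : ℕ) : Submodule K g.CE := ⨆ n, g.biGr k n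

theorem biGr_le_ceGr (k : ℕ) (n : ℤ) : g.biGr k n ≤ g.ceGr n := le_iSup (fun k => g.biGr k n) k

theorem biGr_le_ceWt (k : ℕ) (n : ℤ) : g.biGr k n ≤ g.ceWt k := le_iSup (fun n => g.biGr k n) n

theorem one_mem_biGr : (1 : g.CE) ∈ g.biGr 0 0 :=
  Submodule.subset_span ⟨[], by simp⟩

theorem ceGen_mem_biGr {p : ℤ} {ξ : Module.Dual K L} (hξ : ξ ∈ g.dualGr p) :
    g.ceGen ξ ∈ g.biGr 1 (1 - p) :=
  Submodule.subset_span ⟨[(p, ξ)], by simpa using hξ⟩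

theorem mul_mem_biGr {k l : ℕ} {m n : ℤ} {a b : g.CE} (ha : a ∈ g.biGr k m)
    (hb : b ∈ g.biGr l n) : a * b ∈ g.biGr (k + l) (m + n) := by
  have h := Submodule.mul_mem_mul ha hb
  rw [biGr, biGr, Submodule.span_mul_span] at h
  refine Submodule.span_mono ?_ h
  rintro _ ⟨_, ⟨l₁, h₁, h₂, h₃, rfl⟩, _, ⟨l₂, h₁', h₂', h₃', rfl⟩, rfl⟩
  refine ⟨l₁ ++ l₂, ?_, by simp [h₂, h₂'], by simp [h₃, h₃'], by simp⟩
  intro c hc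
  rcases List.mem_append.1 hc with hc | hc
  exacts [h₁ c hc, h₁' c hc]

theorem mul_ceGen_comm {n q : ℤ} {a : g.CE} {η : Module.Dual K L} (ha : a ∈ g.ceGr n)
    (hη : η ∈ g.dualGr q) :
    a * g.ceGen η = (n * (1 - q)).negOnePow • (g.ceGen η * a) := by
  suffices h : ∀ k, g.biGr k n ≤ LinearMap.eqLocus (LinearMap.mulRight K (g.ceGen η))
      ((n * (1 - q)).negOnePow • LinearMap.mulLeft K (g.ceGen η)) by
    have := (iSup_le h : g.ceGr n ≤ _) ha
    simpa using this
  intro k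
  refine Submodule.span_le.2 ?_
  rintro _ ⟨l, hl, -, rfl, rfl⟩
  simp only [SetLike.mem_coe, LinearMap.mem_eqLocus, LinearMap.mulRight_apply,
    LinearMap.smul_apply, LinearMap.mulLeft_apply]
  clear k ha a
  induction l with
  | nil => simp
  | cons c l ih =>
    have ih := ih fun c' hc' => hl c' (List.mem_cons_of_mem _ hc')
    have hc := hl c (List.mem_cons_self)
    simp only [List.map_cons, List.prod_cons, List.sum_cons]
    rw [mul_assoc, ih, mul_smul_comm, ← mul_assoc, g.ceGen_comm hc hη, smul_mul_assoc, smul_smul,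
      add_mul, Int.negOnePow_add, mul_comm ((_ : ℤ).negOnePow) ((_ : ℤ).negOnePow), mul_assoc]

theorem ce_induction {P : g.CE → Prop} (hs : ∀ c : K, P (algebraMap K g.CE c))
    (hg : ∀ ξ, P (g.ceGen ξ)) (hm : ∀ a b, P a → P b → P (a * b))
    (ha : ∀ a b, P a → P b → P (a + b)) (a : g.CE) : P a := by
  obtain ⟨t, rfl⟩ := RingQuot.mkAlgHom_surjective K g.CERel a
  induction t using TensorAlgebra.induction with
  | algebraMap c => exact (AlgHom.commutes (RingQuot.mkAlgHom K g.CERel) c).symm ▸ hs c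
  | ι ξ => exact hg ξ
  | mul a b iha ihb => rw [map_mul]; exact hm _ _ iha ihb
  | add a b iha ihb => rw [map_add]; exact ha _ _ iha ihb

section Basis

variable [FiniteDimensional K L]

/-- Index set of a homogeneous basis of `𝔤`; the first component of an index is the degree of the
basis vector. -/
abbrev Idx : Type := Σ p : ℤ, Fin (Module.finrank K (g.gr p))

/-- A homogeneous basis `e` of `𝔤`. -/
def basis : Module.Basis g.Idx K L :=
  g.internal.collectedBasis fun p => Module.finBasis K (g.gr p)

instance : Fintype g.Idx := FiniteDimensional.fintypeBasisIndex g.basis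

theorem basis_mem (i : g.Idx) : g.basis i ∈ g.gr i.1 :=
  g.internal.collectedBasis_mem (fun p => Module.finBasis K (g.gr p)) i

/-- The dual basis vector `e^i`, a linear form supported on the degree of `e_i`. -/
theorem coord_mem (i : g.Idx) : g.basis.coord i ∈ g.dualGr i.1 := by
  intro q hq x hx
  obtain ⟨p, i⟩ := i
  exact g.internal.collectedBasis_repr_of_mem_ne (fun p => Module.finBasis K (g.gr p)) hq hx

/-- The generator `η^i = e^i[-1]` of `C(𝔤)`, of degree `1 - |e_i|`. -/
def eta (i : g.Idx) : g.CE := g.ceGen (g.basis.coord i)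

theorem eta_mem (i : g.Idx) : g.eta i ∈ g.biGr 1 (1 - i.1) := g.ceGen_mem_biGr (g.coord_mem i)

theorem apply_basis_eq_zero {p : ℤ} {ξ : Module.Dual K L} (hξ : ξ ∈ g.dualGr p) {i : g.Idx}
    (hi : i.1 ≠ p) : ξ (g.basis i) = 0 := hξ _ hi _ (g.basis_mem i)

theorem ceGen_eq_sum (ξ : Module.Dual K L) :
    g.ceGen ξ = ∑ i, ξ (g.basis i) • g.eta i := by
  have h : ξ = ∑ i, ξ (g.basis i) • g.basis.coord i := by
    refine g.basis.ext fun j => ?_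
    simp
  conv_lhs => rw [h, map_sum]
  exact Finset.sum_congr rfl fun i _ => map_smul _ _ _

/-- On generators, `parity s` multiplies an element of degree `n` by `(-1)^(s n)`. -/
def parityGen (s : ℤ) : Module.Dual K L →ₗ[K] g.CE :=
  ∑ i : g.Idx, (s * (1 - i.1)).negOnePow •
    (LinearMap.applyₗ (R := K) (M₂ := K) (g.basis i)).smulRight (g.eta i)

theorem parityGen_apply (s : ℤ) {p : ℤ} {ξ : Module.Dual K L} (hξ : ξ ∈ g.dualGr p) :
    g.parityGen s ξ = (s * (1 - p)).negOnePow • g.ceGen ξ := by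
  rw [ceGen_eq_sum, Finset.smul_sum, parityGen, LinearMap.sum_apply]
  refine Finset.sum_congr rfl fun i _ => ?_
  by_cases hi : i.1 = p
  · simp [hi]
  · simp [g.apply_basis_eq_zero hξ hi]

/-- The algebra automorphism of `C(𝔤)` that multiplies an element of degree `n` by
`(-1)^(s n)`. -/
def parity (s : ℤ) : g.CE →ₐ[K] g.CE :=
  RingQuot.liftAlgHom K ⟨TensorAlgebra.lift K (g.parityGen s), by
    rintro _ _ ⟨hξ, hη⟩
    rw [Units.smul_def, map_zsmul, ← Units.smul_def]
    simp only [map_mul, TensorAlgebra.lift_ι_apply, g.parityGen_apply s hξ,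
      g.parityGen_apply s hη, smul_mul_smul_comm]
    rw [g.ceGen_comm hξ hη, smul_comm, mul_comm (Int.negOnePow _)]⟩

theorem parity_ceGen (s : ℤ) (ξ : Module.Dual K L) :
    g.parity s (g.ceGen ξ) = g.parityGen s ξ := by
  refine (RingQuot.liftAlgHom_mkAlgHom_apply K _ _ _).trans ?_
  simp

/-- The linear map `ξ ↦ [[parity s ξ, v ξ], [0, ξ]]`. -/
def derMatrixGen (s : ℤ) (v : Module.Dual K L →ₗ[K] g.CE) :
    Module.Dual K L →ₗ[K] Matrix (Fin 2) (Fin 2) g.CE where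
  toFun ξ := !![g.parityGen s ξ, v ξ; 0, g.ceGen ξ]
  map_add' ξ η := by ext i j; fin_cases i <;> fin_cases j <;> simp
  map_smul' c ξ := by ext i j; fin_cases i <;> fin_cases j <;> simp

/-- The algebra map `a ↦ [[parity s a, D a], [0, a]]`, where `D` is the derivation of degree `s`
of `C(𝔤)` whose values on generators are given by `v`. -/
def derMatrix (s : ℤ) (v : Module.Dual K L →ₗ[K] g.CE)
    (hv : ∀ p, ∀ ξ ∈ g.dualGr p, v ξ ∈ g.ceGr (1 - p + s)) :
    g.CE →ₐ[K] Matrix (Fin 2) (Fin 2) g.CE :=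
  RingQuot.liftAlgHom K ⟨TensorAlgebra.lift K (g.derMatrixGen s v), by
    rintro _ _ ⟨hξ, hη⟩
    rename_i p q ξ η
    rw [Units.smul_def, map_zsmul, ← Units.smul_def]
    simp only [map_mul, TensorAlgebra.lift_ι_apply, derMatrixGen, LinearMap.coe_mk, AddHom.coe_mk,
      g.parityGen_apply s hξ, g.parityGen_apply s hη]
    have h₁ := g.mul_ceGen_comm (hv _ _ hξ) hη
    have h₂ := g.mul_ceGen_comm (hv _ _ hη) hξ
    have h₃ := g.ceGen_comm hξ hη
    ext i j
    fin_cases i <;> fin_cases j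
    · simp only [Matrix.mul_fin_two, Fin.zero_eta, Matrix.of_apply, Matrix.cons_val', Matrix.cons_val_zero,
        mul_zero, add_zero, smul_mul_smul_comm, h₃, Matrix.smul_apply, Matrix.cons_val_fin_one]
      rw [smul_comm, mul_comm (Int.negOnePow _)]
    · simp only [Matrix.mul_fin_two, Matrix.smul_apply, Fin.zero_eta, Fin.mk_one, Matrix.of_apply,
        Matrix.cons_val', Matrix.cons_val_one, Matrix.cons_val_zero, Matrix.cons_val_fin_one, h₁, h₂,
        smul_mul_assoc, smul_add, smul_smul, ← Int.negOnePow_add]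
      rw [add_comm]
      congr 2 <;> rw [Int.negOnePow_eq_iff]
      · exact ⟨0, by ring⟩
      · exact ⟨-((1 - p) * (1 - q)), by ring⟩
    · simp
    · simp [h₃]⟩

theorem derMatrix_ceGen (s : ℤ) (v : Module.Dual K L →ₗ[K] g.CE)
    (hv : ∀ p, ∀ ξ ∈ g.dualGr p, v ξ ∈ g.ceGr (1 - p + s)) (ξ : Module.Dual K L) :
    g.derMatrix s v hv (g.ceGen ξ) = !![g.parityGen s ξ, v ξ; 0, g.ceGen ξ] := by
  refine (RingQuot.liftAlgHom_mkAlgHom_apply K _ _ _).trans ?_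
  simp [derMatrixGen]

/-- The derivation of degree `s` of `C(𝔤)` with prescribed values on generators. -/
def der (s : ℤ) (v : Module.Dual K L →ₗ[K] g.CE)
    (hv : ∀ p, ∀ ξ ∈ g.dualGr p, v ξ ∈ g.ceGr (1 - p + s)) : g.CE →ₗ[K] g.CE :=
  Matrix.entryLinearMap K g.CE (0 : Fin 2) (1 : Fin 2) ∘ₗ (g.derMatrix s v hv).toLinearMap

theorem der_ceGen (s : ℤ) (v : Module.Dual K L →ₗ[K] g.CE)
    (hv : ∀ p, ∀ ξ ∈ g.dualGr p, v ξ ∈ g.ceGr (1 - p + s)) (ξ : Module.Dual K L) :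
    g.der s v hv (g.ceGen ξ) = v ξ := by
  simp [der, derMatrix_ceGen]

theorem derMatrix_apply (s : ℤ) (v : Module.Dual K L →ₗ[K] g.CE)
    (hv : ∀ p, ∀ ξ ∈ g.dualGr p, v ξ ∈ g.ceGr (1 - p + s)) (a : g.CE) :
    g.derMatrix s v hv a = !![g.parity s a, g.der s v hv a; 0, a] := by
  suffices h : g.derMatrix s v hv a 0 0 = g.parity s a ∧ g.derMatrix s v hv a 1 0 = 0 ∧
      g.derMatrix s v hv a 1 1 = a by
    ext i j
    fin_cases i <;> fin_cases j
    exacts [h.1, rfl, h.2.1, h.2.2]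
  induction a using g.ce_induction with
  | hs c => simp [AlgHom.commutes, Matrix.algebraMap_matrix_apply]
  | hg ξ => simp [derMatrix_ceGen, parity_ceGen]
  | hm a b ha hb => simp [Matrix.mul_apply, ha, hb]
  | ha a b ha hb => simp [ha, hb]

/-- The graded Leibniz rule. -/
theorem der_mul (s : ℤ) (v : Module.Dual K L →ₗ[K] g.CE)
    (hv : ∀ p, ∀ ξ ∈ g.dualGr p, v ξ ∈ g.ceGr (1 - p + s)) (a b : g.CE) :
    g.der s v hv (a * b) = g.der s v hv a * b + g.parity s a * g.der s v hv b := by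
  have h := congrFun (congrFun (map_mul (g.derMatrix s v hv) a b) 0) 1
  rw [derMatrix_apply, derMatrix_apply, derMatrix_apply] at h
  simpa [Matrix.mul_apply, add_comm] using h

theorem parity_apply (s : ℤ) {n : ℤ} {a : g.CE} (ha : a ∈ g.ceGr n) :
    g.parity s a = (s * n).negOnePow • a := by
  suffices h : ∀ k, g.biGr k n ≤ LinearMap.eqLocus (g.parity s).toLinearMap
      ((s * n).negOnePow • LinearMap.id) by
    simpa using (iSup_le h : g.ceGr n ≤ _) ha
  intro k
  refine Submodule.span_le.2 ?_
  rintro _ ⟨l, hl, -, rfl, rfl⟩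
  simp only [SetLike.mem_coe, LinearMap.mem_eqLocus, LinearMap.smul_apply, LinearMap.id_apply,
    AlgHom.toLinearMap_apply]
  clear k ha a
  induction l with
  | nil => simp
  | cons c l ih =>
    have ih := ih fun c' hc' => hl c' (List.mem_cons_of_mem _ hc')
    simp only [List.map_cons, List.prod_cons, List.sum_cons, map_mul]
    rw [ih, parity_ceGen, g.parityGen_apply s (hl c List.mem_cons_self), smul_mul_smul_comm,
      mul_add, Int.negOnePow_add]

/-- The Chevalley-Eilenberg differential on generators. With `η^i = e^i[-1]` for a homogeneous
basis `e`, the first sum is `d₀` (the dual of `d`) and the second one is `d₁` (the dual of the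
bracket). The signs are those for which `ι_x d₀ ξ = (-1)^{|x|} ι_{d x} ξ` and
`ι_x ι_y d₁ ξ = (-1)^{|y|} ι_{[x, y]} ξ` on generators, where `ι_x` denotes contraction with `x[1]`,
`ι_x (ξ[-1]) = ξ x`. -/
def ceDGen : Module.Dual K L →ₗ[K] g.CE :=
  ∑ i : g.Idx, i.1.negOnePow •
    (LinearMap.applyₗ (R := K) (M₂ := K) (g.d (g.basis i))).smulRight (g.eta i) +
  (2⁻¹ : K) • ∑ i : g.Idx, ∑ j : g.Idx, i.1.negOnePow •
    (LinearMap.applyₗ (R := K) (M₂ := K) (g.bracket (g.basis j) (g.basis i))).smulRight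
      (g.eta i * g.eta j)

theorem ceDGen_mem : ∀ p, ∀ ξ ∈ g.dualGr p, g.ceDGen ξ ∈ g.ceGr (1 - p + 1) := by
  intro p ξ hξ
  simp only [ceDGen, LinearMap.add_apply, LinearMap.smul_apply, LinearMap.sum_apply,
    LinearMap.smulRight_apply, LinearMap.applyₗ_apply_apply, Units.smul_def]
  refine add_mem (sum_mem fun i _ => zsmul_mem ?_ _)
    (Submodule.smul_mem _ _ (sum_mem fun i _ => sum_mem fun j _ => zsmul_mem ?_ _))
  · by_cases h : i.1 + 1 = p
    · refine Submodule.smul_mem _ _ (g.biGr_le_ceGr 1 _ ?_)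
      have := g.eta_mem i
      rwa [show 1 - p + 1 = 1 - i.1 by omega]
    · rw [hξ _ h _ (g.d_mem (g.basis_mem i)), zero_smul]
      exact zero_mem _
  · by_cases h : j.1 + i.1 = p
    · refine Submodule.smul_mem _ _ (g.biGr_le_ceGr (1 + 1) _ ?_)
      have := g.mul_mem_biGr (g.eta_mem i) (g.eta_mem j)
      rwa [show 1 - p + 1 = 1 - i.1 + (1 - j.1) by omega]
    · rw [hξ _ h _ (g.bracket_mem (g.basis_mem j) (g.basis_mem i)), zero_smul]
      exact zero_mem _

/-- The Chevalley-Eilenberg differential `d_CE = d₀ + d₁` of `C(𝔤)`. -/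
def ceD : g.CE →ₗ[K] g.CE := g.der 1 g.ceDGen g.ceDGen_mem

theorem contrGen_mem (i : g.Idx) : ∀ p, ∀ ξ ∈ g.dualGr p,
    (LinearMap.applyₗ (R := K) (M₂ := K) (g.basis i)).smulRight (1 : g.CE) ξ ∈
      g.ceGr (1 - p + (i.1 - 1)) := by
  intro p ξ hξ
  simp only [LinearMap.smulRight_apply, LinearMap.applyₗ_apply_apply]
  by_cases h : i.1 = p
  · rw [show 1 - p + (i.1 - 1) = 0 by omega]
    exact Submodule.smul_mem _ _ (g.biGr_le_ceGr 0 0 g.one_mem_biGr)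
  · rw [g.apply_basis_eq_zero hξ h, zero_smul]
    exact zero_mem _

/-- The contraction `ι_{x[1]}` on `C(𝔤)`: linear in `x`, and for homogeneous `x` the derivation of
degree `|x| - 1` with `ι_{x[1]} (ξ[-1]) = ξ x`. -/
def contr : L →ₗ[K] g.CE →ₗ[K] g.CE :=
  ∑ i : g.Idx, (g.basis.coord i).smulRight (g.der (i.1 - 1) _ (g.contrGen_mem i))

theorem contr_ceGen (x : L) (ξ : Module.Dual K L) :
    g.contr x (g.ceGen ξ) = algebraMap K g.CE (ξ x) := by
  simp only [contr, LinearMap.sum_apply, LinearMap.smulRight_apply, LinearMap.smul_apply,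
    der_ceGen, LinearMap.applyₗ_apply_apply, smul_smul, ← Finset.sum_smul]
  rw [Algebra.algebraMap_eq_smul_one]
  congr 1
  have h := congrArg ξ (g.basis.sum_repr x)
  rw [map_sum] at h
  simpa only [map_smul, smul_eq_mul, Module.Basis.coord_apply] using h

theorem contr_mul {p : ℤ} {x : L} (hx : x ∈ g.gr p) (a b : g.CE) :
    g.contr x (a * b) = g.contr x a * b + g.parity (p - 1) a * g.contr x b := by
  simp only [contr, LinearMap.sum_apply, LinearMap.smulRight_apply, LinearMap.smul_apply, der_mul,
    smul_add, Finset.sum_add_distrib, Finset.sum_mul, Finset.mul_sum, smul_mul_assoc,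
    mul_smul_comm]
  congr 1
  refine Finset.sum_congr rfl fun i _ => ?_
  by_cases h : p = i.1
  · subst h; rfl
  · rw [g.coord_mem i p h x hx, zero_smul, zero_smul]

end Basis


section Cochains

variable {V : Type w} [AddCommGroup V] [Module K V]

/-- The underlying space `C(𝔤) ⊗ V` of `C(𝔤, V)`. -/
abbrev Coch (V : Type w) [AddCommGroup V] [Module K V] : Type (max u v w) := g.CE ⊗[K] V

/-- The degree `n` part of `C(𝔤, V)`, for a graded vector space `(V, 𝒱)`. -/
def cochGr (𝒱 : ℤ → Submodule K V) (n : ℤ) : Submodule K (g.Coch V) :=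
  Submodule.span K {z | ∃ p q : ℤ, ∃ a ∈ g.ceGr p, ∃ x ∈ 𝒱 q, p + q = n ∧ z = a ⊗ₜ[K] x}

/-- The weight `k` part `C^k(𝔤, V) = S^k(𝔤^∨[-1]) ⊗ V`. -/
def cochWt (V : Type w) [AddCommGroup V] [Module K V] (k : ℕ) : Submodule K (g.Coch V) :=
  Submodule.span K {z | ∃ a ∈ g.ceWt k, ∃ x : V, z = a ⊗ₜ[K] x}

theorem one_mem_ceGr : (1 : g.CE) ∈ g.ceGr 0 := g.biGr_le_ceGr 0 0 g.one_mem_biGr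

theorem one_mem_ceWt : (1 : g.CE) ∈ g.ceWt 0 := g.biGr_le_ceWt 0 0 g.one_mem_biGr

theorem tmul_mem_cochGr {𝒱 : ℤ → Submodule K V} {p q n : ℤ} {a : g.CE} {x : V}
    (ha : a ∈ g.ceGr p) (hx : x ∈ 𝒱 q) (h : p + q = n) : a ⊗ₜ[K] x ∈ g.cochGr 𝒱 n :=
  Submodule.subset_span ⟨p, q, a, ha, x, hx, h, rfl⟩

theorem tmul_mem_cochWt {k : ℕ} {a : g.CE} (ha : a ∈ g.ceWt k) (x : V) :
    a ⊗ₜ[K] x ∈ g.cochWt V k :=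
  Submodule.subset_span ⟨a, ha, x, rfl⟩

theorem mul_mem_ceGr {m n : ℤ} {a b : g.CE} (ha : a ∈ g.ceGr m) (hb : b ∈ g.ceGr n) :
    a * b ∈ g.ceGr (m + n) := by
  have h := Submodule.mul_mem_mul ha hb
  rw [ceGr, ceGr, Submodule.iSup_mul] at h
  refine (iSup_le fun k => ?_ : _ ≤ g.ceGr (m + n)) h
  rw [Submodule.mul_iSup]
  refine iSup_le fun l => Submodule.mul_le.2 fun x hx y hy => ?_
  exact g.biGr_le_ceGr _ _ (g.mul_mem_biGr hx hy)

theorem mul_mem_ceWt {k l : ℕ} {a b : g.CE} (ha : a ∈ g.ceWt k) (hb : b ∈ g.ceWt l) :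
    a * b ∈ g.ceWt (k + l) := by
  have h := Submodule.mul_mem_mul ha hb
  rw [ceWt, ceWt, Submodule.iSup_mul] at h
  refine (iSup_le fun k => ?_ : _ ≤ g.ceWt _) h
  rw [Submodule.mul_iSup]
  refine iSup_le fun l => Submodule.mul_le.2 fun x hx y hy => ?_
  exact g.biGr_le_ceWt _ _ (g.mul_mem_biGr hx hy)

theorem smul_mem_cochGr {𝒱 : ℤ → Submodule K V} {m n : ℤ} {a : g.CE} {z : g.Coch V}
    (ha : a ∈ g.ceGr m) (hz : z ∈ g.cochGr 𝒱 n) : a • z ∈ g.cochGr 𝒱 (m + n) := by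
  have : g.cochGr 𝒱 n ≤ (g.cochGr 𝒱 (m + n)).comap (Algebra.lsmul K K (g.Coch V) a) := by
    refine Submodule.span_le.2 ?_
    rintro _ ⟨p, q, b, hb, x, hx, rfl, rfl⟩
    exact g.tmul_mem_cochGr (g.mul_mem_ceGr ha hb) hx (by ring)
  exact this hz

theorem smul_mem_cochWt {k l : ℕ} {a : g.CE} {z : g.Coch V}
    (ha : a ∈ g.ceWt k) (hz : z ∈ g.cochWt V l) : a • z ∈ g.cochWt V (k + l) := by
  have : g.cochWt V l ≤ (g.cochWt V (k + l)).comap (Algebra.lsmul K K (g.Coch V) a) := by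
    refine Submodule.span_le.2 ?_
    rintro _ ⟨b, hb, x, rfl⟩
    exact g.tmul_mem_cochWt (g.mul_mem_ceWt ha hb) x
  exact this hz

variable {W : Type*} [AddCommGroup W] [Module K W] {X : Type*} [AddCommGroup X] [Module K X]

/-- The `C(𝔤)`-linear extension `a ⊗ x ↦ a • u x` of a linear map `u : V → C(𝔤, W)`. -/
def extend (u : V →ₗ[K] g.Coch W) : g.Coch V →ₗ[K] g.Coch W :=
  TensorProduct.lift (LinearMap.mk₂ K (fun a x => a • u x) (fun a b x => add_smul a b (u x))
    (fun c a x => smul_assoc c a (u x)) (fun a x y => by rw [map_add, smul_add])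
    (fun c a x => by rw [map_smul, smul_comm]))

@[simp] theorem extend_tmul (u : V →ₗ[K] g.Coch W) (a : g.CE) (x : V) :
    g.extend u (a ⊗ₜ[K] x) = a • u x := rfl

theorem extend_smul (u : V →ₗ[K] g.Coch W) (a : g.CE) (z : g.Coch V) :
    g.extend u (a • z) = a • g.extend u z := by
  induction z using TensorProduct.induction_on with
  | zero => simp
  | add y z hy hz => rw [smul_add, map_add, map_add, smul_add, hy, hz]
  | tmul b x => simp [TensorProduct.smul_tmul', mul_smul]

/-- `C(𝔤)`-linear extension is compatible with composition. -/
theorem extend_extend (t : W →ₗ[K] g.Coch X) (u : V →ₗ[K] g.Coch W) (z : g.Coch V) :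
    g.extend (g.extend t ∘ₗ u) z = g.extend t (g.extend u z) := by
  induction z using TensorProduct.induction_on with
  | zero => simp
  | add y z hy hz => rw [map_add, map_add, map_add, hy, hz]
  | tmul a x => simp [extend_smul]

theorem extend_mem_cochWt {k l : ℕ} {u : V →ₗ[K] g.Coch W} (hu : ∀ x, u x ∈ g.cochWt W k)
    {z : g.Coch V} (hz : z ∈ g.cochWt V l) : g.extend u z ∈ g.cochWt W (l + k) := by
  have : g.cochWt V l ≤ (g.cochWt W (l + k)).comap (g.extend u) := by
    refine Submodule.span_le.2 ?_
    rintro _ ⟨b, hb, x, rfl⟩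
    exact g.smul_mem_cochWt hb (hu x)
  exact this hz

theorem extend_mem_cochGr {𝒱 : ℤ → Submodule K V} {𝒲 : ℤ → Submodule K W} {r n : ℤ}
    {u : V →ₗ[K] g.Coch W} (hu : ∀ q, ∀ x ∈ 𝒱 q, u x ∈ g.cochGr 𝒲 (q + r))
    {z : g.Coch V} (hz : z ∈ g.cochGr 𝒱 n) : g.extend u z ∈ g.cochGr 𝒲 (n + r) := by
  have : g.cochGr 𝒱 n ≤ (g.cochGr 𝒲 (n + r)).comap (g.extend u) := by
    refine Submodule.span_le.2 ?_
    rintro _ ⟨p, q, b, hb, x, hx, rfl, rfl⟩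
    have := g.smul_mem_cochGr hb (hu q x hx)
    rwa [← add_assoc] at this
  exact this hz

/-- A locally finite family of linear maps `u_k : V → C^k(𝔤, W)`, `k ≥ 0`, of degree `r`. -/
@[ext] structure LFMap (𝒱 : ℤ → Submodule K V) (𝒲 : ℤ → Submodule K W) (r : ℤ) where
  /-- the weight `k` component -/
  comp : ℕ → V →ₗ[K] g.Coch W
  comp_mem_wt : ∀ k x, comp k x ∈ g.cochWt W k
  comp_mem_gr : ∀ k n, ∀ x ∈ 𝒱 n, comp k x ∈ g.cochGr 𝒲 (n + r)
  locallyFinite : ∀ x, ∃ N, ∀ k ≥ N, comp k x = 0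

namespace LFMap

variable {g} {𝒱 : ℤ → Submodule K V} {𝒲 : ℤ → Submodule K W} {𝒳 : ℤ → Submodule K X} {r s : ℤ}

theorem finite_support (u : g.LFMap 𝒱 𝒲 r) (x : V) :
    (Function.support fun k => u.comp k x).Finite := by
  obtain ⟨N, hN⟩ := u.locallyFinite x
  refine (Set.finite_Iio N).subset fun k hk => ?_
  by_contra h
  exact hk (hN k (not_lt.1 h))

/-- The sum `∑ u_k : V → C(𝔤, W)`. -/
def total (u : g.LFMap 𝒱 𝒲 r) : V →ₗ[K] g.Coch W where
  toFun x := ∑ᶠ k, u.comp k x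
  map_add' x y := by
    simp only [map_add]
    exact finsum_add_distrib (u.finite_support x) (u.finite_support y)
  map_smul' c x := by
    simp only [map_smul, RingHom.id_apply]
    exact (smul_finsum' c (u.finite_support x)).symm

theorem total_eq_sum (u : g.LFMap 𝒱 𝒲 r) {x : V} {N : ℕ} (hN : ∀ k ≥ N, u.comp k x = 0) :
    u.total x = ∑ k ∈ Finset.range N, u.comp k x := by
  refine finsum_eq_sum_of_support_subset _ fun k hk => ?_
  by_contra h
  exact hk (hN k (by simpa using h))

/-- The `C(𝔤)`-linear extension `id ⊗ ∑ u_k : C(𝔤, V) → C(𝔤, W)` of a family of degree `0`. -/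
def lin (u : g.LFMap 𝒱 𝒲 0) : g.Coch V →ₗ[K] g.Coch W := g.extend u.total


theorem exists_extend_total (t : g.LFMap 𝒲 𝒳 r) (z : g.Coch W) :
    ∃ N, ∀ M ≥ N, (∀ j ≥ M, g.extend (t.comp j) z = 0) ∧
      g.extend t.total z = ∑ j ∈ Finset.range M, g.extend (t.comp j) z := by
  induction z using TensorProduct.induction_on with
  | zero => exact ⟨0, by simp⟩
  | tmul a x =>
    obtain ⟨N, hN⟩ := t.locallyFinite x
    refine ⟨N, fun M hM => ⟨fun j hj => ?_, ?_⟩⟩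
    · rw [extend_tmul, hN j (hM.trans hj), smul_zero]
    · simp only [extend_tmul, t.total_eq_sum fun k hk => hN k (le_trans hM hk), Finset.smul_sum]
  | add y z hy hz =>
    obtain ⟨N₁, h₁⟩ := hy
    obtain ⟨N₂, h₂⟩ := hz
    refine ⟨max N₁ N₂, fun M hM => ?_⟩
    obtain ⟨h₁, h₁'⟩ := h₁ M (le_trans (le_max_left _ _) hM)
    obtain ⟨h₂, h₂'⟩ := h₂ M (le_trans (le_max_right _ _) hM)
    refine ⟨fun j hj => ?_, ?_⟩
    · rw [map_add, h₁ j hj, h₂ j hj, add_zero]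
    · simp only [map_add, Finset.sum_add_distrib, h₁', h₂']

theorem exists_bounds (t : g.LFMap 𝒲 𝒳 s) (u : g.LFMap 𝒱 𝒲 r) (x : V) :
    ∃ M N, (∀ i ≥ M, u.comp i x = 0) ∧ (∀ i, ∀ j ≥ N, g.extend (t.comp j) (u.comp i x) = 0) ∧
      ∀ i, g.extend t.total (u.comp i x) =
        ∑ j ∈ Finset.range N, g.extend (t.comp j) (u.comp i x) := by
  obtain ⟨M, hM⟩ := u.locallyFinite x
  choose N hN using fun i => t.exists_extend_total (u.comp i x)
  refine ⟨M, (Finset.range M).sup N, hM, ?_⟩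
  rw [← forall_and]
  intro i
  by_cases hi : i < M
  · exact hN i _ (Finset.le_sup (Finset.mem_range.2 hi))
  · simp [hM i (not_lt.1 hi)]

/-- Composition of locally finite families: `(t ∘ u)_k = ∑_{i + j = k} (id ⊗ t_j) ∘ u_i`. -/
def compose (t : g.LFMap 𝒲 𝒳 0) (u : g.LFMap 𝒱 𝒲 0) : g.LFMap 𝒱 𝒳 0 where
  comp k := ∑ p ∈ Finset.HasAntidiagonal.antidiagonal k, g.extend (t.comp p.2) ∘ₗ u.comp p.1
  comp_mem_wt k x := by
    rw [LinearMap.sum_apply]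
    refine sum_mem fun p hp => ?_
    rw [← Finset.HasAntidiagonal.mem_antidiagonal.1 hp]
    exact g.extend_mem_cochWt (t.comp_mem_wt p.2) (u.comp_mem_wt p.1 x)
  comp_mem_gr k n x hx := by
    rw [LinearMap.sum_apply]
    refine sum_mem fun p hp => ?_
    have := g.extend_mem_cochGr (t.comp_mem_gr p.2) (u.comp_mem_gr p.1 n x hx)
    rwa [add_zero] at this
  locallyFinite x := by
    obtain ⟨M, N, hM, hN, -⟩ := t.exists_bounds u x
    refine ⟨M + N, fun k hk => ?_⟩
    rw [LinearMap.sum_apply]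
    refine Finset.sum_eq_zero fun p hp => ?_
    have hp := Finset.HasAntidiagonal.mem_antidiagonal.1 hp
    rw [LinearMap.comp_apply]
    by_cases h : p.1 < M
    · exact hN _ _ (by omega)
    · rw [hM _ (not_lt.1 h), map_zero]

theorem total_compose (t : g.LFMap 𝒲 𝒳 0) (u : g.LFMap 𝒱 𝒲 0) (x : V) :
    (t.compose u).total x = g.extend t.total (u.total x) := by
  obtain ⟨M, N, hM, hN, hT⟩ := t.exists_bounds u x
  have h₀ : ∀ i j, ¬ (i < M ∧ j < N) → g.extend (t.comp j) (u.comp i x) = 0 := by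
    intro i j h
    by_cases hi : i < M
    · exact hN _ _ (by omega)
    · rw [hM _ (not_lt.1 hi), map_zero]
  have h₁ : ∀ k ≥ M + N, (t.compose u).comp k x = 0 := by
    intro k hk
    refine (LinearMap.sum_apply _ _ _).trans (Finset.sum_eq_zero fun p hp => h₀ _ _ ?_)
    have := Finset.HasAntidiagonal.mem_antidiagonal.1 hp
    omega
  rw [total_eq_sum _ h₁, total_eq_sum _ hM, map_sum]
  simp only [hT]
  rw [← Finset.sum_product', ← Finset.sum_fiberwise_of_maps_to (t := Finset.range (M + N))
    (g := fun p : ℕ × ℕ => p.1 + p.2)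
    (fun p hp => by simp only [Finset.mem_product, Finset.mem_range] at hp ⊢; omega)]
  refine Finset.sum_congr rfl fun k _ => ?_
  refine (LinearMap.sum_apply _ _ _).trans (Finset.sum_subset ?_ ?_).symm
  · intro p hp
    simpa using (Finset.mem_filter.1 hp).2
  · intro p hp hp'
    refine h₀ _ _ fun h => hp' ?_
    simpa using ⟨h, Finset.HasAntidiagonal.mem_antidiagonal.1 hp⟩

theorem lin_compose (t : g.LFMap 𝒲 𝒳 0) (u : g.LFMap 𝒱 𝒲 0) (z : g.Coch V) :
    (t.compose u).lin z = t.lin (u.lin z) := by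
  rw [lin, lin, lin, ← extend_extend]
  congr 2
  exact LinearMap.ext fun x => t.total_compose u x

/-- The identity family: `x ↦ 1 ⊗ x` in weight `0`. -/
def id (𝒱 : ℤ → Submodule K V) : g.LFMap 𝒱 𝒱 0 where
  comp k := if k = 0 then TensorProduct.mk K g.CE V 1 else 0
  comp_mem_wt k x := by
    split_ifs with h
    · subst h; exact g.tmul_mem_cochWt g.one_mem_ceWt x
    · exact zero_mem _
  comp_mem_gr k n x hx := by
    split_ifs with h
    · exact g.tmul_mem_cochGr g.one_mem_ceGr hx (by ring)
    · exact zero_mem _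
  locallyFinite x := ⟨1, fun k hk => by rw [if_neg (by omega)]; rfl⟩

theorem total_id (x : V) : (LFMap.id (g := g) 𝒱).total x = 1 ⊗ₜ[K] x := by
  rw [total_eq_sum (N := 1) _ fun k hk => by simp [id, show k ≠ 0 by omega]]
  simp [id]

theorem lin_id (z : g.Coch V) : (LFMap.id (g := g) 𝒱).lin z = z := by
  induction z using TensorProduct.induction_on with
  | zero => simp
  | add y z hy hz => rw [map_add, hy, hz]
  | tmul a x => simp [lin, total_id, TensorProduct.smul_tmul']

theorem extend_mk (z : g.Coch V) : g.extend (TensorProduct.mk K g.CE V 1) z = z := by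
  induction z using TensorProduct.induction_on with
  | zero => simp
  | add y z hy hz => rw [map_add, hy, hz]
  | tmul a x => simp [TensorProduct.smul_tmul']

theorem extend_zero (z : g.Coch V) : g.extend (0 : V →ₗ[K] g.Coch W) z = 0 := by
  induction z using TensorProduct.induction_on with
  | zero => simp
  | add y z hy hz => rw [map_add, hy, hz, add_zero]
  | tmul a x => simp

theorem id_compose (u : g.LFMap 𝒱 𝒲 0) : (LFMap.id 𝒲).compose u = u := by
  ext k x : 3
  refine (LinearMap.sum_apply _ _ _).trans ?_
  rw [Finset.sum_eq_single_of_mem (k, 0) (by simp)]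
  · exact extend_mk _
  · intro p hp hne
    have : p.2 ≠ 0 := fun h => hne (Prod.ext (by simpa [h] using hp) h)
    simp [id, this, extend_zero]

theorem compose_id (u : g.LFMap 𝒱 𝒲 0) : u.compose (LFMap.id 𝒱) = u := by
  ext k x : 3
  refine (LinearMap.sum_apply _ _ _).trans ?_
  rw [Finset.sum_eq_single_of_mem (0, k) (by simp)]
  · simp [id]
  · intro p hp hne
    have : p.1 ≠ 0 := fun h => hne (Prod.ext h (by simpa [h] using hp))
    simp [id, this]

theorem extend_sum {ι : Type*} (S : Finset ι) (f : ι → V →ₗ[K] g.Coch W) (z : g.Coch V) :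
    g.extend (∑ i ∈ S, f i) z = ∑ i ∈ S, g.extend (f i) z := by
  induction z using TensorProduct.induction_on with
  | zero => simp
  | add y z hy hz => simp only [map_add, hy, hz, Finset.sum_add_distrib]
  | tmul a x => simp [Finset.smul_sum]

theorem compose_assoc {Y : Type*} [AddCommGroup Y] [Module K Y] {𝒴 : ℤ → Submodule K Y}
    (t : g.LFMap 𝒳 𝒴 0) (s : g.LFMap 𝒲 𝒳 0) (u : g.LFMap 𝒱 𝒲 0) :
    (t.compose s).compose u = t.compose (s.compose u) := by
  ext k x : 3
  refine ((LinearMap.sum_apply _ _ _).trans ?_).trans (LinearMap.sum_apply _ _ _).symm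
  simp only [compose, LinearMap.comp_apply, LinearMap.sum_apply, map_sum, extend_sum,
    extend_extend]
  rw [Finset.sum_sigma', Finset.sum_sigma']
  refine Finset.sum_bij' (fun q _ => ⟨(q.1.1 + q.2.1, q.2.2), (q.1.1, q.2.1)⟩)
    (fun q _ => ⟨(q.2.1, q.2.2 + q.1.2), (q.2.2, q.1.2)⟩) ?_ ?_ ?_ ?_ ?_
  · rintro ⟨⟨a, d⟩, ⟨b, c⟩⟩ h
    simp only [Finset.mem_sigma, Finset.HasAntidiagonal.mem_antidiagonal] at h ⊢
    obtain ⟨h₁, h₂⟩ := h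
    exact ⟨by omega, by trivial⟩
  · rintro ⟨⟨a, d⟩, ⟨b, c⟩⟩ h
    simp only [Finset.mem_sigma, Finset.HasAntidiagonal.mem_antidiagonal] at h ⊢
    obtain ⟨h₁, h₂⟩ := h
    exact ⟨by omega, by trivial⟩
  · rintro ⟨⟨a, d⟩, ⟨b, c⟩⟩ h
    simp only [Finset.mem_sigma, Finset.HasAntidiagonal.mem_antidiagonal] at h
    obtain ⟨-, rfl⟩ := h
    rfl
  · rintro ⟨⟨a, d⟩, ⟨b, c⟩⟩ h
    simp only [Finset.mem_sigma, Finset.HasAntidiagonal.mem_antidiagonal] at h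
    obtain ⟨-, rfl⟩ := h
    rfl
  · intro q _
    rfl

end LFMap

section Differential

variable [FiniteDimensional K L] {𝒱 : ℤ → Submodule K V} {𝒲 : ℤ → Submodule K W}

/-- The operator `d_CE ⊗ id + ∑ id ⊗ d_k` on `C(𝔤, V)` determined by a locally finite family
`d_k : V → C^k(𝔤, V)` of degree `1`. By the Koszul sign rule
`(id ⊗ d_k) (a ⊗ x) = (-1)^{|a|} a • d_k x`. -/
def totalD (u : g.LFMap 𝒱 𝒱 1) : g.Coch V →ₗ[K] g.Coch V :=
  g.ceD.rTensor V + g.extend u.total ∘ₗ (g.parity 1).toLinearMap.rTensor V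

/-- `f` is an `∞`-morphism: its `C(𝔤)`-linear extension intertwines the total differentials. -/
def IsInftyHom (s : g.LFMap 𝒱 𝒱 1) (t : g.LFMap 𝒲 𝒲 1) (f : g.LFMap 𝒱 𝒲 0) : Prop :=
  ∀ z, f.lin (g.totalD s z) = g.totalD t (f.lin z)

/-- The structure maps of the adjoint module: `d_0 x = d x` and `d_1 x = ∑ η^i ⊗ [e_i, x]`, i.e.
`ι_{y[1]} d_1 x = [y, x]`. -/
def adjointComp : ℕ → L →ₗ[K] g.Coch L
  | 0 => TensorProduct.mk K g.CE L 1 ∘ₗ g.d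
  | 1 => ∑ i : g.Idx, TensorProduct.mk K g.CE L (g.eta i) ∘ₗ g.bracket (g.basis i)
  | _ + 2 => 0

/-- The adjoint module of `𝔤`. -/
def adjoint : g.LFMap g.gr g.gr 1 where
  comp := g.adjointComp
  comp_mem_wt k x := by
    match k with
    | 0 => exact g.tmul_mem_cochWt g.one_mem_ceWt _
    | 1 =>
      rw [adjointComp, LinearMap.sum_apply]
      refine sum_mem fun i _ => ?_
      exact g.tmul_mem_cochWt (g.biGr_le_ceWt _ _ (g.eta_mem i)) _
    | _ + 2 => exact zero_mem _
  comp_mem_gr k n x hx := by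
    match k with
    | 0 => exact g.tmul_mem_cochGr g.one_mem_ceGr (g.d_mem hx) (by ring)
    | 1 =>
      rw [adjointComp, LinearMap.sum_apply]
      refine sum_mem fun i _ => ?_
      exact g.tmul_mem_cochGr (g.biGr_le_ceGr _ _ (g.eta_mem i))
        (g.bracket_mem (g.basis_mem i) hx) (by ring)
    | _ + 2 => exact zero_mem _
  locallyFinite x := ⟨2, fun k hk => by
    obtain ⟨k, rfl⟩ := Nat.exists_eq_add_of_le' hk
    rfl⟩

/-- The contraction `ι_{z[1]}` on `C(𝔤, V)` along `z ∈ C(𝔤, 𝔤)`: for `z = ω ⊗ x` it is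
`a ⊗ m ↦ ω ι_{x[1]}(a) ⊗ m`. -/
def contrCoch (V : Type w) [AddCommGroup V] [Module K V] :
    g.Coch L →ₗ[K] g.Coch V →ₗ[K] g.Coch V :=
  TensorProduct.lift (LinearMap.mk₂ K
    (fun a x => Algebra.lsmul K K (g.Coch V) a ∘ₗ (g.contr x).rTensor V)
    (fun a b x => by rw [map_add, LinearMap.add_comp])
    (fun c a x => by rw [map_smul, LinearMap.smul_comp])
    (fun a x y => by rw [map_add, LinearMap.rTensor_add, LinearMap.comp_add])
    (fun c a x => by rw [map_smul, LinearMap.rTensor_smul, LinearMap.comp_smul]))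

theorem contrCoch_tmul (ω : g.CE) (x : L) (a : g.CE) (m : V) :
    g.contrCoch V (ω ⊗ₜ[K] x) (a ⊗ₜ[K] m) = (ω * g.contr x a) ⊗ₜ[K] m := rfl

end Differential

section Path

variable {𝒱 : ℤ → Submodule K V} {𝒲 : ℤ → Submodule K W}

/-- The grading of `J ⊗ V = V ⊕ V t ⊕ V dt`, where `t` has degree `0` and `dt` degree `1`. -/
def pathGr (𝒱 : ℤ → Submodule K V) (n : ℤ) : Submodule K (V × V × V) :=
  (𝒱 n).prod ((𝒱 n).prod (𝒱 (n - 1)))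

/-- The inclusion `V` of the first summand of `J ⊗ V`. -/
def pathIn₀ (V : Type w) [AddCommGroup V] [Module K V] : V →ₗ[K] V × V × V :=
  LinearMap.inl K V (V × V)
/-- The inclusion `V t` of the second summand of `J ⊗ V`. -/
def pathIn₁ (V : Type w) [AddCommGroup V] [Module K V] : V →ₗ[K] V × V × V :=
  LinearMap.inr K V (V × V) ∘ₗ LinearMap.inl K V V
/-- The inclusion `V dt` of the third summand of `J ⊗ V`. -/
def pathIn₂ (V : Type w) [AddCommGroup V] [Module K V] : V →ₗ[K] V × V × V :=
  LinearMap.inr K V (V × V) ∘ₗ LinearMap.inr K V V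

theorem lTensor_mem_cochWt (u : V →ₗ[K] W) {k : ℕ} {z : g.Coch V} (hz : z ∈ g.cochWt V k) :
    u.lTensor g.CE z ∈ g.cochWt W k := by
  have : g.cochWt V k ≤ (g.cochWt W k).comap (u.lTensor g.CE) := by
    refine Submodule.span_le.2 ?_
    rintro _ ⟨b, hb, x, rfl⟩
    exact g.tmul_mem_cochWt hb (u x)
  exact this hz

theorem lTensor_mem_cochGr (u : V →ₗ[K] W) {r : ℤ} (hu : ∀ q, ∀ x ∈ 𝒱 q, u x ∈ 𝒲 (q + r))
    {n : ℤ} {z : g.Coch V} (hz : z ∈ g.cochGr 𝒱 n) :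
    u.lTensor g.CE z ∈ g.cochGr 𝒲 (n + r) := by
  have : g.cochGr 𝒱 n ≤ (g.cochGr 𝒲 (n + r)).comap (u.lTensor g.CE) := by
    refine Submodule.span_le.2 ?_
    rintro _ ⟨p, q, b, hb, x, hx, rfl, rfl⟩
    exact g.tmul_mem_cochGr hb (hu q x hx) (by ring)
  exact this hz

variable [FiniteDimensional K L]

theorem parity_mem_ceWt {k : ℕ} {a : g.CE} (ha : a ∈ g.ceWt k) : g.parity 1 a ∈ g.ceWt k := by
  have : g.ceWt k ≤ (g.ceWt k).comap (g.parity 1).toLinearMap := by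
    refine iSup_le fun n x hx => ?_
    change g.parity 1 x ∈ g.ceWt k
    rw [g.parity_apply 1 (g.biGr_le_ceGr _ _ hx), Units.smul_def]
    exact zsmul_mem (g.biGr_le_ceWt _ _ hx) _
  exact this ha

/-- The operator `a ⊗ x ↦ (-1)^{|a|} a ⊗ x` on `C(𝔤, V)`. -/
def signCoch (V : Type w) [AddCommGroup V] [Module K V] : g.Coch V →ₗ[K] g.Coch V :=
  (g.parity 1).toLinearMap.rTensor V

theorem signCoch_mem_cochWt {k : ℕ} {z : g.Coch V} (hz : z ∈ g.cochWt V k) :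
    g.signCoch V z ∈ g.cochWt V k := by
  have : g.cochWt V k ≤ (g.cochWt V k).comap (g.signCoch V) := by
    refine Submodule.span_le.2 ?_
    rintro _ ⟨b, hb, x, rfl⟩
    exact g.tmul_mem_cochWt (g.parity_mem_ceWt hb) x
  exact this hz

theorem signCoch_mem_cochGr {n : ℤ} {z : g.Coch V} (hz : z ∈ g.cochGr 𝒱 n) :
    g.signCoch V z ∈ g.cochGr 𝒱 n := by
  have : g.cochGr 𝒱 n ≤ (g.cochGr 𝒱 n).comap (g.signCoch V) := by
    refine Submodule.span_le.2 ?_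
    rintro _ ⟨p, q, b, hb, x, hx, rfl, rfl⟩
    change g.parity 1 b ⊗ₜ[K] x ∈ g.cochGr 𝒱 (p + q)
    rw [g.parity_apply 1 hb, Units.smul_def]
    exact g.tmul_mem_cochGr (zsmul_mem hb _) hx rfl
  exact this hz

/-- The structure maps of the path object `J(V) = V ⊕ V t ⊕ V dt` of a module with structure maps
`d_k`. On `x₀ + t x₁ + dt y` the map `d_0` is `d_0 x₀ + t d_0 x₁ + dt (x₁ - d_0 y)`, and for `k ≥ 1`
the map `d_k` is applied to the three components. Moving the odd element `dt` past `d_k` and past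
the coefficients in `C^k(𝔤)` gives the sign `a ⊗ y ↦ -(-1)^{|a|} a ⊗ y` in front of `d_k y`. -/
def pathComp (t : g.LFMap 𝒱 𝒱 1) (k : ℕ) : V × V × V →ₗ[K] g.Coch (V × V × V) :=
  let x₀ := LinearMap.fst K V (V × V)
  let x₁ := LinearMap.fst K V V ∘ₗ LinearMap.snd K V (V × V)
  let y := LinearMap.snd K V V ∘ₗ LinearMap.snd K V (V × V)
  (pathIn₀ V).lTensor g.CE ∘ₗ t.comp k ∘ₗ x₀ + (pathIn₁ V).lTensor g.CE ∘ₗ t.comp k ∘ₗ x₁ +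
    (pathIn₂ V).lTensor g.CE ∘ₗ
      ((if k = 0 then TensorProduct.mk K g.CE V 1 ∘ₗ x₁ else 0) - g.signCoch V ∘ₗ t.comp k ∘ₗ y)

/-- The path object `J(V)` of a module `V`. -/
def path (t : g.LFMap 𝒱 𝒱 1) : g.LFMap (pathGr 𝒱) (pathGr 𝒱) 1 where
  comp := g.pathComp t
  comp_mem_wt k x := by
    refine add_mem (add_mem (g.lTensor_mem_cochWt _ (t.comp_mem_wt _ _))
      (g.lTensor_mem_cochWt _ (t.comp_mem_wt _ _)))
      (g.lTensor_mem_cochWt _ (sub_mem ?_ (g.signCoch_mem_cochWt (t.comp_mem_wt _ _))))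
    split_ifs with h
    · subst h; exact g.tmul_mem_cochWt g.one_mem_ceWt _
    · exact zero_mem _
  comp_mem_gr k n x hx := by
    obtain ⟨h₀, h₁, h₂⟩ := hx
    have e : n + 1 = n - 1 + 1 + 1 := by ring
    have H := g.signCoch_mem_cochGr (t.comp_mem_gr k _ _ h₂)
    refine add_mem (add_mem ?_ ?_) ?_
    · rw [← add_zero (n + 1)]
      refine g.lTensor_mem_cochGr _ (fun q y hy => ?_) (t.comp_mem_gr k n _ h₀)
      rw [add_zero]
      exact ⟨hy, zero_mem _, zero_mem _⟩
    · rw [← add_zero (n + 1)]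
      refine g.lTensor_mem_cochGr _ (fun q y hy => ?_) (t.comp_mem_gr k n _ h₁)
      rw [add_zero]
      exact ⟨zero_mem _, hy, zero_mem _⟩
    · rw [e]
      refine g.lTensor_mem_cochGr (𝒱 := 𝒱) _ (fun q y hy => ?_) (sub_mem ?_ H)
      · refine ⟨zero_mem _, zero_mem _, ?_⟩
        rwa [add_sub_cancel_right]
      · split_ifs with h
        · exact g.tmul_mem_cochGr g.one_mem_ceGr h₁ (by ring)
        · exact zero_mem _
  locallyFinite x := by
    obtain ⟨N₀, h₀⟩ := t.locallyFinite x.1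
    obtain ⟨N₁, h₁⟩ := t.locallyFinite x.2.1
    obtain ⟨N₂, h₂⟩ := t.locallyFinite x.2.2
    refine ⟨N₀ + N₁ + N₂ + 1, fun k hk => ?_⟩
    simp [pathComp, h₀ k (by omega), h₁ k (by omega), h₂ k (by omega), show k ≠ 0 by omega]

/-- The evaluation `ε₀ (x₀ + t x₁ + dt y) = x₀`. -/
def pathEval₀ (V : Type w) [AddCommGroup V] [Module K V] : V × V × V →ₗ[K] V :=
  LinearMap.fst K V (V × V)

/-- The evaluation `ε₁ (x₀ + t x₁ + dt y) = x₀ + x₁`. -/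
def pathEval₁ (V : Type w) [AddCommGroup V] [Module K V] : V × V × V →ₗ[K] V :=
  LinearMap.fst K V (V × V) + LinearMap.fst K V V ∘ₗ LinearMap.snd K V (V × V)

/-- Two `∞`-morphisms `f, f' : V ⇝ W` are homotopic if there is an `∞`-morphism `H : V ⇝ J(W)`
with `ε₀ ∘ H = f` and `ε₁ ∘ H = f'`. -/
def Homotopic (s : g.LFMap 𝒱 𝒱 1) (t : g.LFMap 𝒲 𝒲 1) (f f' : g.LFMap 𝒱 𝒲 0) : Prop :=
  ∃ H : g.LFMap 𝒱 (pathGr 𝒲) 0, g.IsInftyHom s (g.path t) H ∧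
    (∀ k x, (pathEval₀ W).lTensor g.CE (H.comp k x) = f.comp k x) ∧
    (∀ k x, (pathEval₁ W).lTensor g.CE (H.comp k x) = f'.comp k x)

end Path

end Cochains

section Modules

variable [FiniteDimensional K L]

/-- A locally finite `∞`-`𝔤`-module: a finite dimensional graded vector space `M` with a locally
finite family of structure maps `d_k : M → C^k(𝔤, M)` of degree `1` such that the total differential
`d_CE ⊗ id + ∑ id ⊗ d_k` squares to zero. In weight `0` this says that `(M, d_0)` is a cochain
complex. -/
structure LFModule : Type (max u v (w + 1)) where
  carrier : Type w
  [addCommGroup : AddCommGroup carrier]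
  [module : Module K carrier]
  [finiteDimensional : FiniteDimensional K carrier]
  gr : ℤ → Submodule K carrier
  internal : DirectSum.IsInternal gr
  str : g.LFMap gr gr 1
  sq_zero : ∀ z, g.totalD str (g.totalD str z) = 0

attribute [instance] LFModule.addCommGroup LFModule.module LFModule.finiteDimensional

/-- A weak Loday-Pirashvili module over `𝔤`: an `∞`-morphism `f : M ⇝ 𝔤` from a locally finite
`∞`-`𝔤`-module to the adjoint module. -/
structure WLP : Type (max u v (w + 1)) where
  mod : LFModule.{u, v, w} g
  f : g.LFMap mod.gr g.gr 0
  f_hom : g.IsInftyHom mod.str g.adjoint f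

/-- A morphism of weak Loday-Pirashvili modules from `f : M ⇝ 𝔤` to `f' : M' ⇝ 𝔤`: an
`∞`-morphism `φ : M ⇝ M'` with `f' ∘ φ = f`. -/
@[ext] structure WLP.Hom (X Y : WLP.{u, v, w} g) : Type (max u v w) where
  φ : g.LFMap X.mod.gr Y.mod.gr 0
  φ_hom : g.IsInftyHom X.mod.str Y.mod.str φ
  comm : Y.f.compose φ = X.f

/-- The category of weak Loday-Pirashvili modules over `𝔤`. -/
instance : CategoryTheory.Category (WLP.{u, v, w} g) where
  Hom X Y := WLP.Hom g X Y
  id X := ⟨LFMap.id _, fun z => by rw [LFMap.lin_id, LFMap.lin_id], LFMap.compose_id _⟩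
  comp a b := ⟨b.φ.compose a.φ,
    fun z => by rw [LFMap.lin_compose, LFMap.lin_compose, a.φ_hom, b.φ_hom],
    by rw [← LFMap.compose_assoc, b.comm, a.comm]⟩
  id_comp a := WLP.Hom.ext (LFMap.compose_id _)
  comp_id a := WLP.Hom.ext (LFMap.id_compose _)
  assoc a b c := WLP.Hom.ext (LFMap.compose_assoc _ _ _).symm

/-- The grading of `C(𝔤, M[1])`, where `M[1]^n = M^{n+1}`. As a `C(𝔤)`-module with differential,
`C(𝔤, M[1])` is `C(𝔤, M)`; an element `a ⊗ m[1]` is written `a ⊗ m`. -/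
def LFModule.shiftGr (M : LFModule.{u, v, w} g) (n : ℤ) : Submodule K (g.Coch M.carrier) :=
  g.cochGr (fun q => M.gr (q + 1)) n

end Modules

end DGLieAlgebra

section LeibnizInfinity

variable {K : Type u} [Field K] {A : Type*} [Ring A] [Algebra K A]
  {U : Type*} [AddCommGroup U] [Module K U] [Module A U]
  {W : Type*} [AddCommGroup W] [Module K W] [Module A W]
  {X : Type*} [AddCommGroup X] [Module K X] [Module A X]

/-- Evaluation of a family of multilinear maps on a finite list of arguments. -/
def evalList (φ : ∀ n, MultilinearMap K (fun _ : Fin n => U) W) (l : List U) : W :=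
  φ l.length l.get

/-- For arguments `x_i` of degree `e_i` and a family `lam` of maps of degree `1`, the sum
`∑ ± φ (x_σ(1), …, x_σ(k-j), lam (x_σ(k-j+1), …, x_σ(k-1), x_k), x_{k+1}, …, x_n)`
over `1 ≤ j ≤ k ≤ n` and `(k - j, j - 1)`-shuffles `σ` of `1, …, k - 1`, where the sign is the
Koszul sign of `σ` times `(-1)^(e_σ(1) + … + e_σ(k-j))`. The shuffle is encoded by the set
`S = {σ(k-j+1), …, σ(k-1)}`, an arbitrary subset of the indices before `k`; the complement `T` of
`S` among these indices is `{σ(1), …, σ(k-j)}`. -/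
def insertSum (φ : ∀ n, MultilinearMap K (fun _ : Fin n => U) W)
    (lam : ∀ n, MultilinearMap K (fun _ : Fin n => U) U) {n : ℕ} (e : Fin n → ℤ) (x : Fin n → U) :
    W :=
  ∑ k : Fin n, ∑ S ∈ (Finset.Iio k).powerset,
    ((∑ s ∈ S, ∑ t ∈ (Finset.Iio k \ S).filter (s < ·), e s * e t) +
        ∑ t ∈ Finset.Iio k \ S, e t).negOnePow •
      evalList φ
        (((List.finRange n).filter (· ∈ Finset.Iio k \ S)).map x ++
          evalList lam (((List.finRange n).filter (· ∈ S)).map x ++ [x k]) ::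
            ((List.finRange n).filter (k < ·)).map x)

/-- For arguments `x_i` of degree `e_i` and a family `φ` of maps of degree `0`, the sum
`∑ ± ψ (φ (x_{B_1}), …, φ (x_{B_r}))` over all partitions of the index set into nonempty blocks
`B_1, …, B_r`, ordered by `max B_1 < … < max B_r`, the arguments inside each block being in
increasing order; the sign is the Koszul sign of the resulting permutation of the arguments. These
permutations are the half-shuffles. -/
def compSum (ψ : ∀ n, MultilinearMap K (fun _ : Fin n => W) X)
    (φ : ∀ n, MultilinearMap K (fun _ : Fin n => U) W) {n : ℕ} (e : Fin n → ℤ) (x : Fin n → U) :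
    X :=
  ∑ c : OrderedFinpartition n,
    (∑ a : Fin n, ∑ b ∈ Finset.univ.filter (fun b => a < b ∧ c.index b < c.index a),
        e a * e b).negOnePow •
      ψ c.length fun m => φ (c.partSize m) fun j => x (c.emb m j)

/-- A Leibniz`_∞[1]` algebra over a differential graded algebra `(A, 𝒜, dA)` on the graded
`A`-module `(U, 𝒰)`: brackets `λ_n : U^{⊗ n} → U` of degree `1`, `n ≥ 1`, subject to the
generalized Jacobi identities, such that `(U, λ_1)` is a differential graded `A`-module and the
higher brackets are `A`-multilinear (with the Koszul sign for moving `a ∈ A` to the front past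
`λ_n`, of degree `1`, and past the preceding arguments). -/
structure LeibnizInftyAlg (𝒜 : ℤ → Submodule K A) (dA : A →ₗ[K] A) (𝒰 : ℤ → Submodule K U) where
  /-- the brackets; the component with no arguments is a placeholder -/
  br : ∀ n, MultilinearMap K (fun _ : Fin n => U) U
  br_zero : br 0 = 0
  br_mem : ∀ (n : ℕ) (e : Fin n → ℤ) (x : Fin n → U), (∀ i, x i ∈ 𝒰 (e i)) →
    br n x ∈ 𝒰 (∑ i, e i + 1)
  br_one_smul : ∀ (p : ℤ) (a : A) (y : U), a ∈ 𝒜 p →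
    br 1 (fun _ => a • y) = dA a • y + p.negOnePow • a • br 1 (fun _ => y)
  br_smul : ∀ n ≥ 2, ∀ (e : Fin n → ℤ) (x : Fin n → U), (∀ i, x i ∈ 𝒰 (e i)) →
    ∀ (i : Fin n) (p : ℤ) (a : A), a ∈ 𝒜 p →
      br n (Function.update x i (a • x i)) =
        (p * (1 + ∑ j ∈ Finset.Iio i, e j)).negOnePow • a • br n x
  jacobi : ∀ n ≥ 1, ∀ (e : Fin n → ℤ) (x : Fin n → U), (∀ i, x i ∈ 𝒰 (e i)) →
    insertSum br br e x = 0

variable {𝒜 : ℤ → Submodule K A} {dA : A →ₗ[K] A} {𝒰 : ℤ → Submodule K U} {𝒲 : ℤ → Submodule K W}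

/-- A morphism of Leibniz`_∞[1]` algebras over a differential graded algebra `A`: `A`-multilinear
maps `φ_n : U^{⊗ n} → W` of degree `0`, `n ≥ 1`, compatible with the brackets. -/
structure LeibnizInftyHom (P : LeibnizInftyAlg 𝒜 dA 𝒰) (R : LeibnizInftyAlg 𝒜 dA 𝒲) where
  /-- the components; the component with no arguments is a placeholder -/
  map : ∀ n, MultilinearMap K (fun _ : Fin n => U) W
  map_zero : map 0 = 0
  map_mem : ∀ (n : ℕ) (e : Fin n → ℤ) (x : Fin n → U), (∀ i, x i ∈ 𝒰 (e i)) →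
    map n x ∈ 𝒲 (∑ i, e i)
  map_smul : ∀ (n : ℕ) (e : Fin n → ℤ) (x : Fin n → U), (∀ i, x i ∈ 𝒰 (e i)) →
    ∀ (i : Fin n) (p : ℤ) (a : A), a ∈ 𝒜 p →
      map n (Function.update x i (a • x i)) =
        (p * ∑ j ∈ Finset.Iio i, e j).negOnePow • a • map n x
  compat : ∀ n ≥ 1, ∀ (e : Fin n → ℤ) (x : Fin n → U), (∀ i, x i ∈ 𝒰 (e i)) →
    compSum R.br map e x = insertSum map P.br e x

/-- `χ` is the composite `ψ ∘ φ` of two families of multilinear maps of degree `0`. -/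
def IsComposite (𝒰 : ℤ → Submodule K U) (χ : ∀ n, MultilinearMap K (fun _ : Fin n => U) X)
    (ψ : ∀ n, MultilinearMap K (fun _ : Fin n => W) X)
    (φ : ∀ n, MultilinearMap K (fun _ : Fin n => U) W) : Prop :=
  ∀ n ≥ 1, ∀ (e : Fin n → ℤ) (x : Fin n → U), (∀ i, x i ∈ 𝒰 (e i)) → χ n x = compSum ψ φ e x

variable (K U) in
/-- The components of the identity morphism: the identity for `n = 1` and `0` otherwise. -/
def idFamily : ∀ n, MultilinearMap K (fun _ : Fin n => U) U
  | 1 => MultilinearMap.ofSubsingleton K U U (0 : Fin 1) LinearMap.id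
  | _ => 0

end LeibnizInfinity

end

/-! Write A for C(𝔤) and U for C(𝔤, M[1]). Contraction along f gives an A-linear family of
derivations ρ(u) = ι_{f(u)} of A, an anchor. Cartan's formula [d_CE, ι_z] = ι_{d_tot z}
(`ceD_contrDer`), together with f being an ∞-morphism, says that ρ is compatible with the
differentials. Everything else is proved for an arbitrary anchored free dg module over a graded
commutative algebra.

A Leibniz∞[1] structure on U is a codifferential Q on the tensor space T(U), taken over the field,
for the half unshuffle coproduct `coprod`, which keeps the last letter in the second factor. A word
can be rebuilt from its coproduct (`concatProj_coprod`), so coderivations and coalgebra morphisms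
are determined by their components in length one (`IsCoder.apply_word`, `IsComor.apply_word`). Under
this dictionary the Jacobi identities become Q² = 0 and the morphism equations become F Q = Q' F
(`insertSum_family`, `compSum_family`).

The derivation of T(U) extending d is a codifferential with no higher brackets. The brackets come
from a change of coordinates. Left multiplication by u and the derivation of T(U) extending ρ(u) ⊗
id_M are both coderivations; let `op u` be their sum. Replacing each letter u of a word by `op u`
gives a coalgebra automorphism θ, unipotent for the length, and Q = θ ∘ der(d) ∘ θ⁻¹. So Q² = 0 for
free, and Q(op(u) x) = op(du) x ± op(u) Q(x). On words in the generators 1 ⊗ m the derivation part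
vanishes, because a derivation kills 1; iterating the commutation rule then yields the stated
formula for λ_n.

Multilinearity over A is tested on the quotient T_A(U) = A ⊗ T(M) (`toFree`), through which the
projection to length one factors. There `op u` becomes an operator that is A-linear in u and
satisfies a Leibniz rule in scalars with symbol ρ(u). Compatibility of ρ with the differentials is
what makes Q descend as well (`freeCodiff_toFree`).

A morphism φ acts by θ' ∘ T(φ) ∘ θ⁻¹, and functoriality is cancellation of θ' against its inverse.
For a homotopy H, the dt-component gives a family η_u of derivations, of degree one less, whose
boundary is ρ' - ρ. The operators op(u) + [Q, η_u] + η_{du} obey the same commutation rule with Q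
but have symbol ρ'. The map ξ built from them, composed with θ'⁻¹, is the required isomorphism.
Since these operators send the unit to the letter u, its first component is the identity. -/

noncomputable section

/-! ### Signed sums over splittings and partitions of words -/

section Combinatorics

variable {α : Type*} {U : Type*} {Y : Type*} [AddCommGroup Y]

/-- The total degree of a word whose letters carry degrees. -/
def wordDeg (l : List (ℤ × U)) : ℤ := (l.map Prod.fst).sum

@[simp] theorem wordDeg_nil : wordDeg ([] : List (ℤ × U)) = 0 := rfl

@[simp] theorem wordDeg_cons (c : ℤ × U) (l : List (ℤ × U)) :
    wordDeg (c :: l) = c.1 + wordDeg l := by simp [wordDeg]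

/-- The signed sum of `k a b` over all ways to split a word into two complementary subwords. -/
def splitsSum : List (ℤ × U) → (List (ℤ × U) → List (ℤ × U) → Y) → Y
  | [], k => k [] []
  | c :: l, k => splitsSum l fun a b =>
      k (c :: a) b + (c.1 * wordDeg a).negOnePow • k a (c :: b)

theorem splitsSum_add (l : List (ℤ × U)) (k k' : List (ℤ × U) → List (ℤ × U) → Y) :
    splitsSum l (fun a b => k a b + k' a b) = splitsSum l k + splitsSum l k' := by
  induction l generalizing k k' with
  | nil => rfl
  | cons c l ih =>
    simp only [splitsSum, ← ih]
    congr 1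
    ext a b
    rw [smul_add]
    abel

theorem map_splitsSum {Y' F : Type*} [AddCommGroup Y'] [FunLike F Y Y'] [AddMonoidHomClass F Y Y']
    (f : F) (l : List (ℤ × U)) (k : List (ℤ × U) → List (ℤ × U) → Y) :
    f (splitsSum l k) = splitsSum l fun a b => f (k a b) := by
  induction l generalizing k with
  | nil => rfl
  | cons c l ih => simp only [splitsSum, ih, map_add, Units.smul_def, map_zsmul]

theorem splitsSum_congr {l : List (ℤ × U)} {k k' : List (ℤ × U) → List (ℤ × U) → Y}
    (h : ∀ a b, a.Sublist l → b.Sublist l → k a b = k' a b) : splitsSum l k = splitsSum l k' := by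
  induction l generalizing k k' with
  | nil => exact h _ _ (List.Sublist.refl _) (List.Sublist.refl _)
  | cons c l ih =>
    refine ih fun a b ha hb => ?_
    rw [h _ _ (ha.cons_cons c) (hb.cons c), h _ _ (ha.cons c) (hb.cons_cons c)]

/-- The signed sum over all ways to put a letter in front of one of the given words. -/
def insertLetterSum (c : ℤ × U) : List (List (ℤ × U)) → (List (List (ℤ × U)) → Y) → Y
  | [], _ => 0
  | b :: bs, k => k ((c :: b) :: bs) +
      (c.1 * wordDeg b).negOnePow • insertLetterSum c bs fun bs' => k (b :: bs')

/-- The signed sum of `k` over all partitions of a word into nonempty subwords, ordered by their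
last letters. -/
def partsSum : List (ℤ × U) → (List (List (ℤ × U)) → Y) → Y
  | [], k => k []
  | c :: l, k => partsSum l fun bs => k ([c] :: bs) + insertLetterSum c bs k

/-- The recursion defining `insertLetterSum` looks at the first block, while the coproduct singles
out the last one; this passes from one to the other. A letter entering the last block has crossed
all earlier blocks. -/
theorem insertLetterSum_append (c : ℤ × U) (as : List (List (ℤ × U))) (b : List (ℤ × U))
    (k : List (List (ℤ × U)) → Y) :
    insertLetterSum c (as ++ [b]) k = insertLetterSum c as (fun as' => k (as' ++ [b])) +
      (c.1 * (as.map wordDeg).sum).negOnePow • k (as ++ [c :: b]) := by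
  induction as generalizing k with
  | nil => simp [insertLetterSum]
  | cons a as ih =>
    simp only [List.cons_append, insertLetterSum, ih, smul_add, smul_smul, List.map_cons,
      List.sum_cons, mul_add, Int.negOnePow_add, add_assoc]

theorem insertLetterSum_add (c : ℤ × U) (bs : List (List (ℤ × U)))
    (k k' : List (List (ℤ × U)) → Y) :
    insertLetterSum c bs (fun bs' => k bs' + k' bs') =
      insertLetterSum c bs k + insertLetterSum c bs k' := by
  induction bs generalizing k k' with
  | nil => simp [insertLetterSum]
  | cons b bs ih =>
    simp only [insertLetterSum, ih, smul_add]
    abel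

theorem map_insertLetterSum {Y' F : Type*} [AddCommGroup Y'] [FunLike F Y Y']
    [AddMonoidHomClass F Y Y'] (f : F) (c : ℤ × U) (bs : List (List (ℤ × U)))
    (k : List (List (ℤ × U)) → Y) :
    f (insertLetterSum c bs k) = insertLetterSum c bs fun bs' => f (k bs') := by
  induction bs generalizing k with
  | nil => simp [insertLetterSum]
  | cons b bs ih => simp only [insertLetterSum, ih, map_add, Units.smul_def, map_zsmul]

theorem partsSum_add (l : List (ℤ × U)) (k k' : List (List (ℤ × U)) → Y) :
    partsSum l (fun bs => k bs + k' bs) = partsSum l k + partsSum l k' := by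
  induction l generalizing k k' with
  | nil => rfl
  | cons c l ih =>
    simp only [partsSum, ← ih]
    congr 1
    ext bs
    rw [insertLetterSum_add]
    abel

theorem map_partsSum {Y' F : Type*} [AddCommGroup Y'] [FunLike F Y Y'] [AddMonoidHomClass F Y Y']
    (f : F) (l : List (ℤ × U)) (k : List (List (ℤ × U)) → Y) :
    f (partsSum l k) = partsSum l fun bs => f (k bs) := by
  induction l generalizing k with
  | nil => rfl
  | cons c l ih => simp only [partsSum, ih, map_add, map_insertLetterSum]

/-- The blocks of a partition have total degree equal to that of the word. Recording this allows a
sign depending on the word to be rewritten as a sign depending on its blocks. -/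
theorem partsSum_congr {l : List (ℤ × U)} {k k' : List (List (ℤ × U)) → Y}
    (h : ∀ bs, (bs.map wordDeg).sum = wordDeg l → k bs = k' bs) :
    partsSum l k = partsSum l k' := by
  induction l generalizing k k' with
  | nil => exact h _ rfl
  | cons c l ih =>
    refine ih fun bs hbs => ?_
    rw [h _ (by simp [hbs])]
    congr 1
    have key : ∀ (as : List (List (ℤ × U))) (q q' : List (List (ℤ × U)) → Y),
        (∀ as', (as'.map wordDeg).sum = c.1 + (as.map wordDeg).sum → q as' = q' as') →
        insertLetterSum c as q = insertLetterSum c as q' := by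
      intro as
      induction as with
      | nil => intros; rfl
      | cons b as ih' =>
        intro q q' hq
        simp only [insertLetterSum]
        rw [hq _ (by simp [add_assoc]), ih' (fun bs' => q (b :: bs')) _ fun as' has' => hq _ ?_]
        simp only [List.map_cons, List.sum_cons, has']
        ring
    exact key bs _ _ fun as' has' => h _ (by rw [has', hbs, wordDeg_cons])

/-- The block containing the last letter of a word can be split off. -/
theorem partsSum_append_singleton (l : List (ℤ × U)) (c : ℤ × U)
    (k : List (List (ℤ × U)) → Y) :
    partsSum (l ++ [c]) k =
      splitsSum l fun a b => partsSum a fun as => k (as ++ [b ++ [c]]) := by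
  induction l generalizing k with
  | nil => simp [partsSum, insertLetterSum, splitsSum]
  | cons d l ih =>
    simp only [List.cons_append, partsSum, ih, splitsSum]
    congr 1
    ext a b
    -- When `d` joins the last block it crosses the word `a`, hence all blocks into which `a` is
    -- cut; the two forms of the sign agree by `partsSum_congr`.
    have : (d.1 * wordDeg a).negOnePow • partsSum a (fun as => k (as ++ [d :: (b ++ [c])])) =
        partsSum a fun as => (d.1 * (as.map wordDeg).sum).negOnePow •
          k (as ++ [d :: (b ++ [c])]) := by
      have h := map_partsSum (DistribSMul.toAddMonoidHom Y (d.1 * wordDeg a).negOnePow) a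
        (fun as => k (as ++ [d :: (b ++ [c])]))
      refine h.trans (partsSum_congr fun bs hbs => ?_)
      rw [hbs]
      rfl
    rw [this, ← partsSum_add]
    congr 1
    ext as
    rw [insertLetterSum_append, add_assoc]

theorem insertLetterSum_eq_sum (c : ℤ × U) (bs : List (List (ℤ × U)))
    (k : List (List (ℤ × U)) → Y) :
    insertLetterSum c bs k = ∑ i : Fin bs.length,
      (c.1 * ((bs.take i).map wordDeg).sum).negOnePow • k (bs.modify i (c :: ·)) := by
  induction bs generalizing k with
  | nil => simp [insertLetterSum]
  | cons b bs ih =>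
    simp only [insertLetterSum, ih]
    refine Eq.symm ((Fin.sum_univ_succ _).trans ?_)
    simp [Finset.smul_sum, smul_smul, mul_add, Int.negOnePow_add]

end Combinatorics

/-! ### Ordered partitions of an index set as partitions of words -/

namespace OrderedFinpartition

variable {n : ℕ} {α : Type*}

/-- The subwords of a word that correspond to the parts of an ordered partition. -/
def blocks (c : OrderedFinpartition n) (y : Fin n → α) : List (List α) :=
  List.ofFn fun m => List.ofFn fun j => y (c.emb m j)

theorem index_eq_of_emb {c : OrderedFinpartition n} {i : Fin n} {m : Fin c.length}
    {j : Fin (c.partSize m)} (h : c.emb m j = i) : c.index i = m := by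
  by_contra hne
  exact c.emb_ne_emb_of_ne hne ((c.emb_invEmbedding i).trans h.symm)

theorem blocks_extendLeft (c : OrderedFinpartition n) (a : α) (y : Fin n → α) :
    c.extendLeft.blocks (Fin.cons a y) = [a] :: c.blocks y := by
  refine (List.ofFn_succ (n := c.length) (f := fun m => List.ofFn fun j =>
    (Fin.cons a y : Fin (n + 1) → α) (c.extendLeft.emb m j))).trans ?_
  rfl

theorem index_extendLeft_zero (c : OrderedFinpartition n) :
    c.extendLeft.index 0 = (0 : Fin (c.length + 1)) :=
  index_eq_of_emb (j := (0 : Fin 1)) rfl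

theorem index_extendLeft_succ (c : OrderedFinpartition n) (i : Fin n) :
    c.extendLeft.index i.succ = Fin.succ (c.index i) := by
  refine index_eq_of_emb (j := (c.invEmbedding i : Fin (c.partSize (c.index i)))) ?_
  exact congrArg Fin.succ (c.emb_invEmbedding i)

theorem ofFn_emb_extendMiddle_self (c : OrderedFinpartition n) (k : Fin c.length) (a : α)
    (y : Fin n → α) :
    (List.ofFn fun j => (Fin.cons a y : Fin (n + 1) → α) ((c.extendMiddle k).emb k j)) =
      a :: List.ofFn fun j => y (c.emb k j) := by
  have hs : (c.extendMiddle k).partSize k = c.partSize k + 1 := by simp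
  rw [List.ofFn_congr hs, List.ofFn_succ]
  simp only [extendMiddle, dite_true, List.cons.injEq]
  exact ⟨rfl, rfl⟩

theorem ofFn_emb_extendMiddle_of_ne (c : OrderedFinpartition n) {k m : Fin c.length}
    (hm : m ≠ k) (a : α) (y : Fin n → α) :
    (List.ofFn fun j => (Fin.cons a y : Fin (n + 1) → α) ((c.extendMiddle k).emb m j)) =
      List.ofFn fun j => y (c.emb m j) := by
  have hs : (c.extendMiddle k).partSize m = c.partSize m := by simp [hm]
  rw [List.ofFn_congr hs]
  simp only [extendMiddle, hm, dite_false]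
  rfl

theorem blocks_extendMiddle (c : OrderedFinpartition n) (k : Fin c.length) (a : α)
    (y : Fin n → α) :
    (c.extendMiddle k).blocks (Fin.cons a y) = (c.blocks y).modify k (a :: ·) := by
  refine List.ext_getElem (by simp [blocks]) fun i h₁ h₂ => ?_
  simp only [blocks, List.getElem_ofFn, List.getElem_modify]
  split_ifs with h
  · subst h
    exact ofFn_emb_extendMiddle_self c k a y
  · refine ofFn_emb_extendMiddle_of_ne c (m := ⟨i, by simpa [blocks] using h₁⟩) ?_ a y
    exact fun h' => h (congrArg Fin.val h').symm

theorem index_extendMiddle_succ (c : OrderedFinpartition n) (k : Fin c.length) (i : Fin n) :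
    (c.extendMiddle k).index i.succ = c.index i := by
  by_cases h : c.index i = k
  · have hs : (c.extendMiddle k).partSize (c.index i) = c.partSize (c.index i) + 1 := by simp [h]
    refine index_eq_of_emb (j := Fin.cast hs.symm (Fin.succ (c.invEmbedding i))) ?_
    simp only [extendMiddle, h, dite_true]
    subst h
    exact congrArg Fin.succ (c.emb_invEmbedding i)
  · have hs : (c.extendMiddle k).partSize (c.index i) = c.partSize (c.index i) := by simp [h]
    refine index_eq_of_emb (j := Fin.cast hs.symm (c.invEmbedding i)) ?_
    simp only [extendMiddle, h, dite_false]
    exact congrArg Fin.succ (c.emb_invEmbedding i)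

/-- The exponent of the Koszul sign of the rearrangement of letters into blocks. -/
def koszul (c : OrderedFinpartition n) (e : Fin n → ℤ) : ℤ :=
  ∑ a : Fin n, ∑ b ∈ Finset.univ.filter (fun b => a < b ∧ c.index b < c.index a), e a * e b

theorem koszul_extendLeft (c : OrderedFinpartition n) (e₀ : ℤ) (e : Fin n → ℤ) :
    c.extendLeft.koszul (Fin.cons e₀ e) = c.koszul e := by
  simp only [koszul, Finset.sum_filter]
  rw [Fin.sum_univ_succ, Finset.sum_eq_zero, zero_add]
  · refine Finset.sum_congr rfl fun a _ => ?_
    rw [Fin.sum_univ_succ]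
    simp only [Fin.not_lt_zero, false_and, if_false, zero_add, Fin.cons_succ, Fin.succ_lt_succ_iff,
      index_extendLeft_succ]
    refine Finset.sum_congr rfl fun b _ => ?_
    congr 1
    rw [eq_iff_iff]
    exact and_congr_right fun _ => Fin.succ_lt_succ_iff
  · intro b _
    rw [if_neg]
    rintro ⟨-, h⟩
    rw [index_extendLeft_zero] at h
    exact Nat.not_lt_zero _ h

/-- The new index 0 precedes all others, so once it lies in block `k` it is out of order exactly
with the letters of the blocks before `k`. -/
theorem koszul_extendMiddle (c : OrderedFinpartition n) (k : Fin c.length) (e₀ : ℤ)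
    (e : Fin n → ℤ) :
    (c.extendMiddle k).koszul (Fin.cons e₀ e) =
      e₀ * (∑ b, if c.index b < k then e b else 0) + c.koszul e := by
  simp only [koszul, Finset.sum_filter]
  rw [Fin.sum_univ_succ, Fin.sum_univ_succ]
  simp only [lt_self_iff_false, false_and, if_false, zero_add, Fin.cons_zero, Fin.cons_succ,
    Fin.succ_pos, true_and, index_extendMiddle_succ, index_extendMiddle_zero]
  congr 1
  · rw [Finset.mul_sum]
    exact Finset.sum_congr rfl fun b _ => by
      rw [mul_ite, mul_zero]
      rfl
  · refine Finset.sum_congr rfl fun a _ => ?_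
    rw [Fin.sum_univ_succ]
    simp only [Fin.not_lt_zero, false_and, if_false, zero_add, Fin.succ_lt_succ_iff,
      index_extendMiddle_succ, Fin.cons_succ]
    rfl

theorem sum_take_blocks {U : Type*} (c : OrderedFinpartition n) (k : ℕ) (y : Fin n → ℤ × U) :
    (((c.blocks y).take k).map wordDeg).sum =
      ∑ b, if (c.index b : ℕ) < k then (y b).1 else 0 := by
  rw [← c.sum_sigma_eq_sum]
  have h : ∀ m j, c.index (c.emb m j) = m := fun m j => index_eq_of_emb rfl
  simp only [h]
  have e₁ : ((c.blocks y).take k).map wordDeg =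
      (List.ofFn fun m => ∑ j, (y (c.emb m j)).1).take k := by
    rw [List.map_take]
    congr 1
    simp [blocks, List.map_ofFn, Function.comp_def, wordDeg, List.sum_ofFn]
  rw [e₁, List.sum_take_ofFn, Finset.sum_filter]
  refine Finset.sum_congr rfl fun m _ => ?_
  split_ifs <;> simp

variable {U Y : Type*} [AddCommGroup Y]

/-- The bijection `extendEquiv` builds a partition of n + 1 letters by letting the first letter form
its own block, which then has the smallest maximum and comes first, or join an existing block. This
is the recursion of `partsSum`. -/
theorem sum_koszul_blocks (y : Fin n → ℤ × U) (k : List (List (ℤ × U)) → Y) :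
    ∑ c : OrderedFinpartition n, (c.koszul fun i => (y i).1).negOnePow • k (c.blocks y) =
      partsSum (List.ofFn y) k := by
  induction n generalizing k with
  | zero =>
    rw [Fintype.sum_unique]
    have h : (default : OrderedFinpartition 0).blocks y = [] := by
      simp [blocks]
    rw [h]
    simp [partsSum, koszul]
  | succ n ih =>
    obtain ⟨a, y, rfl⟩ : ∃ a y', y = Fin.cons a y' := ⟨y 0, Fin.tail y,
      (Fin.cons_self_tail y).symm⟩
    have hy : (fun i => ((Fin.cons a y : Fin (n + 1) → ℤ × U) i).1) =
        Fin.cons a.1 fun i => (y i).1 := by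
      funext i
      refine Fin.cases ?_ (fun i => ?_) i <;> simp
    rw [List.ofFn_cons, partsSum, ← ih, ← (extendEquiv n).sum_comp, Fintype.sum_sigma]
    refine Finset.sum_congr rfl fun c _ => ?_
    rw [Fintype.sum_option, smul_add]
    congr 1
    · change (c.extendLeft.koszul _).negOnePow • k (c.extendLeft.blocks _) = _
      rw [hy, koszul_extendLeft, blocks_extendLeft]
    · rw [insertLetterSum_eq_sum, Finset.smul_sum]
      have hl : (c.blocks y).length = c.length := by simp [blocks]
      rw [← (finCongr hl).symm.sum_comp]
      refine Finset.sum_congr rfl fun i _ => ?_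
      change ((c.extendMiddle i).koszul _).negOnePow • k ((c.extendMiddle i).blocks _) = _
      rw [hy, koszul_extendMiddle, blocks_extendMiddle, sum_take_blocks, smul_smul,
        ← Int.negOnePow_add, add_comm]
      rfl

end OrderedFinpartition

/-! ### Shuffles encoded by subsets of positions -/

section Subsets

variable {n : ℕ} {U Y : Type*} [AddCommGroup Y]

/-- A signed sum over the subsets of a set of positions in a word is a signed sum over the ways to
split the word. -/
theorem sum_powerset_eq_splitsSum (y : Fin n → ℤ × U) (k : List (ℤ × U) → List (ℤ × U) → Y)
    (l : List (Fin n)) (hl : l.Pairwise (· < ·)) :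
    ∑ S ∈ l.toFinset.powerset,
        (∑ s ∈ S, ∑ t ∈ (l.toFinset \ S).filter (s < ·), (y s).1 * (y t).1).negOnePow •
          k ((l.filter (· ∈ l.toFinset \ S)).map y) ((l.filter (· ∈ S)).map y) =
      splitsSum (l.map y) k := by
  induction l generalizing k with
  | nil => simp [splitsSum]
  | cons i l ih =>
    have hlt : ∀ j ∈ l, i < j := (List.pairwise_cons.1 hl).1
    have hi : i ∉ l := fun h => lt_irrefl i (hlt i h)
    have hi' : i ∉ l.toFinset := by simpa using hi
    -- Subsets avoiding or containing the first position `i` correspond to the two terms of the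
    -- recursion. Since `i` is smallest, it contributes a sign only when it lies in `S`, namely for
    -- crossing the whole complement.
    rw [List.toFinset_cons, Finset.sum_powerset_insert hi', List.map_cons, splitsSum,
      ← ih _ (List.pairwise_cons.1 hl).2, ← Finset.sum_add_distrib]
    refine Finset.sum_congr rfl fun S hS => ?_
    have hS := Finset.mem_powerset.1 hS
    have hiS : i ∉ S := fun h => hi' (hS h)
    have e₁ : insert i l.toFinset \ S = insert i (l.toFinset \ S) :=
      Finset.insert_sdiff_of_notMem _ hiS
    have e₂ : insert i l.toFinset \ insert i S = l.toFinset \ S := by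
      rw [Finset.insert_sdiff_insert, Finset.sdiff_insert, Finset.erase_eq_of_notMem]
      exact fun h => hi' (Finset.mem_sdiff.1 h).1
    have hmem : ∀ j ∈ l, j ≠ i := fun j hj h => hi (h ▸ hj)
    have f₁ : (i :: l).filter (· ∈ insert i (l.toFinset \ S)) =
        i :: l.filter (· ∈ l.toFinset \ S) := by
      rw [List.filter_cons_of_pos (by simp)]
      congr 1
      refine List.filter_congr fun j hj => ?_
      simp only [Finset.mem_insert, hmem j hj, false_or]
    have f₂ : (i :: l).filter (· ∈ S) = l.filter (· ∈ S) :=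
      List.filter_cons_of_neg (by simpa using hiS)
    have f₃ : (i :: l).filter (· ∈ l.toFinset \ S) = l.filter (· ∈ l.toFinset \ S) :=
      List.filter_cons_of_neg (by simpa using fun h => (hi h).elim)
    have f₄ : (i :: l).filter (· ∈ insert i S) = i :: l.filter (· ∈ S) := by
      rw [List.filter_cons_of_pos (by simp)]
      congr 1
      refine List.filter_congr fun j hj => ?_
      simp only [Finset.mem_insert, hmem j hj, false_or]
    rw [e₁, e₂, f₁, f₂, f₃, f₄, smul_add, smul_smul, ← Int.negOnePow_add]
    congr 2
    · congr 1
      refine Finset.sum_congr rfl fun s hs => ?_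
      rw [Finset.filter_insert, if_neg]
      exact not_lt.2 (hlt s (by simpa using hS hs)).le
    · rw [Finset.sum_insert hiS, add_comm]
      congr 2
      rw [Finset.filter_true_of_mem fun t ht =>
        hlt t (by simpa using (Finset.mem_sdiff.1 ht).1), ← Finset.mul_sum]
      congr 1
      have hnd : (l.filter (· ∈ l.toFinset \ S)).Nodup :=
        (((List.pairwise_cons.1 hl).2.imp fun h => ne_of_lt h).filter _)
      have : l.toFinset \ S = (l.filter (· ∈ l.toFinset \ S)).toFinset := by
        ext j
        simp
      conv_lhs => rw [this]
      rw [List.sum_toFinset _ hnd]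
      simp [wordDeg, Function.comp_def]

theorem evalList_eq {K : Type*} [Field K] {U W : Type*} [AddCommGroup U] [Module K U]
    [AddCommGroup W] [Module K W] (φ : TensorAlgebra K U →ₗ[K] W) (l : List U) :
    evalList (fun n => φ.compMultilinearMap (TensorAlgebra.tprod K U n)) l =
      φ (l.map (TensorAlgebra.ι K)).prod := by
  simp only [evalList, LinearMap.compMultilinearMap_apply, TensorAlgebra.tprod_apply]
  congr 2
  rw [List.ofFn_comp']
  simp

theorem sum_sdiff_eq_wordDeg (y : Fin n → ℤ × U) {k : Fin n} {S : Finset (Fin n)} :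
    ∑ t ∈ Finset.Iio k \ S, (y t).1 =
      wordDeg (((List.finRange n).filter (· ∈ Finset.Iio k \ S)).map y) := by
  have hnd : ((List.finRange n).filter (· ∈ Finset.Iio k \ S)).Nodup :=
    (List.nodup_finRange n).filter _
  have : Finset.Iio k \ S = ((List.finRange n).filter (· ∈ Finset.Iio k \ S)).toFinset := by
    ext j
    simp
  conv_lhs => rw [this]
  rw [List.sum_toFinset _ hnd]
  simp [wordDeg, Function.comp_def]

theorem map_filter_lt_finRange {α : Type*} (y : Fin n → α) (k : Fin n) :
    ((List.finRange n).filter (· < k)).map y = (List.ofFn y).take k := by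
  induction n with
  | zero => exact k.elim0
  | succ n ih =>
    rw [List.finRange_succ, List.ofFn_succ]
    refine Fin.cases ?_ (fun k => ?_) k
    · simp
    · rw [List.filter_cons_of_pos (by simp), List.filter_map, List.map_cons, List.map_map,
        Fin.val_succ, List.take_succ_cons, ← ih (fun i => y i.succ) k]
      simp [Function.comp_def, Fin.succ_lt_succ_iff]

theorem map_filter_gt_finRange {α : Type*} (y : Fin n → α) (k : Fin n) :
    ((List.finRange n).filter (k < ·)).map y = (List.ofFn y).drop (k + 1) := by
  induction n with
  | zero => exact k.elim0
  | succ n ih =>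
    rw [List.finRange_succ, List.ofFn_succ]
    refine Fin.cases ?_ (fun k => ?_) k
    · rw [List.filter_cons_of_neg (by simp), List.filter_map]
      simp [Function.comp_def, List.ofFn_eq_map]
    · rw [List.filter_cons_of_neg (by simp), List.filter_map, List.map_map,
        Fin.val_succ, List.drop_succ_cons, ← ih (fun i => y i.succ) k]
      simp [Function.comp_def, Fin.succ_lt_succ_iff]

variable {K : Type*} [Field K] {W : Type*} [AddCommGroup W] [Module K W]

/-- The signed insertion sum in terms of the ways to split initial segments of the word of
arguments. -/
theorem insertSum_eq_sum_splitsSum {U : Type*} [AddCommGroup U] [Module K U]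
    (φ : ∀ n, MultilinearMap K (fun _ : Fin n => U) W)
    (lam : ∀ n, MultilinearMap K (fun _ : Fin n => U) U) {n : ℕ} (y : Fin n → ℤ × U) :
    insertSum φ lam (fun i => (y i).1) (fun i => (y i).2) =
      ∑ k : Fin n, splitsSum ((List.ofFn y).take k) fun a b => (wordDeg a).negOnePow •
        evalList φ (a.map Prod.snd ++ evalList lam (b.map Prod.snd ++ [(y k).2]) ::
          ((List.ofFn y).drop (k + 1)).map Prod.snd) := by
  refine Finset.sum_congr rfl fun k _ => ?_
  rw [← map_filter_lt_finRange, ← sum_powerset_eq_splitsSum _ _ _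
    ((List.pairwise_lt_finRange n).filter _)]
  have hI : ((List.finRange n).filter (· < k)).toFinset = Finset.Iio k := by
    ext j
    simp
  rw [hI]
  refine Finset.sum_congr rfl fun S hS => ?_
  have hS := Finset.mem_powerset.1 hS
  have f₁ : ((List.finRange n).filter (· < k)).filter (· ∈ Finset.Iio k \ S) =
      (List.finRange n).filter (· ∈ Finset.Iio k \ S) := by
    rw [List.filter_filter]
    refine List.filter_congr fun j _ => ?_
    simp only [Finset.mem_sdiff, Finset.mem_Iio]
    grind
  have f₂ : ((List.finRange n).filter (· < k)).filter (· ∈ S) =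
      (List.finRange n).filter (· ∈ S) := by
    rw [List.filter_filter]
    refine List.filter_congr fun j _ => ?_
    have : j ∈ S → j < k := fun h => Finset.mem_Iio.1 (hS h)
    grind
  rw [f₁, f₂, ← map_filter_gt_finRange, Int.negOnePow_add, mul_smul, sum_sdiff_eq_wordDeg]
  simp only [List.map_map, Function.comp_def]

end Subsets

/-! ### Gradings with sign operators -/

/-- A `ℤ`-grading of a vector space, given by homogeneous pieces that span it, together with the
operators `sg e` that multiply an element of degree `n` by `(-1)^(e n)`. -/
structure SignedGrading (K : Type*) [Field K] (V : Type*) [AddCommGroup V] [Module K V] where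
  gr : ℤ → Submodule K V
  sg : ℤ → V →ₗ[K] V
  sg_apply : ∀ {e n : ℤ} {x : V}, x ∈ gr n → sg e x = (e * n).negOnePow • x
  iSup_gr : ⨆ n, gr n = ⊤

namespace SignedGrading

variable {K : Type*} [Field K] {V : Type*} [AddCommGroup V] [Module K V]
  {W : Type*} [AddCommGroup W] [Module K W] {X : Type*} [AddCommGroup X] [Module K X]
  (𝒱 : SignedGrading K V) (𝒲 : SignedGrading K W) (𝒳 : SignedGrading K X)

variable {𝒱} in
theorem le_of_gr_le {S : Submodule K V} (h : ∀ n, 𝒱.gr n ≤ S) (x : V) : x ∈ S :=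
  (iSup_le h : ⨆ n, 𝒱.gr n ≤ S) (𝒱.iSup_gr ▸ Submodule.mem_top)

theorem hom_ext {f g : V →ₗ[K] W} (h : ∀ n, ∀ x ∈ 𝒱.gr n, f x = g x) : f = g :=
  LinearMap.ext fun x => le_of_gr_le (S := LinearMap.eqLocus f g) (fun n x hx => h n x hx) x

theorem smul_negOnePow_mem {S : Submodule K V} {x : V} (e : ℤ) (hx : x ∈ S) :
    e.negOnePow • x ∈ S := by
  rw [Units.smul_def]
  exact zsmul_mem hx _

theorem map_negOnePow_smul (f : V →ₗ[K] W) (e : ℤ) (x : V) :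
    f (e.negOnePow • x) = e.negOnePow • f x := by
  rw [Units.smul_def, map_zsmul, Units.smul_def]

theorem sg_mem {e n : ℤ} {x : V} (hx : x ∈ 𝒱.gr n) : 𝒱.sg e x ∈ 𝒱.gr n := by
  rw [𝒱.sg_apply hx]
  exact smul_negOnePow_mem _ hx

theorem sg_sg (e f : ℤ) (x : V) : 𝒱.sg e (𝒱.sg f x) = 𝒱.sg (e + f) x := by
  refine LinearMap.congr_fun (𝒱.hom_ext (f := 𝒱.sg e ∘ₗ 𝒱.sg f) fun n x hx => ?_) x
  rw [LinearMap.comp_apply, 𝒱.sg_apply hx, map_negOnePow_smul, 𝒱.sg_apply hx, 𝒱.sg_apply hx,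
    smul_smul, ← Int.negOnePow_add]
  congr 2
  ring

theorem sg_eq_of_even {e f : ℤ} (h : Even (e - f)) : 𝒱.sg e = 𝒱.sg f := by
  refine 𝒱.hom_ext fun n x hx => ?_
  rw [𝒱.sg_apply hx, 𝒱.sg_apply hx]
  congr 1
  rw [Int.negOnePow_eq_iff, ← sub_mul]
  exact h.mul_right n

@[simp] theorem sg_zero : 𝒱.sg 0 = LinearMap.id :=
  𝒱.hom_ext fun n x hx => by rw [𝒱.sg_apply hx, zero_mul]; simp

/-- A linear map is homogeneous of degree `e`. -/
def HasDeg (e : ℤ) (P : V →ₗ[K] W) : Prop := ∀ n, ∀ x ∈ 𝒱.gr n, P x ∈ 𝒲.gr (n + e)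

variable {𝒱 𝒲 𝒳}

/-- The Koszul rule for moving a sign operator through a homogeneous map, valid on all vectors and
not only on homogeneous ones. Most signs below are handled in this operator form. -/
theorem HasDeg.map_sg {e : ℤ} {P : V →ₗ[K] W} (hP : HasDeg 𝒱 𝒲 e P) (f : ℤ) (x : V) :
    P (𝒱.sg f x) = (f * e).negOnePow • 𝒲.sg f (P x) := by
  refine LinearMap.congr_fun (𝒱.hom_ext (f := P ∘ₗ 𝒱.sg f)
    (g := (f * e).negOnePow • 𝒲.sg f ∘ₗ P) fun n x hx => ?_) x
  rw [LinearMap.comp_apply, 𝒱.sg_apply hx, map_negOnePow_smul, LinearMap.smul_apply,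
    LinearMap.comp_apply, 𝒲.sg_apply (hP n x hx), smul_smul, ← Int.negOnePow_add]
  congr 1
  rw [Int.negOnePow_eq_iff]
  exact ⟨-(f * e), by ring⟩

theorem HasDeg.sg_map {e : ℤ} {P : V →ₗ[K] W} (hP : HasDeg 𝒱 𝒲 e P) (f : ℤ) (x : V) :
    𝒲.sg f (P x) = (f * e).negOnePow • P (𝒱.sg f x) := by
  rw [hP.map_sg, smul_smul, ← Int.negOnePow_add, Int.negOnePow_even _ ⟨f * e, rfl⟩, one_smul]

theorem HasDeg.comp {e f : ℤ} {P : W →ₗ[K] X} {R : V →ₗ[K] W} (hP : HasDeg 𝒲 𝒳 e P)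
    (hR : HasDeg 𝒱 𝒲 f R) : HasDeg 𝒱 𝒳 (e + f) (P ∘ₗ R) := fun n x hx => by
  have := hP _ _ (hR n x hx)
  rwa [add_assoc, add_comm f e] at this

theorem HasDeg.add {e : ℤ} {P R : V →ₗ[K] W} (hP : HasDeg 𝒱 𝒲 e P) (hR : HasDeg 𝒱 𝒲 e R) :
    HasDeg 𝒱 𝒲 e (P + R) := fun n x hx => add_mem (hP n x hx) (hR n x hx)

theorem HasDeg.sub {e : ℤ} {P R : V →ₗ[K] W} (hP : HasDeg 𝒱 𝒲 e P) (hR : HasDeg 𝒱 𝒲 e R) :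
    HasDeg 𝒱 𝒲 e (P - R) := fun n x hx => sub_mem (hP n x hx) (hR n x hx)

theorem HasDeg.smul {e : ℤ} {P : V →ₗ[K] W} (hP : HasDeg 𝒱 𝒲 e P) (f : ℤ) :
    HasDeg 𝒱 𝒲 e (f.negOnePow • P) := fun n x hx => smul_negOnePow_mem _ (hP n x hx)

variable (𝒱) [CharZero K]

/-- The linear map that agrees with `B n` on elements of degree `n`, for a family `B` that depends
on the parity of the index only. -/
def glue (B : ℤ → V →ₗ[K] W) : V →ₗ[K] W :=
  (2⁻¹ : K) • (B 0 ∘ₗ (LinearMap.id + 𝒱.sg 1) + B 1 ∘ₗ (LinearMap.id - 𝒱.sg 1))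

/-- The maps (id ± sg 1)/2 project to the even and odd parts, which is where characteristic zero
enters. Signs depend on the degree of a letter only modulo 2, so a formula stated for homogeneous
letters becomes linear in the letter. -/
theorem glue_apply {B : ℤ → V →ₗ[K] W} (hB : ∀ e f, Even (e - f) → B e = B f) {n : ℤ} {x : V}
    (hx : x ∈ 𝒱.gr n) : 𝒱.glue B x = B n x := by
  simp only [glue, LinearMap.smul_apply, LinearMap.add_apply, LinearMap.comp_apply,
    LinearMap.sub_apply, LinearMap.id_apply, 𝒱.sg_apply hx, one_mul]
  have h2 : (2 : K) ≠ 0 := two_ne_zero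
  rcases Int.even_or_odd n with h | h
  · rw [Int.negOnePow_even n h, one_smul, sub_self, map_zero, add_zero, ← two_smul K x, map_smul,
      smul_smul, inv_mul_cancel₀ h2, one_smul, hB 0 n (by simpa using h)]
  · rw [Int.negOnePow_odd n h]
    simp only [Units.neg_smul, one_smul, add_neg_cancel, map_zero, zero_add, sub_neg_eq_add]
    rw [← two_smul K x, map_smul, smul_smul, inv_mul_cancel₀ h2, one_smul,
      hB 1 n (by simpa using Odd.sub_odd odd_one h)]

end SignedGrading

/-! ### Recursion on the letters of a word -/

namespace TensorAlgebra

variable {K : Type*} [Field K] {U : Type*} [AddCommGroup U] [Module K U]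
  {Y : Type*} [AddCommGroup Y] [Module K Y]

/-- The linear map out of the tensor algebra obtained from an action of the letters. -/
def letterRec (β : U →ₗ[K] Module.End K Y) (y : Y) : TensorAlgebra K U →ₗ[K] Y :=
  LinearMap.applyₗ y ∘ₗ (TensorAlgebra.lift K β).toLinearMap

@[simp] theorem letterRec_one (β : U →ₗ[K] Module.End K Y) (y : Y) : letterRec β y 1 = y := by
  simp [letterRec]

@[simp] theorem letterRec_ι_mul (β : U →ₗ[K] Module.End K Y) (y : Y) (u : U)
    (x : TensorAlgebra K U) : letterRec β y (ι K u * x) = β u (letterRec β y x) := by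
  simp [letterRec]

theorem letterRec_ι (β : U →ₗ[K] Module.End K Y) (y : Y) (u : U) :
    letterRec β y (ι K u) = β u y := by
  rw [← mul_one (ι K u), letterRec_ι_mul, letterRec_one]

/-- Left multiplication by a letter. -/
def mulLetter : U →ₗ[K] Module.End K (TensorAlgebra K U) := LinearMap.mul K _ ∘ₗ ι K

@[simp] theorem mulLetter_apply (u : U) (x : TensorAlgebra K U) : mulLetter u x = ι K u * x := rfl

/-- The augmentation. -/
abbrev aug : TensorAlgebra K U →ₐ[K] K := algebraMapInv

theorem aug_ι (u : U) : aug (ι K u) = 0 := by simp [aug, algebraMapInv]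

theorem aug_ι_mul (u : U) (x : TensorAlgebra K U) : aug (ι K u * x) = 0 := by
  rw [map_mul, aug_ι, zero_mul]

/-- The action of the letters that extracts the part of length one. -/
def projLetter : U →ₗ[K] Module.End K (K × U) :=
  LinearMap.mk₂ K (fun u p => (0, p.1 • u)) (fun u v p => by simp) (fun c u p => by
    rw [Prod.smul_mk, smul_zero, smul_comm])
    (fun u p q => by simp [add_smul]) (fun c u p => by simp [mul_smul])

/-- The projection to words of length one. -/
def proj : TensorAlgebra K U →ₗ[K] U := LinearMap.snd K K U ∘ₗ letterRec projLetter (1, 0)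

theorem proj_one : proj (1 : TensorAlgebra K U) = 0 := by simp [proj]

theorem proj_ι_mul (u : U) (x : TensorAlgebra K U) : proj (ι K u * x) = aug x • u := by
  -- The recursion carries the augmentation as auxiliary state; a letter survives in length one only
  -- in front of a scalar.
  have h : ∀ x : TensorAlgebra K U, (letterRec projLetter ((1, 0) : K × U) x).1 = aug x := by
    intro x
    induction x using TensorAlgebra.induction with
    | algebraMap c =>
      rw [Algebra.algebraMap_eq_smul_one, map_smul, map_smul, letterRec_one, map_one]
      rfl
    | ι u => simp [letterRec_ι, projLetter, aug_ι]
    | mul a b ha hb =>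
      -- The factor `a` acts on the state left by `b`, so the claim has to be proved for an
      -- arbitrary initial state.
      suffices H : ∀ y : K × U, (TensorAlgebra.lift K projLetter a y).1 = aug a * y.1 by
        have h : letterRec projLetter ((1, 0) : K × U) (a * b) =
            TensorAlgebra.lift K projLetter a (letterRec projLetter (1, 0) b) := by
          simp [letterRec]
        rw [h, H, hb, map_mul]
      clear ha hb
      intro y
      induction a using TensorAlgebra.induction generalizing y with
      | algebraMap c => simp
      | ι u => simp [projLetter, aug_ι]
      | mul a b ha hb => rw [map_mul, map_mul, Module.End.mul_apply, ha, hb, mul_assoc]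
      | add a b ha hb => rw [map_add, map_add, LinearMap.add_apply, Prod.fst_add, ha, hb, add_mul]
    | add a b ha hb => rw [map_add, map_add, Prod.fst_add, ha, hb]
  rw [proj, LinearMap.comp_apply, letterRec_ι_mul, ← h]
  rfl

theorem proj_ι (u : U) : proj (ι K u) = u := by
  rw [← mul_one (ι K u), proj_ι_mul, map_one, one_smul]

variable (𝒰 : SignedGrading K U)

/-- Induction on words with homogeneous letters. -/
theorem word_induction {S : Submodule K (TensorAlgebra K U)} (h₁ : 1 ∈ S)
    (h : ∀ n, ∀ u ∈ 𝒰.gr n, ∀ x ∈ S, ι K u * x ∈ S) (x : TensorAlgebra K U) : x ∈ S := by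
  have hu : ∀ u, ∀ x ∈ S, ι K u * x ∈ S := by
    intro u x hx
    exact SignedGrading.le_of_gr_le (𝒱 := 𝒰)
      (S := S.comap (LinearMap.mulRight K x ∘ₗ ι K)) (fun n u hu => h n u hu x hx) u
  suffices H : ∀ y ∈ S, x * y ∈ S by simpa using H 1 h₁
  induction x using TensorAlgebra.induction with
  | algebraMap c =>
    intro y hy
    rw [← Algebra.smul_def]
    exact S.smul_mem c hy
  | ι u => exact hu u
  | mul a b ha hb =>
    intro y hy
    rw [mul_assoc]
    exact ha _ (hb y hy)
  | add a b ha hb =>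
    intro y hy
    rw [add_mul]
    exact add_mem (ha y hy) (hb y hy)

/-- The standard way to compare maps on the tensor algebra below: it suffices to know how they react
to a homogeneous letter placed in front. -/
theorem word_hom_ext {f g : TensorAlgebra K U →ₗ[K] Y} (h₁ : f 1 = g 1)
    (h : ∀ n, ∀ u ∈ 𝒰.gr n, ∀ x, f x = g x → f (ι K u * x) = g (ι K u * x)) : f = g :=
  LinearMap.ext fun x => word_induction 𝒰 (S := LinearMap.eqLocus f g) h₁
    (fun n u hu x hx => h n u hu x hx) x

/-- The element of the tensor algebra given by a word whose letters carry degrees. -/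
def word (l : List (ℤ × U)) : TensorAlgebra K U := (l.map fun c => ι K c.2).prod

@[simp] theorem word_nil : word (K := K) ([] : List (ℤ × U)) = 1 := rfl

@[simp] theorem word_cons (c : ℤ × U) (l : List (ℤ × U)) :
    word (K := K) (c :: l) = ι K c.2 * word l := by simp [word]

theorem word_append (l l' : List (ℤ × U)) :
    word (K := K) (l ++ l') = word l * word l' := by simp [word]

theorem word_singleton (c : ℤ × U) : word (K := K) [c] = ι K c.2 := by simp

/-- The signed grading of the tensor algebra of a graded space. -/
def signedGrading : SignedGrading K (TensorAlgebra K U) where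
  gr n := Submodule.span K {x | ∃ l : List (ℤ × U), (∀ c ∈ l, c.2 ∈ 𝒰.gr c.1) ∧ wordDeg l = n ∧
    x = word l}
  sg e := (TensorAlgebra.lift K (ι K ∘ₗ 𝒰.sg e)).toLinearMap
  sg_apply {e n x} hx := by
    have : Submodule.span K {x | ∃ l : List (ℤ × U), (∀ c ∈ l, c.2 ∈ 𝒰.gr c.1) ∧ wordDeg l = n ∧
        x = word l} ≤ LinearMap.eqLocus (TensorAlgebra.lift K (ι K ∘ₗ 𝒰.sg e)).toLinearMap
          ((e * n).negOnePow • LinearMap.id) := by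
      refine Submodule.span_le.2 ?_
      rintro _ ⟨l, hl, rfl, rfl⟩
      simp only [SetLike.mem_coe, LinearMap.mem_eqLocus, LinearMap.smul_apply, LinearMap.id_apply,
        AlgHom.toLinearMap_apply]
      clear hx
      induction l with
      | nil => simp
      | cons c l ih =>
        rw [word_cons, map_mul, ih fun c' hc' => hl c' (List.mem_cons_of_mem _ hc'),
          TensorAlgebra.lift_ι_apply, LinearMap.comp_apply, 𝒰.sg_apply (hl c List.mem_cons_self),
          SignedGrading.map_negOnePow_smul, smul_mul_smul_comm, ← Int.negOnePow_add, wordDeg_cons,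
          mul_add]
    exact this hx
  iSup_gr := by
    refine eq_top_iff.2 fun x _ => word_induction 𝒰 ?_ ?_ x
    · exact Submodule.mem_iSup_of_mem 0 (Submodule.subset_span ⟨[], by simp⟩)
    · intro n u hu x hx
      suffices H : (⨆ n, Submodule.span K {x | ∃ l : List (ℤ × U), (∀ c ∈ l, c.2 ∈ 𝒰.gr c.1) ∧
          wordDeg l = n ∧ x = word l}) ≤
          (⨆ n, Submodule.span K {x | ∃ l : List (ℤ × U), (∀ c ∈ l, c.2 ∈ 𝒰.gr c.1) ∧
          wordDeg l = n ∧ x = word (K := K) l}).comap (mulLetter u) from H hx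
      refine iSup_le fun m => Submodule.span_le.2 ?_
      rintro _ ⟨l, hl, rfl, rfl⟩
      refine Submodule.mem_iSup_of_mem (n + wordDeg l) (Submodule.subset_span ⟨(n, u) :: l, ?_, ?_⟩)
      · intro c hc
        rcases List.mem_cons.1 hc with rfl | hc
        exacts [hu, hl c hc]
      · simp

theorem word_mem_gr {l : List (ℤ × U)} (hl : ∀ c ∈ l, c.2 ∈ 𝒰.gr c.1) :
    word l ∈ (signedGrading 𝒰).gr (wordDeg l) := Submodule.subset_span ⟨l, hl, rfl, rfl⟩

theorem one_mem_gr : (1 : TensorAlgebra K U) ∈ (signedGrading 𝒰).gr 0 :=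
  word_mem_gr 𝒰 (l := []) (by simp)

theorem gr_le {n : ℤ} {S : Submodule K (TensorAlgebra K U)}
    (h : ∀ l : List (ℤ × U), (∀ c ∈ l, c.2 ∈ 𝒰.gr c.1) → wordDeg l = n → word l ∈ S) :
    (signedGrading 𝒰).gr n ≤ S := by
  refine Submodule.span_le.2 ?_
  rintro _ ⟨l, hl, hn, rfl⟩
  exact h l hl hn

theorem hasDeg_of_word {𝒴 : SignedGrading K Y} {e : ℤ} {P : TensorAlgebra K U →ₗ[K] Y}
    (h : ∀ l : List (ℤ × U), (∀ c ∈ l, c.2 ∈ 𝒰.gr c.1) → P (word l) ∈ 𝒴.gr (wordDeg l + e)) :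
    SignedGrading.HasDeg (signedGrading 𝒰) 𝒴 e P := fun n x hx =>
  gr_le 𝒰 (S := (𝒴.gr (n + e)).comap P) (fun l hl hn => by
    subst hn
    exact h l hl) hx

theorem ι_mul_mem_gr {n m : ℤ} {u : U} (hu : u ∈ 𝒰.gr n) {x : TensorAlgebra K U}
    (hx : x ∈ (signedGrading 𝒰).gr m) : ι K u * x ∈ (signedGrading 𝒰).gr (m + n) := by
  refine hasDeg_of_word 𝒰 (P := mulLetter u) (𝒴 := signedGrading 𝒰) (fun l hl => ?_) m x hx
  have := word_mem_gr 𝒰 (l := (n, u) :: l) fun c hc => by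
    rcases List.mem_cons.1 hc with rfl | hc
    exacts [hu, hl c hc]
  rw [word_cons, wordDeg_cons, add_comm] at this
  exact this

theorem hasDeg_mulLetter {n : ℤ} {u : U} (hu : u ∈ 𝒰.gr n) :
    SignedGrading.HasDeg (signedGrading 𝒰) (signedGrading 𝒰) n (mulLetter u) :=
  fun _ _ hx => ι_mul_mem_gr 𝒰 hu hx

theorem sg_mul (e : ℤ) (x y : TensorAlgebra K U) :
    (signedGrading 𝒰).sg e (x * y) = (signedGrading 𝒰).sg e x * (signedGrading 𝒰).sg e y :=
  map_mul (TensorAlgebra.lift K (ι K ∘ₗ 𝒰.sg e)) x y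

theorem sg_one (e : ℤ) : (signedGrading 𝒰).sg e 1 = 1 :=
  map_one (TensorAlgebra.lift K (ι K ∘ₗ 𝒰.sg e))

theorem sg_ι (e : ℤ) (u : U) : (signedGrading 𝒰).sg e (ι K u) = ι K (𝒰.sg e u) :=
  TensorAlgebra.lift_ι_apply _ _

end TensorAlgebra

/-! ### Derivations, the half coproduct, coderivations and coalgebra morphisms -/

namespace TensorAlgebra

open SignedGrading

variable {K : Type*} [Field K] {U : Type*} [AddCommGroup U] [Module K U]
  {W : Type*} [AddCommGroup W] [Module K W] {X : Type*} [AddCommGroup X] [Module K X]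
  {Y : Type*} [AddCommGroup Y] [Module K Y]

theorem negOnePow_succ_smul (e : ℤ) (f : U →ₗ[K] W) :
    (e + 1).negOnePow • f = -(e.negOnePow • f) := by
  ext x
  simp [Int.negOnePow_succ]

theorem smul_negOnePow_comm (c : K) (e : ℤ) (x : W) :
    c • e.negOnePow • x = e.negOnePow • c • x := by
  simp only [Units.smul_def, smul_comm c]

theorem negOnePow_smul_tmul (e : ℤ) (x : U) (y : W) :
    (e.negOnePow • x) ⊗ₜ[K] y = e.negOnePow • (x ⊗ₜ[K] y) := by
  simp only [Units.smul_def, TensorProduct.smul_tmul']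

theorem tmul_negOnePow_smul (e : ℤ) (x : U) (y : W) :
    x ⊗ₜ[K] (e.negOnePow • y) = e.negOnePow • (x ⊗ₜ[K] y) := by
  simp only [Units.smul_def, TensorProduct.tmul_smul]

variable (𝒰 : SignedGrading K U) (𝒲 : SignedGrading K W) (𝒳 : SignedGrading K X)

section Derivations

/-- The action of the letters that computes the derivation extending `f`. -/
def derLetter (e : ℤ) (f : U →ₗ[K] U) :
    U →ₗ[K] Module.End K (TensorAlgebra K U × TensorAlgebra K U) :=
  LinearMap.mk₂ K (fun u p => (ι K (𝒰.sg e u) * p.1 + ι K (f u) * p.2, ι K u * p.2))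
    (fun u v p => by
      simp only [map_add, add_mul, Prod.mk_add_mk]
      congr 1
      abel)
    (fun c u p => by simp only [map_smul, smul_mul_assoc, ← smul_add, Prod.smul_mk])
    (fun u p q => by
      simp only [Prod.fst_add, Prod.snd_add, mul_add, Prod.mk_add_mk]
      congr 1
      abel)
    (fun c u p => by
      simp only [Prod.smul_fst, Prod.smul_snd, mul_smul_comm, ← smul_add, Prod.smul_mk])

/-- The derivation of degree `e` of the tensor algebra that extends a linear endomorphism of the
space of letters. -/
def der (e : ℤ) (f : U →ₗ[K] U) : Module.End K (TensorAlgebra K U) :=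
  LinearMap.fst K _ _ ∘ₗ letterRec (derLetter 𝒰 e f) (0, 1)

@[simp] theorem der_one (e : ℤ) (f : U →ₗ[K] U) : der 𝒰 e f 1 = 0 := by simp [der]

@[simp] theorem der_ι_mul (e : ℤ) (f : U →ₗ[K] U) (u : U) (x : TensorAlgebra K U) :
    der 𝒰 e f (ι K u * x) = ι K (f u) * x + ι K (𝒰.sg e u) * der 𝒰 e f x := by
  -- The second component of the state is a copy of the word read so far, which the Leibniz rule
  -- needs when the derivation hits the new letter.
  have h : LinearMap.snd K _ _ ∘ₗ letterRec (derLetter 𝒰 e f) (0, 1) = LinearMap.id := by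
    refine word_hom_ext 𝒰 (by simp) fun n u _ x hx => ?_
    simp only [LinearMap.comp_apply, letterRec_ι_mul, LinearMap.id_apply] at hx ⊢
    conv_rhs => rw [← hx]
    rfl
  have hx : (letterRec (derLetter 𝒰 e f) (0, 1) x).2 = x := LinearMap.congr_fun h x
  rw [der, LinearMap.comp_apply, letterRec_ι_mul]
  change _ + ι K (f u) * (letterRec (derLetter 𝒰 e f) (0, 1) x).2 = _
  rw [hx, add_comm]
  rfl

@[simp] theorem der_ι (e : ℤ) (f : U →ₗ[K] U) (u : U) : der 𝒰 e f (ι K u) = ι K (f u) := by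
  rw [← mul_one (ι K u), der_ι_mul, der_one, mul_zero, add_zero, mul_one]

theorem der_eq_of_even {e e' : ℤ} (h : Even (e - e')) (f : U →ₗ[K] U) :
    der 𝒰 e f = der 𝒰 e' f := by
  refine word_hom_ext 𝒰 (by simp) fun n u _ x hx => ?_
  rw [der_ι_mul, der_ι_mul, hx, 𝒰.sg_eq_of_even h]

/-- `der`, as a linear function of the endomorphism. -/
def derₗ (e : ℤ) : (U →ₗ[K] U) →ₗ[K] Module.End K (TensorAlgebra K U) where
  toFun := der 𝒰 e
  map_add' f f' := by
    refine word_hom_ext 𝒰 (by simp) fun n u _ x hx => ?_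
    rw [LinearMap.add_apply] at hx ⊢
    rw [der_ι_mul, der_ι_mul, der_ι_mul, hx, LinearMap.add_apply, map_add, add_mul, mul_add]
    abel
  map_smul' c f := by
    refine word_hom_ext 𝒰 (by simp) fun n u _ x hx => ?_
    rw [RingHom.id_apply, LinearMap.smul_apply] at hx ⊢
    rw [der_ι_mul, der_ι_mul, hx, LinearMap.smul_apply, map_smul, smul_mul_assoc, mul_smul_comm,
      smul_add]

theorem aug_der (e : ℤ) (f : U →ₗ[K] U) (x : TensorAlgebra K U) : aug (der 𝒰 e f x) = 0 := by
  refine word_induction 𝒰 (S := LinearMap.ker (aug.toLinearMap ∘ₗ der 𝒰 e f)) (by simp)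
    (fun n u _ x _ => ?_) x
  simp [aug_ι]

theorem hasDeg_der {e : ℤ} {f : U →ₗ[K] U} (hf : HasDeg 𝒰 𝒰 e f) :
    HasDeg (signedGrading 𝒰) (signedGrading 𝒰) e (der 𝒰 e f) := by
  refine hasDeg_of_word 𝒰 fun l hl => ?_
  induction l with
  | nil => simp
  | cons c l ih =>
    have hl' := fun c' hc' => hl c' (List.mem_cons_of_mem _ hc')
    rw [word_cons, der_ι_mul, wordDeg_cons]
    refine add_mem ?_ ?_
    · have := ι_mul_mem_gr 𝒰 (hf _ _ (hl c List.mem_cons_self)) (word_mem_gr 𝒰 hl')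
      rwa [show c.1 + wordDeg l + e = wordDeg l + (c.1 + e) by ring]
    · have := ι_mul_mem_gr 𝒰 (𝒰.sg_mem (e := e) (hl c List.mem_cons_self)) (ih hl')
      rwa [show c.1 + wordDeg l + e = wordDeg l + e + c.1 by ring]

theorem der_comm_mulLetter {e : ℤ} (f : U →ₗ[K] U) {n : ℤ} {u : U} (hu : u ∈ 𝒰.gr n) :
    der 𝒰 e f ∘ₗ mulLetter u = (e * n).negOnePow • (mulLetter u ∘ₗ der 𝒰 e f) + mulLetter (f u) := by
  ext x
  simp only [LinearMap.comp_apply, mulLetter_apply, der_ι_mul, 𝒰.sg_apply hu,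
    LinearMap.add_apply, LinearMap.smul_apply]
  rw [map_negOnePow_smul, smul_mul_assoc, add_comm]

end Derivations

section Coproduct

/-- The action of an operator of degree `e` on both factors of a tensor square. -/
def hat (e : ℤ) (P : Module.End K (TensorAlgebra K U)) :
    Module.End K (TensorAlgebra K U ⊗[K] TensorAlgebra K U) :=
  P.rTensor _ + TensorProduct.map ((signedGrading 𝒰).sg e) P

theorem hat_tmul (e : ℤ) (P : Module.End K (TensorAlgebra K U)) (x y : TensorAlgebra K U) :
    hat 𝒰 e P (x ⊗ₜ y) = P x ⊗ₜ y + (signedGrading 𝒰).sg e x ⊗ₜ P y := rfl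

theorem hat_add (e : ℤ) (P R : Module.End K (TensorAlgebra K U)) :
    hat 𝒰 e (P + R) = hat 𝒰 e P + hat 𝒰 e R := by
  refine TensorProduct.ext' fun x y => ?_
  simp only [hat_tmul, LinearMap.add_apply, TensorProduct.add_tmul, TensorProduct.tmul_add]
  abel

/-- Passing from an operator to its action on the tensor square respects graded commutators: the
terms with one operator on each factor cancel by the Koszul signs. -/
theorem hat_comm {e f : ℤ} {P R C : Module.End K (TensorAlgebra K U)}
    (hP : HasDeg (signedGrading 𝒰) (signedGrading 𝒰) e P)
    (hR : HasDeg (signedGrading 𝒰) (signedGrading 𝒰) f R)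
    (h : P ∘ₗ R = (e * f).negOnePow • (R ∘ₗ P) + C) :
    hat 𝒰 e P ∘ₗ hat 𝒰 f R = (e * f).negOnePow • (hat 𝒰 f R ∘ₗ hat 𝒰 e P) + hat 𝒰 (e + f) C := by
  have h' : ∀ x, P (R x) = (e * f).negOnePow • R (P x) + C x := fun x => LinearMap.congr_fun h x
  refine TensorProduct.ext' fun x y => ?_
  simp only [LinearMap.comp_apply, hat_tmul, LinearMap.add_apply, LinearMap.smul_apply, map_add,
    h', TensorProduct.add_tmul, TensorProduct.tmul_add, hP.map_sg, hR.sg_map, smul_add, sg_sg,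
    negOnePow_smul_tmul, tmul_negOnePow_smul]
  rw [mul_comm f e, add_comm f e]
  abel

variable [CharZero K]

/-- The action of the letters on the tensor square. -/
def hatLetter : U →ₗ[K] Module.End K (TensorAlgebra K U ⊗[K] TensorAlgebra K U) :=
  𝒰.glue fun n =>
    { toFun := fun u => hat 𝒰 n (mulLetter u)
      map_add' := fun u v => by rw [map_add, hat_add]
      map_smul' := fun c u => by
        refine TensorProduct.ext' fun x y => ?_
        simp [hat_tmul, TensorProduct.smul_tmul'] }

theorem hatLetter_apply {n : ℤ} {u : U} (hu : u ∈ 𝒰.gr n) :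
    hatLetter 𝒰 u = hat 𝒰 n (mulLetter u) := by
  refine 𝒰.glue_apply (fun e f h => ?_) hu
  refine LinearMap.ext fun u => ?_
  simp only [LinearMap.coe_mk, AddHom.coe_mk, hat, (signedGrading 𝒰).sg_eq_of_even h]

/-- The action of the letters that computes the half coproduct. -/
def coprodLetter : U →ₗ[K] Module.End K ((TensorAlgebra K U ⊗[K] TensorAlgebra K U) × K) :=
  LinearMap.mk₂ K (fun u p => (hatLetter 𝒰 u p.1 + p.2 • (1 ⊗ₜ ι K u), 0))
    (fun u v p => by
      simp only [map_add, LinearMap.add_apply, TensorProduct.tmul_add, smul_add, Prod.mk_add_mk,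
        add_zero]
      congr 1
      abel)
    (fun c u p => by
      simp only [map_smul, LinearMap.smul_apply, TensorProduct.tmul_smul, Prod.smul_mk, smul_zero,
        smul_add]
      rw [smul_comm])
    (fun u p q => by
      simp only [Prod.fst_add, Prod.snd_add, map_add, add_smul, Prod.mk_add_mk, add_zero]
      congr 1
      abel)
    (fun c u p => by
      rw [Prod.smul_fst, Prod.smul_snd, map_smul, smul_assoc, ← smul_add, Prod.smul_mk, smul_zero])

/-- The half unshuffle coproduct: the signed sum over all ways to split a nonempty word into two
subwords, the second of which contains the last letter. -/
def coprod : TensorAlgebra K U →ₗ[K] TensorAlgebra K U ⊗[K] TensorAlgebra K U :=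
  LinearMap.fst K _ _ ∘ₗ letterRec (coprodLetter 𝒰) (0, 1)

omit [CharZero K] in
@[simp] theorem coprod_one : coprod 𝒰 1 = 0 := by simp [coprod]

omit [CharZero K] in
-- A new first letter goes to either side of each splitting. The extra term is the start of the
-- recursion: over a scalar the letter is also the last one and must lie in the second factor.
theorem coprod_ι_mul' (u : U) (x : TensorAlgebra K U) :
    coprod 𝒰 (ι K u * x) = hatLetter 𝒰 u (coprod 𝒰 x) + aug x • (1 ⊗ₜ ι K u) := by
  have h : LinearMap.snd K _ _ ∘ₗ letterRec (coprodLetter 𝒰) (0, 1) = aug.toLinearMap := by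
    refine word_hom_ext 𝒰 (by simp) fun n u _ x hx => ?_
    simp only [LinearMap.comp_apply, letterRec_ι_mul, AlgHom.toLinearMap_apply, aug_ι_mul]
    rfl
  have hx : (letterRec (coprodLetter 𝒰) (0, 1) x).2 = aug x := LinearMap.congr_fun h x
  rw [coprod, LinearMap.comp_apply, letterRec_ι_mul, ← hx]
  rfl

theorem coprod_ι_mul {n : ℤ} {u : U} (hu : u ∈ 𝒰.gr n) (x : TensorAlgebra K U) :
    coprod 𝒰 (ι K u * x) = hat 𝒰 n (mulLetter u) (coprod 𝒰 x) + aug x • (1 ⊗ₜ ι K u) := by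
  rw [coprod_ι_mul', hatLetter_apply 𝒰 hu]

omit [CharZero K] in
theorem coprod_ι (u : U) : coprod 𝒰 (ι K u) = 1 ⊗ₜ ι K u := by
  rw [← mul_one (ι K u), coprod_ι_mul', coprod_one]
  simp

/-- Coderivations of degree `e` with respect to the half coproduct. -/
structure IsCoder (e : ℤ) (P : Module.End K (TensorAlgebra K U)) : Prop where
  hasDeg : HasDeg (signedGrading 𝒰) (signedGrading 𝒰) e P
  aug_apply : ∀ x, aug (P x) = 0
  coprod_apply : ∀ x, coprod 𝒰 (P x) = hat 𝒰 e P (coprod 𝒰 x) + aug x • coprod 𝒰 (P 1)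

/-- Morphisms with respect to the half coproduct. -/
structure IsComor (F : TensorAlgebra K U →ₗ[K] TensorAlgebra K W) : Prop where
  hasDeg : HasDeg (signedGrading 𝒰) (signedGrading 𝒲) 0 F
  map_one : F 1 = 1
  aug_apply : ∀ x, aug (F x) = aug x
  coprod_apply : ∀ x, coprod 𝒲 (F x) = TensorProduct.map F F (coprod 𝒰 x)

variable {𝒰 𝒲 𝒳}

omit [CharZero K] in
theorem IsCoder.add {e : ℤ} {P R : Module.End K (TensorAlgebra K U)} (hP : IsCoder 𝒰 e P)
    (hR : IsCoder 𝒰 e R) : IsCoder 𝒰 e (P + R) where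
  hasDeg := hP.hasDeg.add hR.hasDeg
  aug_apply x := by rw [LinearMap.add_apply, map_add, hP.aug_apply, hR.aug_apply, add_zero]
  coprod_apply x := by
    simp only [LinearMap.add_apply, map_add, hP.coprod_apply x, hR.coprod_apply x, hat_add,
      smul_add]
    abel

omit [CharZero K] in
-- Since coderivations here take values in the kernel of the augmentation, the defect term with `P
-- 1` does not propagate through a second coderivation, and `hat_comm` gives the rest.
theorem IsCoder.comm {e f : ℤ} {P R C : Module.End K (TensorAlgebra K U)} (hP : IsCoder 𝒰 e P)
    (hR : IsCoder 𝒰 f R) (h : P ∘ₗ R = (e * f).negOnePow • (R ∘ₗ P) + C) :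
    IsCoder 𝒰 (e + f) C := by
  have hC : C = P ∘ₗ R + (e * f + 1).negOnePow • (R ∘ₗ P) := by
    rw [h, negOnePow_succ_smul]
    abel
  have aug₀ : ∀ x, aug (C x) = 0 := fun x => by
    have := map_negOnePow_smul (aug (K := K) (U := U)).toLinearMap (e * f + 1) (R (P x))
    rw [AlgHom.toLinearMap_apply, AlgHom.toLinearMap_apply, hR.aug_apply, smul_zero] at this
    rw [hC, LinearMap.add_apply, map_add, LinearMap.comp_apply, hP.aug_apply, zero_add]
    exact this
  refine ⟨?_, aug₀, fun x => ?_⟩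
  · rw [hC]
    refine (hP.hasDeg.comp hR.hasDeg).add (HasDeg.smul ?_ _)
    rw [add_comm e f]
    exact hR.hasDeg.comp hP.hasDeg
  · have H := LinearMap.congr_fun (hat_comm 𝒰 hP.hasDeg hR.hasDeg h) (coprod 𝒰 x)
    have e₁ : hat 𝒰 (e + f) C = hat 𝒰 e P ∘ₗ hat 𝒰 f R +
        (e * f + 1).negOnePow • (hat 𝒰 f R ∘ₗ hat 𝒰 e P) := by
      rw [hat_comm 𝒰 hP.hasDeg hR.hasDeg h, negOnePow_succ_smul]
      abel
    rw [e₁, hC]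
    simp only [LinearMap.add_apply, LinearMap.smul_apply, LinearMap.comp_apply, map_add,
      map_negOnePow_smul]
    rw [hP.coprod_apply (R x), hR.coprod_apply x, hR.coprod_apply (P x), hP.coprod_apply x,
      hP.coprod_apply (R 1), hR.coprod_apply (P 1), hP.aug_apply, hR.aug_apply, hP.aug_apply,
      hR.aug_apply]
    simp only [zero_smul, add_zero, map_add, map_smul, smul_add]
    rw [smul_negOnePow_comm]
    abel

/-- This is why `IsCoder` allows a nonzero value on the unit: the recursion for the coproduct says
precisely that left multiplication by a letter is a coderivation. -/
theorem isCoder_mulLetter {n : ℤ} {u : U} (hu : u ∈ 𝒰.gr n) : IsCoder 𝒰 n (mulLetter u) where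
  hasDeg := hasDeg_mulLetter 𝒰 hu
  aug_apply := aug_ι_mul u
  coprod_apply x := by
    rw [mulLetter_apply, coprod_ι_mul 𝒰 hu, mulLetter_apply, mul_one, coprod_ι]

/-- The derivation kills the unit, so no defect term occurs. The induction on words rests on its
commutator with left multiplication by `u` being left multiplication by `f u`. -/
theorem isCoder_der {e : ℤ} {f : U →ₗ[K] U} (hf : HasDeg 𝒰 𝒰 e f) : IsCoder 𝒰 e (der 𝒰 e f) where
  hasDeg := hasDeg_der 𝒰 hf
  aug_apply := aug_der 𝒰 e f
  coprod_apply x := by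
    rw [der_one, map_zero, smul_zero, add_zero]
    refine LinearMap.congr_fun (word_hom_ext 𝒰 (f := coprod 𝒰 ∘ₗ der 𝒰 e f)
      (g := hat 𝒰 e (der 𝒰 e f) ∘ₗ coprod 𝒰) (by simp) fun n u hu x hx => ?_) x
    simp only [LinearMap.comp_apply] at hx ⊢
    have H := LinearMap.congr_fun (hat_comm 𝒰 (hasDeg_der 𝒰 hf) (hasDeg_mulLetter 𝒰 hu)
      (der_comm_mulLetter 𝒰 f hu)) (coprod 𝒰 x)
    simp only [LinearMap.comp_apply, LinearMap.add_apply, LinearMap.smul_apply] at H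
    rw [der_ι_mul, map_add, coprod_ι_mul 𝒰 (hf n u hu), coprod_ι_mul 𝒰 hu, map_add, H, 
      𝒰.sg_apply hu, map_negOnePow_smul, smul_mul_assoc, map_negOnePow_smul, coprod_ι_mul 𝒰 hu, hx,
      aug_der, zero_smul, add_zero, map_smul, hat_tmul, der_one, TensorProduct.zero_tmul, zero_add,
      sg_one, der_ι, add_comm e n]
    abel

omit [CharZero K] in
theorem IsComor.comp {F : TensorAlgebra K U →ₗ[K] TensorAlgebra K W}
    {G : TensorAlgebra K W →ₗ[K] TensorAlgebra K X} (hG : IsComor 𝒲 𝒳 G) (hF : IsComor 𝒰 𝒲 F) :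
    IsComor 𝒰 𝒳 (G ∘ₗ F) where
  hasDeg := by simpa using hG.hasDeg.comp hF.hasDeg
  map_one := by rw [LinearMap.comp_apply, hF.map_one, hG.map_one]
  aug_apply x := by rw [LinearMap.comp_apply, hG.aug_apply, hF.aug_apply]
  coprod_apply x := by
    rw [LinearMap.comp_apply, hG.coprod_apply, hF.coprod_apply, TensorProduct.map_comp]
    rfl

omit [CharZero K] in
theorem IsComor.inverse {F : TensorAlgebra K U →ₗ[K] TensorAlgebra K W}
    {G : TensorAlgebra K W →ₗ[K] TensorAlgebra K U} (hF : IsComor 𝒰 𝒲 F)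
    (hG : HasDeg (signedGrading 𝒲) (signedGrading 𝒰) 0 G) (h₁ : ∀ x, F (G x) = x)
    (h₂ : ∀ x, G (F x) = x) : IsComor 𝒲 𝒰 G where
  hasDeg := hG
  map_one := by rw [← h₂ 1, hF.map_one]
  aug_apply x := by rw [← hF.aug_apply, h₁]
  coprod_apply x := by
    have h : TensorProduct.map G G ∘ₗ TensorProduct.map F F = LinearMap.id := by
      rw [← TensorProduct.map_comp, show G ∘ₗ F = LinearMap.id from LinearMap.ext h₂,
        TensorProduct.map_id]
    conv_rhs => rw [← h₁ x, hF.coprod_apply]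
    exact (LinearMap.congr_fun h _).symm

omit [CharZero K] in
-- Used to conjugate the derivation extending the differential by the change of coordinates of an
-- anchor.
theorem IsCoder.conj {F : TensorAlgebra K U →ₗ[K] TensorAlgebra K W}
    {G : TensorAlgebra K W →ₗ[K] TensorAlgebra K U} (hF : IsComor 𝒰 𝒲 F) (hG : IsComor 𝒲 𝒰 G)
    (h₂ : ∀ x, F (G x) = x) {e : ℤ} {P : Module.End K (TensorAlgebra K U)}
    (hP : IsCoder 𝒰 e P) : IsCoder 𝒲 e (F ∘ₗ P ∘ₗ G) where
  hasDeg := by simpa using hF.hasDeg.comp (hP.hasDeg.comp hG.hasDeg)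
  aug_apply x := by rw [LinearMap.comp_apply, hF.aug_apply, LinearMap.comp_apply, hP.aug_apply]
  coprod_apply x := by
    have h : TensorProduct.map F F ∘ₗ hat 𝒰 e P ∘ₗ TensorProduct.map G G =
        hat 𝒲 e (F ∘ₗ P ∘ₗ G) := by
      refine TensorProduct.ext' fun x y => ?_
      simp only [LinearMap.comp_apply, TensorProduct.map_tmul, hat_tmul, map_add, h₂,
        hG.hasDeg.sg_map, mul_zero, Int.negOnePow_zero, one_smul]
    rw [← h]
    simp only [LinearMap.comp_apply]
    rw [hF.coprod_apply, hP.coprod_apply, hF.coprod_apply, hG.coprod_apply, hG.aug_apply,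
      hG.map_one, map_add, map_smul]

/-- Morphisms obtained by replacing left multiplications by coderivations. -/
theorem isComor_letterRec {E : U →ₗ[K] Module.End K (TensorAlgebra K W)} {θ : U →ₗ[K] W}
    (hE : ∀ n, ∀ u ∈ 𝒰.gr n, IsCoder 𝒲 n (E u)) (h₁ : ∀ u, E u 1 = ι K (θ u)) :
    IsComor 𝒰 𝒲 (letterRec E 1) := by
  have hdeg : HasDeg (signedGrading 𝒰) (signedGrading 𝒲) 0 (letterRec E 1) := by
    refine hasDeg_of_word 𝒰 fun l hl => ?_
    rw [add_zero]
    induction l with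
    | nil => simpa using one_mem_gr 𝒲
    | cons c l ih =>
      rw [word_cons, letterRec_ι_mul, wordDeg_cons, add_comm]
      exact (hE _ _ (hl c List.mem_cons_self)).hasDeg _ _
        (ih fun c' hc' => hl c' (List.mem_cons_of_mem _ hc'))
  have haug : ∀ x, aug (letterRec E 1 x) = aug x := fun x =>
    LinearMap.congr_fun (word_hom_ext 𝒰 (f := aug.toLinearMap ∘ₗ letterRec E 1)
      (g := aug.toLinearMap) (by simp) fun n u hu x _ => by
        simp [(hE n u hu).aug_apply, aug_ι_mul]) x
  refine ⟨hdeg, letterRec_one _ _, haug, fun x => ?_⟩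
  refine LinearMap.congr_fun (word_hom_ext 𝒰 (f := coprod 𝒲 ∘ₗ letterRec E 1)
    (g := TensorProduct.map (letterRec E 1) (letterRec E 1) ∘ₗ coprod 𝒰) (by simp)
      fun n u hu x hx => ?_) x
  simp only [LinearMap.comp_apply] at hx ⊢
  -- The map turns left multiplication by `u` into `E u` and has degree 0, so its tensor square
  -- turns one diagonal action into the other. The defect terms agree because `E u 1` is again a
  -- letter.
  have h : TensorProduct.map (letterRec E 1) (letterRec E 1) ∘ₗ hat 𝒰 n (mulLetter u) =
      hat 𝒲 n (E u) ∘ₗ TensorProduct.map (letterRec E 1) (letterRec E 1) := by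
    refine TensorProduct.ext' fun x y => ?_
    simp only [LinearMap.comp_apply, TensorProduct.map_tmul, hat_tmul, map_add, hdeg.map_sg,
      mul_zero, Int.negOnePow_zero, one_smul, mulLetter_apply, letterRec_ι_mul]
  rw [letterRec_ι_mul, (hE n u hu).coprod_apply, hx, haug, coprod_ι_mul 𝒰 hu, map_add, map_smul,
    TensorProduct.map_tmul, letterRec_one, letterRec_ι, h₁, coprod_ι]
  congr 1
  exact (LinearMap.congr_fun h _).symm

end Coproduct

end TensorAlgebra

/-! ### Cofreeness: recovering coderivations and morphisms from their length one components -/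

namespace TensorAlgebra

open SignedGrading

variable {K : Type*} [Field K] [CharZero K] {U : Type*} [AddCommGroup U] [Module K U]
  {W : Type*} [AddCommGroup W] [Module K W] {Y : Type*} [AddCommGroup Y] [Module K Y]
  {𝒰 : SignedGrading K U} {𝒲 : SignedGrading K W}

variable (K U) in
/-- The concatenation of the first factor with the part of length one of the second factor. -/
def concatProj : TensorAlgebra K U ⊗[K] TensorAlgebra K U →ₗ[K] TensorAlgebra K U :=
  LinearMap.mul' K _ ∘ₗ TensorProduct.map LinearMap.id (ι K ∘ₗ proj)

omit [CharZero K] in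
theorem concatProj_tmul (x y : TensorAlgebra K U) :
    concatProj K U (x ⊗ₜ y) = x * ι K (proj y) := by simp [concatProj]

/-- The second factor of every splitting contains the last letter, hence is never empty. -/
theorem lid_aug_coprod (x : TensorAlgebra K U) :
    TensorProduct.rid K _ (TensorProduct.map LinearMap.id aug.toLinearMap (coprod 𝒰 x)) = 0 := by
  refine LinearMap.congr_fun (word_hom_ext 𝒰 (f := (TensorProduct.rid K _).toLinearMap ∘ₗ
    TensorProduct.map LinearMap.id aug.toLinearMap ∘ₗ coprod 𝒰) (g := 0) (by simp)
    fun n u hu x hx => ?_) x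
  have h : ∀ z, TensorProduct.rid K _ (TensorProduct.map LinearMap.id aug.toLinearMap
      (hat 𝒰 n (mulLetter u) z)) =
      ι K u * TensorProduct.rid K _ (TensorProduct.map LinearMap.id aug.toLinearMap z) := by
    intro z
    induction z using TensorProduct.induction_on with
    | zero => simp
    | tmul a b => simp [hat_tmul, aug_ι]
    | add a b ha hb => simp only [map_add, ha, hb, mul_add]
  simp only [LinearMap.comp_apply, LinearEquiv.coe_coe, LinearMap.zero_apply] at hx ⊢
  rw [coprod_ι_mul 𝒰 hu, map_add, map_add, h, hx]
  simp [aug_ι]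

/-- Among all splittings of a nonempty word, only the one whose second part is the last letter alone
survives projection to length one, and concatenation then gives the word back. This is the form in
which cofreeness is used. -/
theorem concatProj_coprod (x : TensorAlgebra K U) :
    concatProj K U (coprod 𝒰 x) = x - algebraMap K _ (aug x) := by
  refine LinearMap.congr_fun (word_hom_ext 𝒰 (f := concatProj K U ∘ₗ coprod 𝒰)
    (g := LinearMap.id - Algebra.linearMap K _ ∘ₗ aug.toLinearMap) (by simp)
    fun n u hu x hx => ?_) x
  have h : ∀ z, concatProj K U (hat 𝒰 n (mulLetter u) z) = ι K u * concatProj K U z +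
      (signedGrading 𝒰).sg n (TensorProduct.rid K _
        (TensorProduct.map LinearMap.id aug.toLinearMap z)) * ι K u := by
    intro z
    induction z using TensorProduct.induction_on with
    | zero => simp
    | tmul a b => simp [hat_tmul, concatProj_tmul, proj_ι_mul, mul_assoc]
    | add a b ha hb =>
      simp only [map_add, ha, hb, mul_add, add_mul]
      abel
  simp only [LinearMap.comp_apply, LinearMap.sub_apply, LinearMap.id_apply,
    AlgHom.toLinearMap_apply, Algebra.linearMap_apply] at hx ⊢
  rw [coprod_ι_mul 𝒰 hu, map_add, h, hx, lid_aug_coprod, map_zero, zero_mul, add_zero, map_smul,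
    concatProj_tmul, proj_ι, one_mul, aug_ι_mul, map_zero, sub_zero, mul_sub,
    Algebra.algebraMap_eq_smul_one, mul_smul_comm, mul_one, sub_add_cancel]

theorem coprod_word_append_singleton (l : List (ℤ × U)) (c : ℤ × U)
    (hl : ∀ d ∈ l, d.2 ∈ 𝒰.gr d.1) :
    coprod 𝒰 (word (l ++ [c])) = splitsSum l fun a b => word a ⊗ₜ word (b ++ [c]) := by
  induction l with
  | nil => simp [splitsSum, coprod_ι]
  | cons d l ih =>
    have hl' := fun c' hc' => hl c' (List.mem_cons_of_mem _ hc')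
    rw [List.cons_append, word_cons, coprod_ι_mul 𝒰 (hl d List.mem_cons_self), ih hl',
      word_append l, word_singleton, map_mul, aug_ι, mul_zero, zero_smul, add_zero, map_splitsSum]
    refine splitsSum_congr fun a b ha hb => ?_
    rw [hat_tmul, (signedGrading 𝒰).sg_apply (word_mem_gr 𝒰 fun c' hc' => hl' c' (ha.subset hc')),
      negOnePow_smul_tmul]
    simp

omit [CharZero K] in
theorem aug_word_append_singleton (l : List (ℤ × U)) (c : ℤ × U) :
    aug (word (K := K) (l ++ [c])) = 0 := by
  rw [word_append, word_singleton, map_mul, aug_ι, mul_zero]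

/-- A morphism for the half coproduct is determined by its components of length one. -/
theorem IsComor.apply_word {F : TensorAlgebra K U →ₗ[K] TensorAlgebra K W} (hF : IsComor 𝒰 𝒲 F)
    (l : List (ℤ × U)) (hl : ∀ d ∈ l, d.2 ∈ 𝒰.gr d.1) :
    F (word l) = partsSum l fun bs => (bs.map fun b => ι K (proj (F (word b)))).prod := by
  induction hn : l.length using Nat.strong_induction_on generalizing l with
  | _ n ih =>
    rcases List.eq_nil_or_concat' l with rfl | ⟨l, c, rfl⟩
    · simp [partsSum, hF.map_one]
    · have hl' : ∀ d ∈ l, d.2 ∈ 𝒰.gr d.1 := fun d hd => hl d (List.mem_append_left _ hd)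
      -- Rebuild the image from its coproduct: the part of the splitting holding the last letter
      -- becomes the last block, and the other part is shorter, so induction cuts it into the
      -- remaining blocks.
      have h := concatProj_coprod (𝒰 := 𝒲) (F (word (l ++ [c])))
      rw [hF.aug_apply, aug_word_append_singleton, map_zero, sub_zero, hF.coprod_apply,
        coprod_word_append_singleton l c hl', map_splitsSum, map_splitsSum] at h
      rw [← h, partsSum_append_singleton]
      refine splitsSum_congr fun a b ha hb => ?_
      rw [TensorProduct.map_tmul, concatProj_tmul, ih a.length ?_ a
        (fun d hd => hl' d (ha.subset hd)) rfl]
      · refine (map_partsSum (LinearMap.mulRight K (ι K (proj (F (word (b ++ [c])))))) a _).trans ?_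
        simp
      · rw [← hn, List.length_append, List.length_singleton]
        exact Nat.lt_succ_of_le ha.length_le

omit [AddCommGroup U] in
-- Needed for the part of a coderivation acting on the first factor: there the second factor is
-- projected unchanged, which leaves only the splitting with the last letter alone.
theorem splitsSum_eq_of_right_nil (l : List (ℤ × U)) (k : List (ℤ × U) → List (ℤ × U) → Y)
    (hk : ∀ a b, b ≠ [] → k a b = 0) : splitsSum l k = k l [] := by
  induction l generalizing k with
  | nil => rfl
  | cons c l ih =>
    rw [splitsSum, ih]
    · rw [hk _ [c] (by simp), smul_zero, add_zero]
    · intro a b hb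
      rw [hk _ _ hb, hk _ (c :: b) (by simp), smul_zero, add_zero]

omit [CharZero K] in
theorem proj_word_append_singleton (b : List (ℤ × U)) (c : ℤ × U) (hb : b ≠ []) :
    proj (word (K := K) (b ++ [c])) = 0 := by
  cases b with
  | nil => exact absurd rfl hb
  | cons d b => rw [List.cons_append, word_cons, proj_ι_mul, word_append, map_mul, word_singleton,
      aug_ι, mul_zero, zero_smul]

/-- A coderivation of degree one that vanishes on the unit is determined by its components of
length one. -/
theorem IsCoder.apply_word {Q : Module.End K (TensorAlgebra K U)} (hQ : IsCoder 𝒰 1 Q)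
    (h₁ : Q 1 = 0) {n : ℕ} (y : Fin n → ℤ × U) (hy : ∀ i, (y i).2 ∈ 𝒰.gr (y i).1) :
    Q (word (List.ofFn y)) =
      ∑ k : Fin n, splitsSum ((List.ofFn y).take k) fun a b => (wordDeg a).negOnePow •
        (word a * ι K (proj (Q (word (b ++ [y k])))) * word ((List.ofFn y).drop (k + 1))) := by
  induction n with
  | zero => simp [h₁]
  | succ n ih =>
    set l := List.ofFn fun i : Fin n => y i.castSucc with hl
    set c := y (Fin.last n) with hc
    have hlen : l.length = n := List.length_ofFn
    have hlc : List.ofFn y = l ++ [c] := by rw [List.ofFn_succ', List.concat_eq_append]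
    have hl' : ∀ d ∈ l, d.2 ∈ 𝒰.gr d.1 := by
      intro d hd
      obtain ⟨i, rfl⟩ := (List.mem_ofFn' _ _).1 hd
      exact hy _
    have h := concatProj_coprod (𝒰 := 𝒰) (Q (word (l ++ [c])))
    rw [hQ.aug_apply, map_zero, sub_zero, hQ.coprod_apply, h₁, map_zero, smul_zero, add_zero,
      coprod_word_append_singleton l c hl', map_splitsSum, map_splitsSum] at h
    rw [Fin.sum_univ_castSucc, hlc, ← h]
    -- If `Q` acts on the first factor, the bracket involves only earlier letters and induction
    -- applies. If it acts on the second, the last letter is the distinguished argument of the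
    -- bracket; the sign is that of moving `Q`, of degree one, past `a`.
    have hterm : ∀ a b : List (ℤ × U), a.Sublist l → b.Sublist l →
        concatProj K U (hat 𝒰 1 Q ((word a : TensorAlgebra K U) ⊗ₜ[K]
          (word (b ++ [c]) : TensorAlgebra K U))) =
          Q (word a) * ι K (proj (word (K := K) (b ++ [c]))) +
            (wordDeg a).negOnePow • (word a * ι K (proj (Q (word (b ++ [c]))))) := by
      intro a b ha hb
      rw [hat_tmul, map_add, concatProj_tmul, concatProj_tmul, (signedGrading 𝒰).sg_apply
        (word_mem_gr 𝒰 fun c' hc' => hl' c' (ha.subset hc')), one_mul, smul_mul_assoc]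
    rw [splitsSum_congr hterm, splitsSum_add]
    congr 1
    · rw [splitsSum_eq_of_right_nil]
      · rw [List.nil_append, word_singleton, proj_ι, ih _ fun i => hy _, Finset.sum_mul]
        refine Finset.sum_congr rfl fun k _ => ?_
        refine (map_splitsSum (LinearMap.mulRight K (ι K c.2)) _ _).trans ?_
        have e₁ : (l ++ [c]).take (k.castSucc : Fin (n + 1)) = l.take k := by
          rw [Fin.val_castSucc, List.take_append_of_le_length (by rw [hlen]; exact k.2.le)]
        have e₂ : (l ++ [c]).drop ((k.castSucc : Fin (n + 1)) + 1) = l.drop (k + 1) ++ [c] := by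
          rw [Fin.val_castSucc, List.drop_append_of_le_length (by rw [hlen]; exact k.2)]
        rw [e₁, e₂]
        refine splitsSum_congr fun a b _ _ => ?_
        rw [map_negOnePow_smul, LinearMap.mulRight_apply, mul_assoc _ _ (ι K c.2),
          word_append (l.drop _), word_singleton]
      · intro a b hb
        rw [proj_word_append_singleton (K := K) b c hb, map_zero, mul_zero]
    · have e₁ : (l ++ [c]).take (Fin.last n) = l := by
        rw [Fin.val_last, List.take_append_of_le_length hlen.ge, ← hlen, List.take_length]
      have e₂ : (l ++ [c]).drop (Fin.last n + 1) = [] := by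
        rw [List.drop_eq_nil_iff]
        simp [hlen]
      rw [e₁, e₂, word_nil]
      simp only [mul_one, hc]

/-- The multilinear maps that are the components of a linear map on the tensor algebra. -/
def family (φ : TensorAlgebra K U →ₗ[K] W) (n : ℕ) : MultilinearMap K (fun _ : Fin n => U) W :=
  φ.compMultilinearMap (tprod K U n)

omit [CharZero K] in
theorem family_apply (φ : TensorAlgebra K U →ₗ[K] W) {n : ℕ} (x : Fin n → U) :
    family φ n x = φ (List.ofFn fun i => ι K (x i)).prod := by
  rw [family, LinearMap.compMultilinearMap_apply, tprod_apply]

omit [CharZero K] in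
theorem word_ofFn {n : ℕ} (y : Fin n → ℤ × U) :
    word (K := K) (List.ofFn y) = (List.ofFn fun i => ι K (y i).2).prod := by
  rw [word, List.map_ofFn]
  rfl

omit [CharZero K] in
theorem evalList_family (φ : TensorAlgebra K U →ₗ[K] W) (l : List U) :
    evalList (family φ) l = φ (l.map (ι K)).prod := evalList_eq φ l

/-- This identifies the shuffle sum in the Jacobi and morphism equations with composition by the
coderivation. For `φ = proj ∘ Q` the Jacobi identities follow from Q² = 0. -/
theorem insertSum_family {Q : Module.End K (TensorAlgebra K U)} (hQ : IsCoder 𝒰 1 Q)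
    (h₁ : Q 1 = 0) (φ : TensorAlgebra K U →ₗ[K] W) {n : ℕ} (e : Fin n → ℤ) (x : Fin n → U)
    (hx : ∀ i, x i ∈ 𝒰.gr (e i)) :
    insertSum (family φ) (family (proj ∘ₗ Q)) e x = family (φ ∘ₗ Q) n x := by
  have h := insertSum_eq_sum_splitsSum (family φ) (family (proj ∘ₗ Q)) fun i => (e i, x i)
  rw [h, family_apply, LinearMap.comp_apply, ← word_ofFn (fun i => (e i, x i)),
    hQ.apply_word h₁ _ hx, map_sum]
  refine Finset.sum_congr rfl fun k _ => ?_
  rw [map_splitsSum]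
  refine splitsSum_congr fun a b _ _ => ?_
  rw [evalList_family, evalList_family, map_negOnePow_smul]
  simp [word, List.map_append, mul_assoc, Function.comp_def]

/-- The companion for sums over partitions: they compute composition with a coalgebra morphism. It
serves both the morphism equations and the composition law. -/
theorem compSum_family {F : TensorAlgebra K U →ₗ[K] TensorAlgebra K W} (hF : IsComor 𝒰 𝒲 F)
    (ψ : TensorAlgebra K W →ₗ[K] Y) {n : ℕ} (e : Fin n → ℤ) (x : Fin n → U)
    (hx : ∀ i, x i ∈ 𝒰.gr (e i)) :
    compSum (family ψ) (family (proj ∘ₗ F)) e x = family (ψ ∘ₗ F) n x := by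
  have hl : ∀ d ∈ List.ofFn fun i => (e i, x i), d.2 ∈ 𝒰.gr d.1 := by
    intro d hd
    obtain ⟨i, rfl⟩ := (List.mem_ofFn' _ _).1 hd
    exact hx _
  rw [family_apply, LinearMap.comp_apply, ← word_ofFn (fun i => (e i, x i)), hF.apply_word _ hl,
    map_partsSum, ← OrderedFinpartition.sum_koszul_blocks]
  refine Finset.sum_congr rfl fun c _ => ?_
  refine congrArg₂ _ rfl ?_
  rw [family_apply]
  congr 2
  simp [OrderedFinpartition.blocks, List.map_ofFn, Function.comp_def, family_apply, word_ofFn]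

end TensorAlgebra

/-! ### Graded commutative algebras and free modules over them -/

/-- A signed grading that makes an algebra graded commutative. -/
structure SignedAlgebra (K : Type*) [Field K] (A : Type*) [Ring A] [Algebra K A] extends
    SignedGrading K A where
  one_mem : (1 : A) ∈ gr 0
  mul_mem : ∀ {m n : ℤ} {a b : A}, a ∈ gr m → b ∈ gr n → a * b ∈ gr (m + n)
  mul_comm : ∀ {m n : ℤ} {a b : A}, a ∈ gr m → b ∈ gr n → a * b = (m * n).negOnePow • (b * a)

namespace SignedAlgebra

open SignedGrading TensorAlgebra

variable {K : Type*} [Field K] {A : Type*} [Ring A] [Algebra K A] (𝒜 : SignedAlgebra K A)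
  {M : Type*} [AddCommGroup M] [Module K M] (ℳ : SignedGrading K M)
  {N : Type*} [AddCommGroup N] [Module K N]

theorem sg_mul (e : ℤ) (a b : A) : 𝒜.sg e (a * b) = 𝒜.sg e a * 𝒜.sg e b := by
  refine le_of_gr_le (𝒱 := 𝒜.toSignedGrading) (S := LinearMap.eqLocus
    (𝒜.sg e ∘ₗ LinearMap.mulRight K b) (LinearMap.mulRight K (𝒜.sg e b) ∘ₗ 𝒜.sg e))
    (fun m a ha => ?_) a
  refine le_of_gr_le (𝒱 := 𝒜.toSignedGrading) (S := LinearMap.eqLocus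
    (𝒜.sg e ∘ₗ LinearMap.mulLeft K a) (LinearMap.mulLeft K (𝒜.sg e a) ∘ₗ 𝒜.sg e))
    (fun n b hb => ?_) b
  simp only [LinearMap.mem_eqLocus, LinearMap.comp_apply, LinearMap.mulLeft_apply]
  rw [𝒜.sg_apply ha, 𝒜.sg_apply hb, 𝒜.sg_apply (𝒜.mul_mem ha hb), smul_mul_smul_comm,
    ← Int.negOnePow_add, mul_add]

@[simp] theorem sg_one (e : ℤ) : 𝒜.sg e 1 = 1 := by
  rw [𝒜.sg_apply 𝒜.one_mem, mul_zero]
  simp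

theorem mul_eq_sg_mul {p : ℤ} {b : A} (hb : b ∈ 𝒜.gr p) (c : A) : b * c = 𝒜.sg p c * b :=
  le_of_gr_le (𝒱 := 𝒜.toSignedGrading) (S := LinearMap.eqLocus (LinearMap.mulLeft K b)
    (LinearMap.mulRight K b ∘ₗ 𝒜.sg p)) (fun n c hc => by
      simp only [LinearMap.mem_eqLocus, LinearMap.mulLeft_apply, LinearMap.comp_apply,
        LinearMap.mulRight_apply]
      rw [𝒜.mul_comm hb hc, 𝒜.sg_apply hc, smul_mul_assoc]) c

/-- A derivation of degree `e` of a graded algebra. -/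
structure IsDer (e : ℤ) (p : A →ₗ[K] A) : Prop where
  hasDeg : HasDeg 𝒜.toSignedGrading 𝒜.toSignedGrading e p
  map_mul : ∀ a b, p (a * b) = p a * b + 𝒜.sg e a * p b

variable {𝒜} in
theorem IsDer.map_one {e : ℤ} {p : A →ₗ[K] A} (hp : 𝒜.IsDer e p) : p 1 = 0 := by
  have := hp.map_mul 1 1
  rwa [mul_one, mul_one, sg_one, one_mul, left_eq_add] at this

/-- The signed grading of a free module. -/
def tensor : SignedGrading K (A ⊗[K] M) where
  gr n := Submodule.span K {z | ∃ p q : ℤ, ∃ a ∈ 𝒜.gr p, ∃ x ∈ ℳ.gr q, p + q = n ∧ z = a ⊗ₜ[K] x}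
  sg e := TensorProduct.map (𝒜.sg e) (ℳ.sg e)
  sg_apply {e n z} hz := by
    have : Submodule.span K
        {z | ∃ p q : ℤ, ∃ a ∈ 𝒜.gr p, ∃ x ∈ ℳ.gr q, p + q = n ∧ z = a ⊗ₜ[K] x} ≤
        LinearMap.eqLocus (TensorProduct.map (𝒜.sg e) (ℳ.sg e))
          ((e * n).negOnePow • LinearMap.id) := by
      refine Submodule.span_le.2 ?_
      rintro _ ⟨p, q, a, ha, x, hx, rfl, rfl⟩
      simp only [SetLike.mem_coe, LinearMap.mem_eqLocus, TensorProduct.map_tmul,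
        LinearMap.smul_apply, LinearMap.id_apply, 𝒜.sg_apply ha, ℳ.sg_apply hx,
        negOnePow_smul_tmul, tmul_negOnePow_smul, smul_smul, ← Int.negOnePow_add, mul_add]
      rw [add_comm]
    exact this hz
  iSup_gr := by
    refine eq_top_iff.2 fun z _ => ?_
    induction z using TensorProduct.induction_on with
    | zero => exact zero_mem _
    | add y z hy hz => exact add_mem (hy trivial) (hz trivial)
    | tmul a x =>
      refine le_of_gr_le (𝒱 := 𝒜.toSignedGrading)
        (S := (⨆ n, _ : Submodule K (A ⊗[K] M)).comap ((TensorProduct.mk K A M).flip x))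
        (fun p a ha => ?_) a
      refine le_of_gr_le (𝒱 := ℳ) (S := (⨆ n, _ : Submodule K (A ⊗[K] M)).comap
        (TensorProduct.mk K A M a)) (fun q x hx => ?_) x
      exact Submodule.mem_iSup_of_mem (p + q)
        (Submodule.subset_span ⟨p, q, a, ha, x, hx, rfl, rfl⟩)

theorem tmul_mem_gr {p q n : ℤ} {a : A} {x : M} (ha : a ∈ 𝒜.gr p) (hx : x ∈ ℳ.gr q)
    (h : p + q = n) : a ⊗ₜ[K] x ∈ (𝒜.tensor ℳ).gr n :=
  Submodule.subset_span ⟨p, q, a, ha, x, hx, h, rfl⟩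

theorem one_tmul_mem_gr {q : ℤ} {x : M} (hx : x ∈ ℳ.gr q) :
    (1 : A) ⊗ₜ[K] x ∈ (𝒜.tensor ℳ).gr q := 𝒜.tmul_mem_gr ℳ 𝒜.one_mem hx (zero_add q)

theorem tensor_sg_smul (e : ℤ) (a : A) (z : A ⊗[K] M) :
    (𝒜.tensor ℳ).sg e (a • z) = 𝒜.sg e a • (𝒜.tensor ℳ).sg e z := by
  induction z using TensorProduct.induction_on with
  | zero => simp
  | add y z hy hz => simp only [smul_add, map_add, hy, hz]
  | tmul b x =>
    rw [TensorProduct.smul_tmul', smul_eq_mul]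
    change 𝒜.sg e (a * b) ⊗ₜ[K] ℳ.sg e x = 𝒜.sg e a • (𝒜.sg e b ⊗ₜ[K] ℳ.sg e x)
    rw [sg_mul, TensorProduct.smul_tmul', smul_eq_mul]

theorem rTensor_smul {e : ℤ} {p : A →ₗ[K] A} (hp : 𝒜.IsDer e p) (a : A) (z : A ⊗[K] M) :
    p.rTensor M (a • z) = p a • z + 𝒜.sg e a • p.rTensor M z := by
  induction z using TensorProduct.induction_on with
  | zero => simp
  | add y z hy hz =>
    simp only [smul_add, map_add, hy, hz]
    abel
  | tmul b x =>
    simp only [TensorProduct.smul_tmul', smul_eq_mul, LinearMap.rTensor_tmul, hp.map_mul,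
      TensorProduct.add_tmul]

variable {ℳ} in
theorem hasDeg_rTensor {e : ℤ} {p : A →ₗ[K] A} (hp : 𝒜.IsDer e p) :
    HasDeg (𝒜.tensor ℳ) (𝒜.tensor ℳ) e (p.rTensor M) := by
  intro n z hz
  suffices H : (𝒜.tensor ℳ).gr n ≤ ((𝒜.tensor ℳ).gr (n + e)).comap (p.rTensor M) from H hz
  refine Submodule.span_le.2 ?_
  rintro _ ⟨m, q, a, ha, x, hx, rfl, rfl⟩
  exact 𝒜.tmul_mem_gr ℳ (hp.hasDeg _ _ ha) hx (by ring)

variable (A) in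
/-- The `A`-linear extension of a linear map to a free module. -/
def linExt (u : M →ₗ[K] A ⊗[K] N) : A ⊗[K] M →ₗ[K] A ⊗[K] N :=
  TensorProduct.lift (LinearMap.mk₂ K (fun a x => a • u x) (fun a b x => add_smul a b (u x))
    (fun c a x => smul_assoc c a (u x)) (fun a x y => by rw [map_add, smul_add])
    (fun c a x => by rw [map_smul, smul_comm]))

@[simp] theorem linExt_tmul (u : M →ₗ[K] A ⊗[K] N) (a : A) (x : M) :
    linExt A u (a ⊗ₜ[K] x) = a • u x := rfl

theorem linExt_smul (u : M →ₗ[K] A ⊗[K] N) (a : A) (z : A ⊗[K] M) :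
    linExt A u (a • z) = a • linExt A u z := by
  induction z using TensorProduct.induction_on with
  | zero => simp
  | add y z hy hz => rw [smul_add, map_add, map_add, smul_add, hy, hz]
  | tmul b x => simp [TensorProduct.smul_tmul', mul_smul]

section TensorAlgebra

variable [CharZero K]

variable (A) in
/-- The action on `A ⊗ T(M)` of a letter in `M`. -/
def baseLetter : M →ₗ[K] Module.End K (A ⊗[K] TensorAlgebra K M) :=
  ℳ.glue fun n =>
    { toFun := fun m => TensorProduct.map (𝒜.sg n) (mulLetter m)
      map_add' := fun u v => by rw [map_add, TensorProduct.map_add_right]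
      map_smul' := fun c u => by rw [map_smul, TensorProduct.map_smul_right, RingHom.id_apply] }

theorem baseLetter_tmul {n : ℤ} {m : M} (hm : m ∈ ℳ.gr n) (a : A) (x : TensorAlgebra K M) :
    𝒜.baseLetter A ℳ m (a ⊗ₜ x) = 𝒜.sg n a ⊗ₜ (ι K m * x) := by
  rw [baseLetter, ℳ.glue_apply (fun e f h => ?_) hm]
  · rfl
  · refine LinearMap.ext fun u => ?_
    simp only [LinearMap.coe_mk, AddHom.coe_mk, 𝒜.sg_eq_of_even h]

/-- The action on `A ⊗ T(M)` of a letter in `A ⊗ M`. -/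
def freeLetter : A ⊗[K] M →ₗ[K] Module.End K (A ⊗[K] TensorAlgebra K M) :=
  TensorProduct.lift (LinearMap.mk₂ K (fun b m => Algebra.lsmul K K _ b ∘ₗ 𝒜.baseLetter A ℳ m)
    (fun a b m => by rw [map_add, LinearMap.add_comp])
    (fun c a m => by rw [map_smul, LinearMap.smul_comp])
    (fun a m m' => by rw [map_add, LinearMap.comp_add])
    (fun c a m => by rw [map_smul, LinearMap.comp_smul]))

omit [CharZero K] in
theorem freeLetter_tmul_apply (b : A) (m : M) (z : A ⊗[K] TensorAlgebra K M) :
    𝒜.freeLetter ℳ (b ⊗ₜ m) z = b • 𝒜.baseLetter A ℳ m z := rfl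

theorem freeLetter_tmul {n : ℤ} {m : M} (hm : m ∈ ℳ.gr n) (b a : A) (x : TensorAlgebra K M) :
    𝒜.freeLetter ℳ (b ⊗ₜ m) (a ⊗ₜ x) = (b * 𝒜.sg n a) ⊗ₜ (ι K m * x) := by
  rw [freeLetter_tmul_apply, 𝒜.baseLetter_tmul ℳ hm, TensorProduct.smul_tmul', smul_eq_mul]

omit [CharZero K] in
theorem freeLetter_smul (a : A) (u : A ⊗[K] M) (z : A ⊗[K] TensorAlgebra K M) :
    𝒜.freeLetter ℳ (a • u) z = a • 𝒜.freeLetter ℳ u z := by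
  induction u using TensorProduct.induction_on with
  | zero => simp
  | add u v hu hv => simp only [smul_add, map_add, LinearMap.add_apply, hu, hv]
  | tmul b m => rw [TensorProduct.smul_tmul', freeLetter_tmul_apply, freeLetter_tmul_apply,
      smul_eq_mul, mul_smul]

variable {𝒜 ℳ} in
omit [CharZero K] in
/-- Induction on elements of a free module. -/
theorem free_induction {S : Submodule K (A ⊗[K] M)} (h : ∀ q, ∀ m ∈ ℳ.gr q, ∀ b : A, b ⊗ₜ m ∈ S)
    (z : A ⊗[K] M) : z ∈ S := by
  induction z using TensorProduct.induction_on with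
  | zero => exact zero_mem _
  | add y z hy hz => exact add_mem hy hz
  | tmul a x =>
    have := le_of_gr_le (𝒱 := ℳ) (S := S.comap (TensorProduct.mk K A M a))
      (fun q x hx => h q x hx a) x
    exact this

/-- A scalar leaves past a letter with the Koszul sign; graded commutativity is used to bring it in
front of the coefficient `b` of the letter. -/
theorem freeLetter_apply_smul {n : ℤ} {u : A ⊗[K] M} (hu : u ∈ (𝒜.tensor ℳ).gr n) (a : A)
    (z : A ⊗[K] TensorAlgebra K M) :
    𝒜.freeLetter ℳ u (a • z) = 𝒜.sg n a • 𝒜.freeLetter ℳ u z := by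
  suffices H : (𝒜.tensor ℳ).gr n ≤ LinearMap.eqLocus
      ((LinearMap.applyₗ (a • z)) ∘ₗ 𝒜.freeLetter ℳ)
      (Module.toModuleEnd K _ (𝒜.sg n a) ∘ₗ LinearMap.applyₗ z ∘ₗ 𝒜.freeLetter ℳ) from H hu
  refine Submodule.span_le.2 ?_
  rintro _ ⟨p, q, b, hb, m, hm, rfl, rfl⟩
  change 𝒜.freeLetter ℳ (b ⊗ₜ m) (a • z) = 𝒜.sg (p + q) a • 𝒜.freeLetter ℳ (b ⊗ₜ m) z
  induction z using TensorProduct.induction_on with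
  | zero => simp
  | add y z hy hz => simp only [smul_add, map_add, hy, hz]
  | tmul c x =>
    rw [TensorProduct.smul_tmul', smul_eq_mul, 𝒜.freeLetter_tmul ℳ hm, 𝒜.freeLetter_tmul ℳ hm,
      TensorProduct.smul_tmul', smul_eq_mul, 𝒜.sg_mul, ← mul_assoc, ← mul_assoc,
      𝒜.mul_eq_sg_mul hb, 𝒜.sg_sg]

end TensorAlgebra

end SignedAlgebra

/-! ### Products with a distinguished factor, and the length filtration -/

namespace TensorAlgebra

variable {K : Type*} [Field K] {U : Type*} [AddCommGroup U] [Module K U]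

/-- A product of letters with one distinguished factor. -/
theorem exists_prod_update_eq (𝒰 : SignedGrading K U) {n : ℕ} (e : Fin n → ℤ) (x : Fin n → U)
    (hx : ∀ i, x i ∈ 𝒰.gr (e i)) (i : Fin n) :
    ∃ x₁ ∈ (signedGrading 𝒰).gr (∑ j ∈ Finset.Iio i, e j), ∃ x₂ : TensorAlgebra K U,
      (∀ v, (List.ofFn fun j => ι K (Function.update x i v j)).prod = x₁ * ι K v * x₂) ∧
      (2 ≤ n → ∀ v, proj (x₁ * ι K v * x₂) = 0) := by
  induction n with
  | zero => exact i.elim0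
  | succ n ih =>
    refine Fin.cases ?_ (fun i => ?_) i
    · refine ⟨1, ?_, (List.ofFn fun j => ι K (x (Fin.succ j))).prod, fun v => ?_, fun hn v => ?_⟩
      · have : (Finset.Iio (0 : Fin (n + 1))) = ∅ := by
          ext j
          simp
        rw [this, Finset.sum_empty]
        exact one_mem_gr 𝒰
      · simp [List.ofFn_succ]
      -- With at least two letters there is one behind the distinguished first letter, so the
      -- product has no part of length one.
      · obtain ⟨n, rfl⟩ : ∃ k, n = k + 1 := ⟨n - 1, by omega⟩
        rw [one_mul, proj_ι_mul, List.ofFn_succ, List.prod_cons, aug_ι_mul, zero_smul]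
    · obtain ⟨x₁, h₁, x₂, h, -⟩ := ih (fun j => e j.succ) (fun j => x j.succ) (fun j => hx _) i
      refine ⟨ι K (x 0) * x₁, ?_, x₂, fun v => ?_, fun _ v => ?_⟩
      · have := ι_mul_mem_gr 𝒰 (hx 0) h₁
        convert this using 2
        have : Finset.Iio i.succ = insert 0 ((Finset.Iio i).map (Fin.succEmb n)) := by
          ext j
          refine Fin.cases ?_ (fun j => ?_) j <;> simp
        rw [this, Finset.sum_insert (by simp), Finset.sum_map, add_comm]
        rfl
      · rw [List.ofFn_succ, List.prod_cons, mul_assoc (ι K (x 0)), mul_assoc (ι K (x 0)), ← h v,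
          Function.update_of_ne (Fin.succ_ne_zero i).symm]
        congr 3
        funext j
        by_cases hj : j = i
        · subst hj
          simp
        · rw [Function.update_of_ne hj, Function.update_of_ne (fun h => hj (Fin.succ_injective _ h))]
      · rw [mul_assoc, mul_assoc, proj_ι_mul, map_mul, aug_ι_mul, mul_zero, zero_smul]

variable (K U) in
/-- The span of the words of length less than `k`. -/
def lenFil (k : ℕ) : Submodule K (TensorAlgebra K U) :=
  Submodule.span K {x | ∃ l : List U, l.length < k ∧ x = (l.map (ι K)).prod}

theorem lenFil_zero : lenFil K U 0 = ⊥ := by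
  simp [lenFil]

theorem lenFil_mono : Monotone (lenFil K U) := fun _ _ h =>
  Submodule.span_mono fun _ ⟨l, hl, hx⟩ => ⟨l, hl.trans_le h, hx⟩

theorem one_mem_lenFil (k : ℕ) : (1 : TensorAlgebra K U) ∈ lenFil K U (k + 1) :=
  Submodule.subset_span ⟨[], by simp⟩

theorem ι_mul_mem_lenFil {k : ℕ} {x : TensorAlgebra K U} (u : U) (hx : x ∈ lenFil K U k) :
    ι K u * x ∈ lenFil K U (k + 1) := by
  have : lenFil K U k ≤ (lenFil K U (k + 1)).comap (mulLetter u) := by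
    refine Submodule.span_le.2 ?_
    rintro _ ⟨l, hl, rfl⟩
    exact Submodule.subset_span ⟨u :: l, by simpa using hl, by simp⟩
  exact this hx

theorem exists_mem_lenFil (x : TensorAlgebra K U) : ∃ k, x ∈ lenFil K U k := by
  induction x using TensorAlgebra.induction with
  | algebraMap c =>
    exact ⟨1, by rw [Algebra.algebraMap_eq_smul_one]; exact Submodule.smul_mem _ _ (one_mem_lenFil 0)⟩
  | ι u => exact ⟨2, by simpa using ι_mul_mem_lenFil u (one_mem_lenFil 0)⟩
  | mul a b ha hb =>
    obtain ⟨k, hk⟩ := ha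
    obtain ⟨m, hm⟩ := hb
    refine ⟨k + m, ?_⟩
    have : lenFil K U k ≤ (lenFil K U (k + m)).comap (LinearMap.mulRight K b) := by
      refine Submodule.span_le.2 ?_
      rintro _ ⟨l, hl, rfl⟩
      clear hk
      simp only [Submodule.comap_coe, Set.mem_preimage, LinearMap.mulRight_apply, SetLike.mem_coe]
      induction l generalizing k with
      | nil => simpa using lenFil_mono (Nat.le_add_left m k) hm
      | cons u l ih =>
        obtain ⟨k, rfl⟩ : ∃ j, k = j + 1 := ⟨k - 1, by rw [List.length_cons] at hl; omega⟩
        rw [List.map_cons, List.prod_cons, mul_assoc, Nat.add_right_comm]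
        exact ι_mul_mem_lenFil u (ih k (by simpa using hl))
    exact this hk
  | add a b ha hb =>
    obtain ⟨k, hk⟩ := ha
    obtain ⟨m, hm⟩ := hb
    exact ⟨max k m, add_mem (lenFil_mono (le_max_left _ _) hk) (lenFil_mono (le_max_right _ _) hm)⟩

theorem lenFil_induction {Y : Type*} [AddCommGroup Y] [Module K Y]
    {f : TensorAlgebra K U →ₗ[K] Y} {F : ℕ → Submodule K Y} (h₁ : ∀ k, f 1 ∈ F (k + 1))
    (h : ∀ k u x, x ∈ lenFil K U k → f x ∈ F k → f (ι K u * x) ∈ F (k + 1)) {k : ℕ}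
    {x : TensorAlgebra K U} (hx : x ∈ lenFil K U k) : f x ∈ F k := by
  suffices H : lenFil K U k ≤ (F k).comap f from H hx
  refine Submodule.span_le.2 ?_
  rintro _ ⟨l, hl, rfl⟩
  simp only [Submodule.comap_coe, Set.mem_preimage, SetLike.mem_coe]
  clear hx
  induction l generalizing k with
  | nil =>
    obtain ⟨k, rfl⟩ : ∃ j, k = j + 1 := ⟨k - 1, by simp at hl; omega⟩
    simpa using h₁ k
  | cons u l ih =>
    obtain ⟨k, rfl⟩ : ∃ j, k = j + 1 := ⟨k - 1, by rw [List.length_cons] at hl; omega⟩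
    have hl' : l.length < k := by simpa using hl
    rw [List.map_cons, List.prod_cons]
    exact h k u _ (Submodule.subset_span ⟨l, hl', rfl⟩) (ih hl')

theorem der_mem_lenFil (𝒰 : SignedGrading K U) (e : ℤ) (f : U →ₗ[K] U) {k : ℕ}
    {x : TensorAlgebra K U} (hx : x ∈ lenFil K U k) : der 𝒰 e f x ∈ lenFil K U k := by
  refine lenFil_induction (F := lenFil K U) (fun k => by simp) (fun k u x hx h => ?_) hx
  rw [der_ι_mul]
  exact add_mem (ι_mul_mem_lenFil _ hx) (ι_mul_mem_lenFil _ h)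

end TensorAlgebra

/-! ### Unipotent endomorphisms -/

section Unipotent

variable {K : Type*} [Field K] {V : Type*} [AddCommGroup V] [Module K V]

/-- An endomorphism that differs from the identity by one that lowers a filtration. -/
structure IsUnipotent (F : ℕ → Submodule K V) (f : V →ₗ[K] V) : Prop where
  zero : F 0 = ⊥
  mono : Monotone F
  exists_mem : ∀ x, ∃ k, x ∈ F k
  lowers : ∀ k, ∀ x ∈ F (k + 1), f x - x ∈ F k

variable {F : ℕ → Submodule K V} {f g : V →ₗ[K] V}

theorem IsUnipotent.map_mem (hf : IsUnipotent F f) {k : ℕ} {x : V} (hx : x ∈ F k) : f x ∈ F k := by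
  have : f x - x ∈ F k := by
    cases k with
    | zero =>
      rw [hf.zero, Submodule.mem_bot] at hx
      simp [hx]
    | succ k => exact hf.mono (Nat.le_succ k) (hf.lowers k x hx)
  have := add_mem this hx
  rwa [sub_add_cancel] at this

theorem IsUnipotent.injective (hf : IsUnipotent F f) : Function.Injective f := by
  refine (injective_iff_map_eq_zero f).2 fun x hx => ?_
  obtain ⟨k, hk⟩ := hf.exists_mem x
  induction k with
  | zero => rwa [hf.zero, Submodule.mem_bot] at hk
  | succ k ih =>
    refine ih ?_
    have := hf.lowers k x hk
    rwa [hx, zero_sub, neg_mem_iff] at this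

/-- Tracking an arbitrary stable subspace `S` shows that the inverse preserves it too; applied to
the homogeneous pieces this gives degree 0 for the inverse. -/
theorem IsUnipotent.exists_preimage (hf : IsUnipotent F f) {S : Submodule K V}
    (hS : ∀ x ∈ S, f x ∈ S) {y : V} (hy : y ∈ S) : ∃ x ∈ S, f x = y := by
  obtain ⟨k, hk⟩ := hf.exists_mem y
  induction k generalizing y with
  | zero =>
    rw [hf.zero, Submodule.mem_bot] at hk
    exact ⟨0, zero_mem _, by rw [map_zero, hk]⟩
  | succ k ih =>
    -- Successive approximation: `y` is its own preimage up to the error `f y - y`, which is lower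
    -- in the filtration and has the preimage `x`, so `y - x` is a preimage of `y`.
    obtain ⟨x, hx, h⟩ := ih (sub_mem (hS y hy) hy) (hf.lowers k y hk)
    exact ⟨y - x, sub_mem hy hx, by rw [map_sub, h]; abel⟩

theorem IsUnipotent.bijective (hf : IsUnipotent F f) : Function.Bijective f :=
  ⟨hf.injective, fun y =>
    let ⟨x, _, h⟩ := hf.exists_preimage (S := ⊤) (fun _ _ => trivial) (y := y) trivial
    ⟨x, h⟩⟩

/-- The inverse of a unipotent endomorphism. -/
def IsUnipotent.inv (hf : IsUnipotent F f) : V →ₗ[K] V :=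
  (LinearEquiv.ofBijective f hf.bijective).symm.toLinearMap

@[simp] theorem IsUnipotent.apply_inv (hf : IsUnipotent F f) (x : V) : f (hf.inv x) = x :=
  (LinearEquiv.ofBijective f hf.bijective).apply_symm_apply x

@[simp] theorem IsUnipotent.inv_apply (hf : IsUnipotent F f) (x : V) : hf.inv (f x) = x :=
  (LinearEquiv.ofBijective f hf.bijective).symm_apply_apply x

theorem IsUnipotent.inv_mem (hf : IsUnipotent F f) {S : Submodule K V}
    (hS : ∀ x ∈ S, f x ∈ S) {y : V} (hy : y ∈ S) : hf.inv y ∈ S := by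
  obtain ⟨x, hx, rfl⟩ := hf.exists_preimage hS hy
  rwa [hf.inv_apply]

theorem IsUnipotent.isUnipotent_inv (hf : IsUnipotent F f) : IsUnipotent F hf.inv where
  zero := hf.zero
  mono := hf.mono
  exists_mem := hf.exists_mem
  lowers k x hx := by
    have := hf.lowers k _ (hf.inv_mem (fun x => hf.map_mem) hx)
    rw [hf.apply_inv] at this
    rw [← neg_sub]
    exact neg_mem this

theorem IsUnipotent.comp (hf : IsUnipotent F f) (hg : IsUnipotent F g) :
    IsUnipotent F (f ∘ₗ g) where
  zero := hf.zero
  mono := hf.mono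
  exists_mem := hf.exists_mem
  lowers k x hx := by
    have := add_mem (hf.lowers k _ (hg.map_mem hx)) (hg.lowers k x hx)
    rwa [sub_add_sub_cancel] at this

/-- Replacing left multiplications by operators that differ from them by operators preserving
length gives a unipotent map. -/
theorem TensorAlgebra.isUnipotent_letterRec {U : Type*} [AddCommGroup U] [Module K U]
    {E : U →ₗ[K] Module.End K (TensorAlgebra K U)}
    (hE : ∀ u k, ∀ x ∈ lenFil K U k, E u x - ι K u * x ∈ lenFil K U k) :
    IsUnipotent (lenFil K U) (letterRec E 1) := by
  refine ⟨lenFil_zero, lenFil_mono, exists_mem_lenFil, fun k x hx => ?_⟩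
  -- The induction runs with the filtration shifted by truncated subtraction; for the index 0 it
  -- says nothing more than x = 0, which is treated separately.
  have H : (letterRec E 1 - LinearMap.id : Module.End K (TensorAlgebra K U)) x ∈
      lenFil K U (k + 1 - 1) := by
    refine lenFil_induction (F := fun k => lenFil K U (k - 1)) (fun k => ?_)
      (fun k u x hx h => ?_) hx
    · rw [LinearMap.sub_apply, letterRec_one, LinearMap.id_apply, sub_self]
      exact zero_mem _
    · rw [LinearMap.sub_apply, LinearMap.id_apply] at h ⊢
      rw [letterRec_ι_mul, Nat.add_sub_cancel]
      cases k with
      | zero =>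
        rw [lenFil_zero, Submodule.mem_bot] at hx
        rw [hx, map_zero, mul_zero, map_zero, sub_zero]
        exact zero_mem _
      | succ k =>
        rw [Nat.add_sub_cancel] at h
        have h' := add_mem (lenFil_mono (Nat.le_succ k) h) hx
        rw [sub_add_cancel] at h'
        have := add_mem (hE u _ _ h') (ι_mul_mem_lenFil u h)
        rwa [mul_sub, sub_add_sub_cancel] at this
  rwa [LinearMap.sub_apply, LinearMap.id_apply] at H

end Unipotent

/-! ### Descent from the tensor algebra over the field to the one over A -/

namespace SignedAlgebra

open SignedGrading TensorAlgebra

variable {K : Type*} [Field K] [CharZero K] {A : Type*} [Ring A] [Algebra K A]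
  (𝒜 : SignedAlgebra K A) {M : Type*} [AddCommGroup M] [Module K M] (ℳ : SignedGrading K M)
  {N : Type*} [AddCommGroup N] [Module K N]

/-- The map from the tensor algebra over `K` of a free `A`-module to its tensor algebra
over `A`. -/
def toFree : TensorAlgebra K (A ⊗[K] M) →ₗ[K] A ⊗[K] TensorAlgebra K M :=
  letterRec (𝒜.freeLetter ℳ) (1 ⊗ₜ 1)

omit [CharZero K] in
@[simp] theorem toFree_one : 𝒜.toFree ℳ 1 = 1 ⊗ₜ 1 := letterRec_one _ _

omit [CharZero K] in
@[simp] theorem toFree_ι_mul (u : A ⊗[K] M) (x : TensorAlgebra K (A ⊗[K] M)) :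
    𝒜.toFree ℳ (ι K u * x) = 𝒜.freeLetter ℳ u (𝒜.toFree ℳ x) := letterRec_ι_mul _ _ _ _

/-- In the tensor algebra over A a scalar on any letter can be pulled out in front, with the Koszul
sign of the preceding word. Multilinearity over A is deduced from this. -/
theorem toFree_mul_smul {p : ℤ} {a : A} (ha : a ∈ 𝒜.gr p) (u : A ⊗[K] M)
    (x₁ x₂ : TensorAlgebra K (A ⊗[K] M)) :
    𝒜.toFree ℳ (x₁ * ι K (a • u) * x₂) =
      a • 𝒜.toFree ℳ ((signedGrading (𝒜.tensor ℳ)).sg p x₁ * ι K u * x₂) := by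
  have H := LinearMap.congr_fun (word_hom_ext (𝒜.tensor ℳ)
    (f := 𝒜.toFree ℳ ∘ₗ LinearMap.mulRight K (ι K (a • u) * x₂))
    (g := Module.toModuleEnd K _ a ∘ₗ 𝒜.toFree ℳ ∘ₗ LinearMap.mulRight K (ι K u * x₂) ∘ₗ
      (signedGrading (𝒜.tensor ℳ)).sg p) ?_ fun n v hv x₁ h => ?_) x₁
  · rw [mul_assoc, mul_assoc]
    exact H
  · simp [TensorAlgebra.sg_one, freeLetter_smul]
  · simp only [LinearMap.comp_apply, LinearMap.mulRight_apply, Module.toModuleEnd_apply,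
      DistribSMul.toLinearMap_apply] at h ⊢
    rw [mul_assoc, toFree_ι_mul, h, TensorAlgebra.sg_mul, mul_assoc, sg_ι,
      (𝒜.tensor ℳ).sg_apply hv, toFree_ι_mul, 𝒜.freeLetter_apply_smul ℳ hv, 𝒜.sg_apply ha,
      map_negOnePow_smul, LinearMap.smul_apply, _root_.mul_comm n p]
    simp only [Units.smul_def, smul_assoc, smul_comm a]

variable (A M) in
/-- The projection to length one in a tensor algebra over `A`. -/
def freeProj : A ⊗[K] TensorAlgebra K M →ₗ[K] A ⊗[K] M := proj.lTensor A

omit [CharZero K] in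
theorem freeProj_smul (a : A) (z : A ⊗[K] TensorAlgebra K M) :
    freeProj A M (a • z) = a • freeProj A M z := by
  induction z using TensorProduct.induction_on with
  | zero => simp
  | add y z hy hz => simp only [smul_add, map_add, hy, hz]
  | tmul b x => rfl

variable (A M) in
/-- The augmentation of a tensor algebra over `A`. -/
def freeAug : A ⊗[K] TensorAlgebra K M →ₗ[K] A :=
  (TensorProduct.rid K A).toLinearMap ∘ₗ aug.toLinearMap.lTensor A

omit [CharZero K] in
@[simp] theorem freeAug_tmul (a : A) (x : TensorAlgebra K M) :
    freeAug A M (a ⊗ₜ x) = aug x • a := by simp [freeAug]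

/-- The part of length zero is not enlarged by passing to A: only scalars of the field occur in it,
so it carries no information about the coefficients. -/
theorem freeAug_toFree (x : TensorAlgebra K (A ⊗[K] M)) :
    freeAug A M (𝒜.toFree ℳ x) = aug x • 1 := by
  have : ∀ u z, freeAug A M (𝒜.freeLetter ℳ u z) = 0 := by
    intro u z
    refine free_induction (ℳ := ℳ) (S := LinearMap.ker (freeAug A M ∘ₗ LinearMap.applyₗ z ∘ₗ
      𝒜.freeLetter ℳ)) (fun q m hm b => ?_) u
    simp only [LinearMap.mem_ker, LinearMap.comp_apply, LinearMap.applyₗ_apply_apply]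
    induction z using TensorProduct.induction_on with
    | zero => simp
    | add y z hy hz => simp only [map_add, hy, hz, add_zero]
    | tmul a x => rw [𝒜.freeLetter_tmul ℳ hm, freeAug_tmul, aug_ι_mul, zero_smul]
  refine LinearMap.congr_fun (word_hom_ext (𝒜.tensor ℳ) (f := freeAug A M ∘ₗ 𝒜.toFree ℳ)
    (g := aug.toLinearMap.smulRight (1 : A)) (by simp) fun n u _ x _ => ?_) x
  rw [LinearMap.comp_apply, toFree_ι_mul, this]
  simp [aug_ι]

/-- Words of length one are the same over the field and over A. Hence the length one component of an
operator can be read off after `toFree`, where scalars move freely. -/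
theorem freeProj_toFree (x : TensorAlgebra K (A ⊗[K] M)) :
    freeProj A M (𝒜.toFree ℳ x) = proj x := by
  have : ∀ q, ∀ m ∈ ℳ.gr q, ∀ (b : A) z, freeProj A M (𝒜.freeLetter ℳ (b ⊗ₜ m) z) =
      (b * 𝒜.sg q (freeAug A M z)) ⊗ₜ m := by
    intro q m hm b z
    induction z using TensorProduct.induction_on with
    | zero => simp
    | add y z hy hz => simp only [map_add, hy, hz, mul_add, TensorProduct.add_tmul]
    | tmul a x =>
      rw [𝒜.freeLetter_tmul ℳ hm, freeAug_tmul, freeProj, LinearMap.lTensor_tmul, proj_ι_mul,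
        map_smul, mul_smul_comm, TensorProduct.tmul_smul, TensorProduct.smul_tmul']
  refine LinearMap.congr_fun (word_hom_ext (𝒜.tensor ℳ) (f := freeProj A M ∘ₗ 𝒜.toFree ℳ)
    (g := proj) (by simp [freeProj, proj_one]) fun n u _ x _ => ?_) x
  rw [LinearMap.comp_apply, toFree_ι_mul, proj_ι_mul]
  refine free_induction (ℳ := ℳ) (S := LinearMap.eqLocus (freeProj A M ∘ₗ
    LinearMap.applyₗ (𝒜.toFree ℳ x) ∘ₗ 𝒜.freeLetter ℳ) ((aug x) • LinearMap.id))
    (fun q m hm b => ?_) u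
  simp only [LinearMap.mem_eqLocus, LinearMap.comp_apply, LinearMap.applyₗ_apply_apply,
    LinearMap.smul_apply, LinearMap.id_apply]
  rw [this q m hm, freeAug_toFree, map_smul, sg_one, mul_smul_comm, mul_one,
    TensorProduct.smul_tmul']

variable (A M) in
/-- The inclusion of the tensor algebra of the generators of a free module. -/
def freeIncl : TensorAlgebra K M →ₐ[K] TensorAlgebra K (A ⊗[K] M) :=
  TensorAlgebra.lift K (ι K ∘ₗ TensorProduct.mk K A M 1)

omit [CharZero K] in
theorem freeIncl_ι_mul (m : M) (x : TensorAlgebra K M) :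
    freeIncl A M (ι K m * x) = ι K (1 ⊗ₜ m) * freeIncl A M x := by
  simp [freeIncl]

@[simp] theorem toFree_freeIncl (x : TensorAlgebra K M) :
    𝒜.toFree ℳ (freeIncl A M x) = 1 ⊗ₜ x := by
  refine LinearMap.congr_fun (word_hom_ext ℳ
    (f := 𝒜.toFree ℳ ∘ₗ (freeIncl A M).toLinearMap) (g := TensorProduct.mk K A _ 1) (by simp)
    fun n m hm x h => ?_) x
  simp only [LinearMap.comp_apply, AlgHom.toLinearMap_apply, TensorProduct.mk_apply] at h ⊢
  rw [freeIncl_ι_mul, toFree_ι_mul, h, 𝒜.freeLetter_tmul ℳ hm, sg_one, mul_one]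

/-- Differentiating the coefficient of each letter in turn amounts, by the Leibniz rule, to
differentiating the product of all coefficients. -/
theorem toFree_der {e : ℤ} {p : A →ₗ[K] A} (hp : 𝒜.IsDer e p)
    (x : TensorAlgebra K (A ⊗[K] M)) :
    𝒜.toFree ℳ (der (𝒜.tensor ℳ) e (p.rTensor M) x) = p.rTensor _ (𝒜.toFree ℳ x) := by
  refine LinearMap.congr_fun (word_hom_ext (𝒜.tensor ℳ)
    (f := 𝒜.toFree ℳ ∘ₗ der (𝒜.tensor ℳ) e (p.rTensor M)) (g := p.rTensor _ ∘ₗ 𝒜.toFree ℳ)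
    (by simp [hp.map_one]) fun n u _ x h => ?_) x
  simp only [LinearMap.comp_apply] at h ⊢
  rw [der_ι_mul, map_add, toFree_ι_mul, toFree_ι_mul, toFree_ι_mul, h]
  generalize 𝒜.toFree ℳ x = z
  refine free_induction (ℳ := ℳ) (S := LinearMap.eqLocus
    (LinearMap.applyₗ z ∘ₗ 𝒜.freeLetter ℳ ∘ₗ p.rTensor M +
      LinearMap.applyₗ (p.rTensor (TensorAlgebra K M) z) ∘ₗ 𝒜.freeLetter ℳ ∘ₗ (𝒜.tensor ℳ).sg e)
    (p.rTensor (TensorAlgebra K M) ∘ₗ LinearMap.applyₗ z ∘ₗ 𝒜.freeLetter ℳ))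
    (fun q m hm b => ?_) u
  simp only [LinearMap.mem_eqLocus, LinearMap.comp_apply, LinearMap.applyₗ_apply_apply,
    LinearMap.add_apply, LinearMap.rTensor_tmul]
  have hs : (𝒜.tensor ℳ).sg e (b ⊗ₜ m) = 𝒜.sg e b ⊗ₜ ((e * q).negOnePow • m) := by
    rw [← ℳ.sg_apply hm]
    rfl
  rw [hs, tmul_negOnePow_smul, map_negOnePow_smul, LinearMap.smul_apply]
  induction z using TensorProduct.induction_on with
  | zero => simp
  | add y z hy hz =>
    simp only [map_add, ← hy, ← hz, smul_add]
    abel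
  | tmul a x =>
    rw [LinearMap.rTensor_tmul, 𝒜.freeLetter_tmul ℳ hm, 𝒜.freeLetter_tmul ℳ hm,
      𝒜.freeLetter_tmul ℳ hm, LinearMap.rTensor_tmul, hp.map_mul, hp.hasDeg.map_sg,
      TensorProduct.add_tmul, _root_.mul_comm q e]
    simp only [Units.smul_def, mul_smul_comm, TensorProduct.smul_tmul']

/-- A family of derivations of `A` parametrized by a free module, raising degrees by `s`. -/
def IsDerFamily (s : ℤ) (ρ : A ⊗[K] M →ₗ[K] Module.End K A) : Prop :=
  ∀ n, ∀ u ∈ (𝒜.tensor ℳ).gr n, 𝒜.IsDer (n + s) (ρ u)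

/-- The operators on the tensor algebra of a free module induced by a family of derivations. -/
def derFamily (s : ℤ) (ρ : A ⊗[K] M →ₗ[K] Module.End K A) :
    A ⊗[K] M →ₗ[K] Module.End K (TensorAlgebra K (A ⊗[K] M)) :=
  (𝒜.tensor ℳ).glue fun n => derₗ (𝒜.tensor ℳ) (n + s) ∘ₗ LinearMap.rTensorHom M ∘ₗ ρ

theorem derFamily_apply (s : ℤ) (ρ : A ⊗[K] M →ₗ[K] Module.End K A) {n : ℤ} {u : A ⊗[K] M}
    (hu : u ∈ (𝒜.tensor ℳ).gr n) :
    𝒜.derFamily ℳ s ρ u = der (𝒜.tensor ℳ) (n + s) ((ρ u).rTensor M) := by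
  refine (𝒜.tensor ℳ).glue_apply (fun e f h => LinearMap.ext fun u => ?_) hu
  exact der_eq_of_even _ (by simpa using h) _

variable {ℳ} in
theorem derFamily_one (s : ℤ) (ρ : A ⊗[K] M →ₗ[K] Module.End K A) (u : A ⊗[K] M) :
    𝒜.derFamily ℳ s ρ u 1 = 0 := by
  refine le_of_gr_le (𝒱 := 𝒜.tensor ℳ)
    (S := LinearMap.ker (LinearMap.applyₗ 1 ∘ₗ 𝒜.derFamily ℳ s ρ)) (fun n u hu => ?_) u
  simp [𝒜.derFamily_apply ℳ s ρ hu]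

theorem derFamily_mem_lenFil (s : ℤ) (ρ : A ⊗[K] M →ₗ[K] Module.End K A) (u : A ⊗[K] M) {k : ℕ}
    {x : TensorAlgebra K (A ⊗[K] M)} (hx : x ∈ lenFil K _ k) :
    𝒜.derFamily ℳ s ρ u x ∈ lenFil K _ k := by
  refine le_of_gr_le (𝒱 := 𝒜.tensor ℳ)
    (S := (lenFil K _ k).comap (LinearMap.applyₗ x ∘ₗ 𝒜.derFamily ℳ s ρ)) (fun n u hu => ?_) u
  simp only [Submodule.mem_comap, LinearMap.comp_apply, LinearMap.applyₗ_apply_apply,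
    𝒜.derFamily_apply ℳ s ρ hu]
  exact der_mem_lenFil _ _ _ hx

variable {𝒜 ℳ}

theorem IsDerFamily.isCoder {s : ℤ} {ρ : A ⊗[K] M →ₗ[K] Module.End K A}
    (hρ : 𝒜.IsDerFamily ℳ s ρ) {n : ℤ} {u : A ⊗[K] M} (hu : u ∈ (𝒜.tensor ℳ).gr n) :
    IsCoder (𝒜.tensor ℳ) (n + s) (𝒜.derFamily ℳ s ρ u) := by
  rw [𝒜.derFamily_apply ℳ s ρ hu]
  exact isCoder_der (𝒜.hasDeg_rTensor (hρ n u hu))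

theorem IsDerFamily.toFree_derFamily {s : ℤ} {ρ : A ⊗[K] M →ₗ[K] Module.End K A}
    (hρ : 𝒜.IsDerFamily ℳ s ρ) (u : A ⊗[K] M) (x : TensorAlgebra K (A ⊗[K] M)) :
    𝒜.toFree ℳ (𝒜.derFamily ℳ s ρ u x) = (ρ u).rTensor _ (𝒜.toFree ℳ x) := by
  refine le_of_gr_le (𝒱 := 𝒜.tensor ℳ) (S := LinearMap.eqLocus
    (𝒜.toFree ℳ ∘ₗ LinearMap.applyₗ x ∘ₗ 𝒜.derFamily ℳ s ρ)
    (LinearMap.applyₗ (𝒜.toFree ℳ x) ∘ₗ LinearMap.rTensorHom _ ∘ₗ ρ)) (fun n u hu => ?_) u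
  simp only [LinearMap.mem_eqLocus, LinearMap.comp_apply, LinearMap.applyₗ_apply_apply,
    𝒜.derFamily_apply ℳ s ρ hu]
  exact 𝒜.toFree_der ℳ (hρ n u hu) x

/-- Generators have coefficient 1, which every derivation kills. Hence the corrections by the anchor
are invisible on words of generators. -/
theorem IsDerFamily.derFamily_freeIncl {s : ℤ} {ρ : A ⊗[K] M →ₗ[K] Module.End K A}
    (hρ : 𝒜.IsDerFamily ℳ s ρ) (u : A ⊗[K] M) (x : TensorAlgebra K M) :
    𝒜.derFamily ℳ s ρ u (freeIncl A M x) = 0 := by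
  refine le_of_gr_le (𝒱 := 𝒜.tensor ℳ) (S := LinearMap.ker
    (LinearMap.applyₗ (freeIncl A M x) ∘ₗ 𝒜.derFamily ℳ s ρ)) (fun n u hu => ?_) u
  simp only [LinearMap.mem_ker, LinearMap.comp_apply, LinearMap.applyₗ_apply_apply,
    𝒜.derFamily_apply ℳ s ρ hu]
  refine LinearMap.congr_fun (word_hom_ext ℳ (f := der (𝒜.tensor ℳ) (n + s) ((ρ u).rTensor M) ∘ₗ
    (freeIncl A M).toLinearMap) (g := 0) (by simp) fun n m _ x h => ?_) x
  simp only [LinearMap.comp_apply, AlgHom.toLinearMap_apply, LinearMap.zero_apply] at h ⊢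
  rw [freeIncl_ι_mul, der_ι_mul, h, LinearMap.rTensor_tmul, (hρ _ u hu).map_one]
  simp

end SignedAlgebra

/-! ### Anchored dg modules and their codifferential -/

open SignedGrading TensorAlgebra SignedAlgebra

variable {K : Type*} [Field K] [CharZero K] {A : Type*} [Ring A] [Algebra K A]
  {𝒜 : SignedAlgebra K A} {D : A →ₗ[K] A}
  {M : Type*} [AddCommGroup M] [Module K M] {ℳ : SignedGrading K M}
  {N : Type*} [AddCommGroup N] [Module K N] {𝒩 : SignedGrading K N}

omit [CharZero K] in
/-- The derivation of the tensor algebra induced by a differential squares to zero. -/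
theorem TensorAlgebra.der_der_eq_zero {U : Type*} [AddCommGroup U] [Module K U]
    {𝒰 : SignedGrading K U} {d : U →ₗ[K] U} (hd : HasDeg 𝒰 𝒰 1 d) (h : ∀ u, d (d u) = 0)
    (x : TensorAlgebra K U) : der 𝒰 1 d (der 𝒰 1 d x) = 0 := by
  refine LinearMap.congr_fun (word_hom_ext 𝒰 (f := der 𝒰 1 d ∘ₗ der 𝒰 1 d) (g := 0) (by simp)
    fun n u _ x hx => ?_) x
  rw [LinearMap.comp_apply, LinearMap.zero_apply] at hx ⊢
  rw [der_ι_mul, map_add, der_ι_mul, der_ι_mul, hx, h, map_zero, zero_mul, zero_add, mul_zero,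
    add_zero, hd.map_sg, mul_one, Int.negOnePow_one]
  simp

variable (𝒜 D ℳ) in
/-- A differential on a free module over a differential graded algebra. -/
structure FreeDGModule where
  d : Module.End K (A ⊗[K] M)
  isDer : 𝒜.IsDer 1 D
  hasDeg : HasDeg (𝒜.tensor ℳ) (𝒜.tensor ℳ) 1 d
  d_smul : ∀ (a : A) (z : A ⊗[K] M), d (a • z) = D a • z + 𝒜.sg 1 a • d z
  d_d : ∀ z, d (d z) = 0

/-- An anchor on a differential graded module: a morphism to the derivations of the algebra. -/
structure FreeDGModule.Anchor (X : FreeDGModule 𝒜 D ℳ) where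
  ρ : A ⊗[K] M →ₗ[K] Module.End K A
  isDer : 𝒜.IsDerFamily ℳ 0 ρ
  smul_apply : ∀ a u b, ρ (a • u) b = a * ρ u b
  comm : ∀ n, ∀ u ∈ (𝒜.tensor ℳ).gr n, ∀ b, D (ρ u b) = n.negOnePow • ρ u (D b) + ρ (X.d u) b

namespace FreeDGModule

variable {X : FreeDGModule 𝒜 D ℳ} {Y : FreeDGModule 𝒜 D 𝒩}

omit [CharZero K] in
theorem d_sg (X : FreeDGModule 𝒜 D ℳ) (u : A ⊗[K] M) :
    (𝒜.tensor ℳ).sg 1 (X.d u) = -X.d ((𝒜.tensor ℳ).sg 1 u) := by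
  rw [X.hasDeg.sg_map, mul_one, Int.negOnePow_one, Units.neg_smul, one_smul]

omit [CharZero K] in
theorem D_sg (X : FreeDGModule 𝒜 D ℳ) (b : A) : D (𝒜.sg 1 b) = -𝒜.sg 1 (D b) := by
  rw [X.isDer.hasDeg.map_sg, mul_one, Int.negOnePow_one, Units.neg_smul, one_smul]

namespace Anchor

variable (𝔞 : X.Anchor) (𝔟 : Y.Anchor)

omit [CharZero K] in
theorem rTensor_smul_left (ρ : A ⊗[K] M →ₗ[K] Module.End K A) {f : A →ₗ[K] A}
    {u : A ⊗[K] M} {a : A} (h : ∀ b, ρ (a • u) b = f a * ρ u b) (z : A ⊗[K] N) :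
    (ρ (a • u)).rTensor N z = f a • (ρ u).rTensor N z := by
  induction z using TensorProduct.induction_on with
  | zero => simp
  | add y z hy hz => simp only [smul_add, map_add, hy, hz]
  | tmul b x => rw [LinearMap.rTensor_tmul, LinearMap.rTensor_tmul, h, TensorProduct.smul_tmul',
      smul_eq_mul]

/-- Left multiplication by a letter, corrected by the anchor. -/
def op : A ⊗[K] M →ₗ[K] Module.End K (TensorAlgebra K (A ⊗[K] M)) :=
  mulLetter + 𝒜.derFamily ℳ 0 𝔞.ρ

omit [CharZero K] in
theorem op_apply (u : A ⊗[K] M) (x : TensorAlgebra K (A ⊗[K] M)) :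
    𝔞.op u x = ι K u * x + 𝒜.derFamily ℳ 0 𝔞.ρ u x := rfl

theorem op_one (u : A ⊗[K] M) : 𝔞.op u 1 = ι K u := by
  rw [op_apply, derFamily_one, add_zero, mul_one]

theorem isCoder_op {n : ℤ} {u : A ⊗[K] M} (hu : u ∈ (𝒜.tensor ℳ).gr n) :
    IsCoder (𝒜.tensor ℳ) n (𝔞.op u) := by
  have h := 𝔞.isDer.isCoder hu
  rw [add_zero] at h
  exact (isCoder_mulLetter hu).add h

theorem op_sub_mem (u : A ⊗[K] M) (k : ℕ) (x : TensorAlgebra K (A ⊗[K] M))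
    (hx : x ∈ lenFil K _ k) : 𝔞.op u x - ι K u * x ∈ lenFil K _ k := by
  rw [op_apply, add_sub_cancel_left]
  exact 𝒜.derFamily_mem_lenFil ℳ 0 𝔞.ρ u hx

theorem op_freeIncl (m : M) (x : TensorAlgebra K M) :
    𝔞.op (1 ⊗ₜ m) (freeIncl A M x) = freeIncl A M (ι K m * x) := by
  rw [op_apply, 𝔞.isDer.derFamily_freeIncl, add_zero, freeIncl_ι_mul]

/-- The change of coordinates on the tensor algebra defined by an anchor. -/
def theta : TensorAlgebra K (A ⊗[K] M) →ₗ[K] TensorAlgebra K (A ⊗[K] M) := letterRec 𝔞.op 1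

omit [CharZero K] in
@[simp] theorem theta_one : 𝔞.theta 1 = 1 := letterRec_one _ _

omit [CharZero K] in
@[simp] theorem theta_ι_mul (u : A ⊗[K] M) (x : TensorAlgebra K (A ⊗[K] M)) :
    𝔞.theta (ι K u * x) = 𝔞.op u (𝔞.theta x) := letterRec_ι_mul _ _ _ _

theorem theta_ι (u : A ⊗[K] M) : 𝔞.theta (ι K u) = ι K u := by
  rw [← mul_one (ι K u), theta_ι_mul, theta_one, op_one, mul_one]

theorem isUnipotent_theta : IsUnipotent (lenFil K (A ⊗[K] M)) 𝔞.theta :=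
  isUnipotent_letterRec 𝔞.op_sub_mem

theorem isComor_theta : IsComor (𝒜.tensor ℳ) (𝒜.tensor ℳ) 𝔞.theta :=
  isComor_letterRec (θ := LinearMap.id) (fun _ _ hu => 𝔞.isCoder_op hu) 𝔞.op_one

/-- The inverse of `theta`. -/
def thetaInv : TensorAlgebra K (A ⊗[K] M) →ₗ[K] TensorAlgebra K (A ⊗[K] M) :=
  𝔞.isUnipotent_theta.inv

@[simp] theorem theta_thetaInv (x : TensorAlgebra K (A ⊗[K] M)) : 𝔞.theta (𝔞.thetaInv x) = x :=
  𝔞.isUnipotent_theta.apply_inv x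

@[simp] theorem thetaInv_theta (x : TensorAlgebra K (A ⊗[K] M)) : 𝔞.thetaInv (𝔞.theta x) = x :=
  𝔞.isUnipotent_theta.inv_apply x

omit [CharZero K] in
theorem isComor_inv {F : Module.End K (TensorAlgebra K (A ⊗[K] M))}
    (hF : IsComor (𝒜.tensor ℳ) (𝒜.tensor ℳ) F) (hu : IsUnipotent (lenFil K (A ⊗[K] M)) F) :
    IsComor (𝒜.tensor ℳ) (𝒜.tensor ℳ) hu.inv := by
  refine hF.inverse (fun n x hx => ?_) hu.apply_inv hu.inv_apply
  rw [add_zero]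
  -- Each homogeneous piece is stable under `F`, hence under its inverse.
  refine hu.inv_mem (fun x hx => ?_) hx
  have := hF.hasDeg n x hx
  rwa [add_zero] at this

theorem isComor_thetaInv : IsComor (𝒜.tensor ℳ) (𝒜.tensor ℳ) 𝔞.thetaInv :=
  isComor_inv 𝔞.isComor_theta 𝔞.isUnipotent_theta

theorem thetaInv_one : 𝔞.thetaInv 1 = 1 := 𝔞.isComor_thetaInv.map_one

theorem thetaInv_ι (u : A ⊗[K] M) : 𝔞.thetaInv (ι K u) = ι K u := by
  rw [← 𝔞.theta_ι, thetaInv_theta, 𝔞.theta_ι]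

/-- Induction on words in the corrected letters. -/
theorem op_induction {S : Submodule K (TensorAlgebra K (A ⊗[K] M))} (h₁ : 1 ∈ S)
    (h : ∀ n, ∀ u ∈ (𝒜.tensor ℳ).gr n, ∀ x ∈ S, 𝔞.op u x ∈ S)
    (x : TensorAlgebra K (A ⊗[K] M)) : x ∈ S := by
  have := word_induction (𝒜.tensor ℳ) (S := S.comap 𝔞.theta) (by simpa using h₁)
    (fun n u hu x hx => by
      simp only [Submodule.mem_comap, theta_ι_mul] at hx ⊢
      exact h n u hu _ hx) (𝔞.thetaInv x)
  simpa using this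

/-- The codifferential of the tensor algebra defined by an anchor. -/
def codiff : Module.End K (TensorAlgebra K (A ⊗[K] M)) :=
  𝔞.theta ∘ₗ der (𝒜.tensor ℳ) 1 X.d ∘ₗ 𝔞.thetaInv

theorem codiff_apply (x : TensorAlgebra K (A ⊗[K] M)) :
    𝔞.codiff x = 𝔞.theta (der (𝒜.tensor ℳ) 1 X.d (𝔞.thetaInv x)) := rfl

theorem codiff_theta (x : TensorAlgebra K (A ⊗[K] M)) :
    𝔞.codiff (𝔞.theta x) = 𝔞.theta (der (𝒜.tensor ℳ) 1 X.d x) := by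
  rw [codiff_apply, thetaInv_theta]

theorem isCoder_codiff : IsCoder (𝒜.tensor ℳ) 1 𝔞.codiff :=
  IsCoder.conj 𝔞.isComor_theta 𝔞.isComor_thetaInv 𝔞.theta_thetaInv (isCoder_der X.hasDeg)

@[simp] theorem codiff_one : 𝔞.codiff 1 = 0 := by
  rw [codiff_apply, thetaInv_one, der_one, map_zero]

theorem codiff_ι (u : A ⊗[K] M) : 𝔞.codiff (ι K u) = ι K (X.d u) := by
  rw [codiff_apply, thetaInv_ι, der_ι, theta_ι]

theorem codiff_codiff (x : TensorAlgebra K (A ⊗[K] M)) : 𝔞.codiff (𝔞.codiff x) = 0 := by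
  rw [codiff_apply, codiff_apply, thetaInv_theta, der_der_eq_zero X.hasDeg X.d_d, map_zero]

/-- Conjugation by `theta` turns letters into `op`, so this is the Leibniz rule of the derivation
extending the differential. All properties of the brackets are drawn from it. -/
theorem codiff_op (u : A ⊗[K] M) (x : TensorAlgebra K (A ⊗[K] M)) :
    𝔞.codiff (𝔞.op u x) = 𝔞.op (X.d u) x + 𝔞.op ((𝒜.tensor ℳ).sg 1 u) (𝔞.codiff x) := by
  obtain ⟨x, rfl⟩ := 𝔞.isUnipotent_theta.bijective.2 x
  rw [← theta_ι_mul, codiff_theta, der_ι_mul, map_add, theta_ι_mul, theta_ι_mul, codiff_theta]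

theorem codiff_mem_lenFil {k : ℕ} {x : TensorAlgebra K (A ⊗[K] M)} (hx : x ∈ lenFil K _ k) :
    𝔞.codiff x ∈ lenFil K _ k :=
  𝔞.isUnipotent_theta.map_mem (der_mem_lenFil _ _ _ (𝔞.isUnipotent_theta.isUnipotent_inv.map_mem hx))

/-- The operators on the tensor algebra over `A` induced by `op`. -/
def freeOp : A ⊗[K] M →ₗ[K] Module.End K (A ⊗[K] TensorAlgebra K M) :=
  𝒜.freeLetter ℳ + LinearMap.rTensorHom _ ∘ₗ 𝔞.ρ

omit [CharZero K] in
theorem freeOp_apply (u : A ⊗[K] M) (z : A ⊗[K] TensorAlgebra K M) :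
    𝔞.freeOp u z = 𝒜.freeLetter ℳ u z + (𝔞.ρ u).rTensor _ z := rfl

theorem toFree_op (u : A ⊗[K] M) (x : TensorAlgebra K (A ⊗[K] M)) :
    𝒜.toFree ℳ (𝔞.op u x) = 𝔞.freeOp u (𝒜.toFree ℳ x) := by
  rw [op_apply, map_add, toFree_ι_mul, 𝔞.isDer.toFree_derFamily, freeOp_apply]

omit [CharZero K] in
theorem freeOp_smul (a : A) (u : A ⊗[K] M) (z : A ⊗[K] TensorAlgebra K M) :
    𝔞.freeOp (a • u) z = a • 𝔞.freeOp u z := by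
  rw [freeOp_apply, freeOp_apply, freeLetter_smul, smul_add,
    rTensor_smul_left 𝔞.ρ (f := LinearMap.id) (𝔞.smul_apply a u), LinearMap.id_apply]

/-- `freeOp u` is a first order operator with symbol the anchor, as a covariant derivative would be.
Together with `freeOp_smul` it is determined by its values on generators. -/
theorem freeOp_apply_smul {n : ℤ} {u : A ⊗[K] M} (hu : u ∈ (𝒜.tensor ℳ).gr n) (a : A)
    (z : A ⊗[K] TensorAlgebra K M) :
    𝔞.freeOp u (a • z) = 𝔞.ρ u a • z + 𝒜.sg n a • 𝔞.freeOp u z := by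
  have h := 𝔞.isDer n u hu
  rw [add_zero] at h
  rw [freeOp_apply, freeOp_apply, 𝒜.freeLetter_apply_smul ℳ hu, 𝒜.rTensor_smul h, smul_add]
  abel

/-- The operator on the tensor algebra over `A` induced by the codifferential. -/
def freeCodiff : Module.End K (A ⊗[K] TensorAlgebra K M) :=
  D.rTensor _ + linExt A (𝒜.toFree ℳ ∘ₗ 𝔞.codiff ∘ₗ (freeIncl A M).toLinearMap) ∘ₗ
    (𝒜.sg 1).rTensor _

theorem freeCodiff_tmul (a : A) (x : TensorAlgebra K M) :
    𝔞.freeCodiff (a ⊗ₜ x) =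
      D a ⊗ₜ x + 𝒜.sg 1 a • 𝒜.toFree ℳ (𝔞.codiff (freeIncl A M x)) := rfl

theorem freeCodiff_smul (a : A) (z : A ⊗[K] TensorAlgebra K M) :
    𝔞.freeCodiff (a • z) = D a • z + 𝒜.sg 1 a • 𝔞.freeCodiff z := by
  induction z using TensorProduct.induction_on with
  | zero => simp
  | add y z hy hz =>
    simp only [smul_add, map_add, hy, hz]
    abel
  | tmul b x =>
    rw [TensorProduct.smul_tmul', smul_eq_mul, freeCodiff_tmul, freeCodiff_tmul, X.isDer.map_mul,
      SignedAlgebra.sg_mul, TensorProduct.add_tmul, smul_add, mul_smul, TensorProduct.smul_tmul',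
      TensorProduct.smul_tmul', smul_eq_mul, smul_eq_mul, add_assoc]

/-- `freeCodiff` is defined by its values on words of generators, so the commutation rule is known
only there. Both sides obey compatible Leibniz rules in the scalars, and the terms where a scalar is
differentiated match because the anchor commutes with the differentials. -/
theorem freeCodiff_freeOp (u : A ⊗[K] M) (z : A ⊗[K] TensorAlgebra K M) :
    𝔞.freeCodiff (𝔞.freeOp u z) =
      𝔞.freeOp (X.d u) z + 𝔞.freeOp ((𝒜.tensor ℳ).sg 1 u) (𝔞.freeCodiff z) := by
  refine free_induction (ℳ := ℳ) (S := LinearMap.eqLocus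
    (𝔞.freeCodiff ∘ₗ LinearMap.applyₗ z ∘ₗ 𝔞.freeOp) (LinearMap.applyₗ z ∘ₗ 𝔞.freeOp ∘ₗ X.d +
      LinearMap.applyₗ (𝔞.freeCodiff z) ∘ₗ 𝔞.freeOp ∘ₗ (𝒜.tensor ℳ).sg 1)) (fun q m hm b => ?_) u
  simp only [LinearMap.mem_eqLocus, LinearMap.comp_apply, LinearMap.applyₗ_apply_apply,
    LinearMap.add_apply]
  have hm' := 𝒜.one_tmul_mem_gr ℳ hm
  have hb : b ⊗ₜ[K] m = b • ((1 : A) ⊗ₜ[K] m) := by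
    rw [TensorProduct.smul_tmul', smul_eq_mul, mul_one]
  have key : 𝔞.freeCodiff (𝔞.freeOp (1 ⊗ₜ m) z) = 𝔞.freeOp (X.d (1 ⊗ₜ m)) z +
      𝔞.freeOp ((𝒜.tensor ℳ).sg 1 (1 ⊗ₜ m)) (𝔞.freeCodiff z) := by
    induction z using TensorProduct.induction_on with
    | zero => simp
    | add y z hy hz =>
      simp only [map_add, hy, hz]
      abel
    | tmul a x =>
      have ha : a ⊗ₜ[K] x = a • 𝒜.toFree ℳ (freeIncl A M x) := by
        rw [toFree_freeIncl, TensorProduct.smul_tmul', smul_eq_mul, mul_one]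
      have hQ : ∀ y, 𝔞.freeCodiff (𝒜.toFree ℳ (freeIncl A M y)) =
          𝒜.toFree ℳ (𝔞.codiff (freeIncl A M y)) := by
        intro y
        rw [toFree_freeIncl, freeCodiff_tmul, X.isDer.map_one, TensorProduct.zero_tmul, zero_add,
          SignedAlgebra.sg_one, one_smul]
      -- Without scalars, `op` of a generator merely prepends it to the word, so `codiff_op`
      -- applies.
      have h₀ : 𝔞.freeCodiff (𝔞.freeOp (1 ⊗ₜ m) (𝒜.toFree ℳ (freeIncl A M x))) =
          𝔞.freeOp (X.d (1 ⊗ₜ m)) (𝒜.toFree ℳ (freeIncl A M x)) +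
          𝔞.freeOp ((𝒜.tensor ℳ).sg 1 (1 ⊗ₜ m))
            (𝔞.freeCodiff (𝒜.toFree ℳ (freeIncl A M x))) := by
        rw [← toFree_op, op_freeIncl, hQ, hQ, ← op_freeIncl, codiff_op, map_add, toFree_op,
          toFree_op]
      rw [ha, 𝔞.freeOp_apply_smul hm', map_add, freeCodiff_smul, freeCodiff_smul, freeCodiff_smul,
        𝔞.freeOp_apply_smul (X.hasDeg q _ hm'), map_add,
        𝔞.freeOp_apply_smul ((𝒜.tensor ℳ).sg_mem hm'),
        𝔞.freeOp_apply_smul ((𝒜.tensor ℳ).sg_mem hm'), h₀, 𝔞.comm q _ hm',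
        (𝔞.isDer q _ hm').hasDeg.sg_map, (𝒜.tensor ℳ).sg_apply hm', X.isDer.hasDeg.map_sg,
        𝒜.sg_sg, 𝒜.sg_sg]
      simp only [add_zero, one_mul, mul_one, smul_add, add_smul, smul_assoc, Units.smul_def,
        map_zsmul, LinearMap.smul_apply, smul_comm _ (q.negOnePow : ℤ)]
      rw [add_comm 1 q]
      abel
  rw [hb, freeOp_smul, freeCodiff_smul, key, X.d_smul, map_add, LinearMap.add_apply, freeOp_smul,
    freeOp_smul, 𝒜.tensor_sg_smul, freeOp_smul, smul_add, add_assoc]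

/-- The codifferential descends to the tensor algebra over A. Both sides have the same commutation
rule with `op`, and every element is a combination of products of such operators applied to the
unit. -/
theorem freeCodiff_toFree (x : TensorAlgebra K (A ⊗[K] M)) :
    𝔞.freeCodiff (𝒜.toFree ℳ x) = 𝒜.toFree ℳ (𝔞.codiff x) := by
  refine 𝔞.op_induction (S := LinearMap.eqLocus (𝔞.freeCodiff ∘ₗ 𝒜.toFree ℳ)
    (𝒜.toFree ℳ ∘ₗ 𝔞.codiff)) ?_ (fun n u hu x hx => ?_) x
  · simp [freeCodiff_tmul, X.isDer.map_one]
  · simp only [LinearMap.mem_eqLocus, LinearMap.comp_apply] at hx ⊢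
    rw [toFree_op, freeCodiff_freeOp, hx, codiff_op, map_add, toFree_op, toFree_op]

/-- A map out of the tensor algebra that intertwines the corrected letters with operators
defined over `A` is defined over `A`. -/
theorem toFree_apply_eq_linExt {F : TensorAlgebra K (A ⊗[K] M) →ₗ[K] TensorAlgebra K (A ⊗[K] N)}
    {E : A ⊗[K] M →ₗ[K] Module.End K (TensorAlgebra K (A ⊗[K] N))}
    {E' : A ⊗[K] M →ₗ[K] Module.End K (A ⊗[K] TensorAlgebra K N)}
    (hF : ∀ u x, F (𝔞.op u x) = E u (F x))
    (hE : ∀ u y, 𝒜.toFree 𝒩 (E u y) = E' u (𝒜.toFree 𝒩 y))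
    (hE₁ : ∀ (a : A) (u : A ⊗[K] M) z, E' (a • u) z = a • E' u z)
    (hE₂ : ∀ n, ∀ u ∈ (𝒜.tensor ℳ).gr n, ∀ (a : A) z,
      E' u (a • z) = 𝔞.ρ u a • z + 𝒜.sg n a • E' u z) (x : TensorAlgebra K (A ⊗[K] M)) :
    𝒜.toFree 𝒩 (F x) =
      linExt A (𝒜.toFree 𝒩 ∘ₗ F ∘ₗ (freeIncl A M).toLinearMap) (𝒜.toFree ℳ x) := by
  set G := linExt A (𝒜.toFree 𝒩 ∘ₗ F ∘ₗ (freeIncl A M).toLinearMap) with hG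
  have hG₁ : ∀ y, G (𝒜.toFree ℳ (freeIncl A M y)) = 𝒜.toFree 𝒩 (F (freeIncl A M y)) := by
    intro y
    rw [toFree_freeIncl, hG, linExt_tmul, one_smul]
    rfl
  -- On words of generators this is `hF`. It extends to all coefficients because `E'` and `freeOp`
  -- have the same symbol.
  have key : ∀ u z, G (𝔞.freeOp u z) = E' u (G z) := by
    intro u z
    refine free_induction (ℳ := ℳ) (S := LinearMap.eqLocus
      (G ∘ₗ LinearMap.applyₗ z ∘ₗ 𝔞.freeOp) (LinearMap.applyₗ (G z) ∘ₗ E')) (fun q m hm b => ?_) u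
    simp only [LinearMap.mem_eqLocus, LinearMap.comp_apply, LinearMap.applyₗ_apply_apply]
    have hm' := 𝒜.one_tmul_mem_gr ℳ hm
    have hb : b ⊗ₜ[K] m = b • ((1 : A) ⊗ₜ[K] m) := by
      rw [TensorProduct.smul_tmul', smul_eq_mul, mul_one]
    rw [hb, freeOp_smul, hE₁, hG, linExt_smul, ← hG]
    congr 1
    induction z using TensorProduct.induction_on with
    | zero => simp
    | add y z hy hz => simp only [map_add, hy, hz]
    | tmul a x =>
      have ha : a ⊗ₜ[K] x = a • 𝒜.toFree ℳ (freeIncl A M x) := by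
        rw [toFree_freeIncl, TensorProduct.smul_tmul', smul_eq_mul, mul_one]
      rw [ha, 𝔞.freeOp_apply_smul hm', map_add, hG, linExt_smul, linExt_smul, linExt_smul, ← hG,
        hE₂ q _ hm', ← toFree_op, op_freeIncl, hG₁, hG₁, ← op_freeIncl, hF, hE]
  refine 𝔞.op_induction (S := LinearMap.eqLocus (𝒜.toFree 𝒩 ∘ₗ F) (G ∘ₗ 𝒜.toFree ℳ)) ?_
    (fun n u hu x hx => ?_) x
  · have := hG₁ 1
    rw [map_one] at this
    exact this.symm
  · simp only [LinearMap.mem_eqLocus, LinearMap.comp_apply] at hx ⊢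
    rw [hF, hE, hx, toFree_op, key]

end Anchor

end FreeDGModule

theorem Int.smul_negOnePow_smul {K A M : Type*} [Field K] [Ring A] [Algebra K A] [AddCommGroup M]
    [Module K M] (e : ℤ) (a : A) (x : A ⊗[K] M) : a • e.negOnePow • x = e.negOnePow • a • x := by
  rcases Int.even_or_odd e with h | h
  · rw [Int.negOnePow_even e h, one_smul, one_smul]
  · rw [Int.negOnePow_odd e h, Units.neg_smul, Units.neg_smul, one_smul, one_smul, smul_neg]

theorem SignedAlgebra.sg_smul {K A M : Type*} [Field K] [Ring A] [Algebra K A] [AddCommGroup M]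
    [Module K M] (𝒜 : SignedAlgebra K A) {e p : ℤ} {a : A} (ha : a ∈ 𝒜.gr p) (x : A ⊗[K] M) :
    𝒜.sg e a • x = (e * p).negOnePow • a • x := by
  rw [𝒜.sg_apply ha]
  rcases Int.even_or_odd (e * p) with h | h
  · rw [Int.negOnePow_even _ h, one_smul, one_smul]
  · rw [Int.negOnePow_odd _ h, Units.neg_smul, Units.neg_smul, one_smul, one_smul]
    exact neg_smul a x

namespace TensorAlgebra

open SignedGrading

variable {K : Type*} [Field K] [CharZero K] {U : Type*} [AddCommGroup U] [Module K U]
  (𝒰 : SignedGrading K U)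

omit [CharZero K] in
theorem hasDeg_proj : HasDeg (signedGrading 𝒰) 𝒰 0 proj := by
  refine hasDeg_of_word 𝒰 fun l hl => ?_
  match l, hl with
  | [], _ =>
    rw [word_nil, proj_one]
    exact zero_mem _
  | [c], hl =>
    rw [word_singleton, proj_ι]
    simpa using hl c List.mem_cons_self
  | c :: c' :: l, _ =>
    rw [word_cons, proj_ι_mul, word_cons, aug_ι_mul, zero_smul]
    exact zero_mem _

omit [CharZero K] in
theorem proj_der (e : ℤ) (f : U →ₗ[K] U) (x : TensorAlgebra K U) :
    proj (der 𝒰 e f x) = f (proj x) := by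
  refine LinearMap.congr_fun (word_hom_ext 𝒰 (f := proj ∘ₗ der 𝒰 e f) (g := f ∘ₗ proj)
    (by simp [proj_one]) fun n u _ x _ => ?_) x
  rw [LinearMap.comp_apply, LinearMap.comp_apply, der_ι_mul, map_add, proj_ι_mul, proj_ι_mul,
    proj_ι_mul, aug_der, zero_smul, add_zero, map_smul]

omit [CharZero K] in
theorem family_mem {W : Type*} [AddCommGroup W] [Module K W] {𝒲 : SignedGrading K W} {s : ℤ}
    {φ : TensorAlgebra K U →ₗ[K] W} (hφ : HasDeg (signedGrading 𝒰) 𝒲 s φ) {n : ℕ} (e : Fin n → ℤ)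
    (x : Fin n → U) (hx : ∀ i, x i ∈ 𝒰.gr (e i)) : family φ n x ∈ 𝒲.gr (∑ i, e i + s) := by
  rw [family_apply, ← word_ofFn (fun i => (e i, x i))]
  have := word_mem_gr 𝒰 (l := List.ofFn fun i => (e i, x i)) fun c hc => by
    obtain ⟨i, rfl⟩ := (List.mem_ofFn' _ _).1 hc
    exact hx i
  have := hφ _ _ this
  simpa [wordDeg, List.map_ofFn, Function.comp_def, List.sum_ofFn] using this

omit [CharZero K] in
theorem proj_family_one {W : Type*} [AddCommGroup W] [Module K W]
    (φ : TensorAlgebra K U →ₗ[K] W) (u : U) : family φ 1 (fun _ => u) = φ (ι K u) := by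
  simp [family_apply]

omit [CharZero K] in
theorem family_zero {W : Type*} [AddCommGroup W] [Module K W]
    {φ : TensorAlgebra K U →ₗ[K] W} (h : φ 1 = 0) : family φ 0 = 0 := by
  ext x
  simp [family_apply, h]

omit [CharZero K] in
theorem family_proj : family (proj (K := K) (U := U)) = idFamily K U := by
  funext n
  ext x
  rw [family_apply]
  match n with
  | 0 => simp [proj_one, idFamily]
  | 1 => simp [proj_ι, idFamily]
  | n + 2 =>
    rw [List.ofFn_succ, List.prod_cons, proj_ι_mul, List.ofFn_succ, List.prod_cons, aug_ι_mul,
      zero_smul]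
    rfl

end TensorAlgebra

/-! ### The Leibniz∞[1] algebra of an anchored module -/

open SignedGrading TensorAlgebra SignedAlgebra

variable {K : Type*} [Field K] [CharZero K] {A : Type*} [Ring A] [Algebra K A]
  {𝒜 : SignedAlgebra K A} {D : A →ₗ[K] A}
  {M : Type*} [AddCommGroup M] [Module K M] {ℳ : SignedGrading K M}
  {N : Type*} [AddCommGroup N] [Module K N] {𝒩 : SignedGrading K N}
  {P : Type*} [AddCommGroup P] [Module K P] {𝒬 : SignedGrading K P}

namespace FreeDGModule

variable {X : FreeDGModule 𝒜 D ℳ} {Y : FreeDGModule 𝒜 D 𝒩} {Z : FreeDGModule 𝒜 D 𝒬}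

namespace Anchor

variable (𝔞 : X.Anchor) (𝔟 : Y.Anchor)

/-- After projection to length one, `op u` acts on augmentation-free elements through the anchor
alone. This is the source of the iterated contractions in the explicit formulas. -/
theorem proj_op (u : A ⊗[K] M) (x : TensorAlgebra K (A ⊗[K] M)) :
    proj (𝔞.op u x) = aug x • u + (𝔞.ρ u).rTensor M (proj x) := by
  rw [op_apply, map_add, proj_ι_mul]
  congr 1
  refine le_of_gr_le (𝒱 := 𝒜.tensor ℳ) (S := LinearMap.eqLocus
    (proj ∘ₗ LinearMap.applyₗ x ∘ₗ 𝒜.derFamily ℳ 0 𝔞.ρ)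
    (LinearMap.applyₗ (proj x) ∘ₗ LinearMap.rTensorHom _ ∘ₗ 𝔞.ρ)) (fun n u hu => ?_) u
  simp only [LinearMap.mem_eqLocus, LinearMap.comp_apply, LinearMap.applyₗ_apply_apply,
    𝒜.derFamily_apply ℳ 0 𝔞.ρ hu]
  exact proj_der _ _ _ _

omit [CharZero K] in
theorem rTensor_one_tmul (u : A ⊗[K] M) (m : M) : (𝔞.ρ u).rTensor M (1 ⊗ₜ m) = 0 := by
  refine le_of_gr_le (𝒱 := 𝒜.tensor ℳ) (S := LinearMap.ker
    (LinearMap.applyₗ (1 ⊗ₜ m) ∘ₗ LinearMap.rTensorHom _ ∘ₗ 𝔞.ρ)) (fun n u hu => ?_) u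
  change (𝔞.ρ u).rTensor M (1 ⊗ₜ m) = 0
  rw [LinearMap.rTensor_tmul, (𝔞.isDer n u hu).map_one, TensorProduct.zero_tmul]

omit [CharZero K] in
theorem aug_freeIncl_append (l : List (ℤ × M)) (m₀ : M) :
    aug (freeIncl A M (word l * ι K m₀)) = 0 := by
  cases l with
  | nil => rw [word_nil, one_mul, ← mul_one (ι K m₀), freeIncl_ι_mul, aug_ι_mul]
  | cons c l => rw [word_cons, mul_assoc, freeIncl_ι_mul, aug_ι_mul]

/-- The codifferential on words of generators. -/
theorem proj_codiff_word (l : List (ℤ × M)) (hl : ∀ c ∈ l, c.2 ∈ ℳ.gr c.1) (m₀ : M) :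
    proj (𝔞.codiff (freeIncl A M (word l * ι K m₀))) = (wordDeg l).negOnePow •
      (l.map fun c => ((𝔞.ρ (1 ⊗ₜ c.2)).rTensor M : Module.End K (A ⊗[K] M))).prod
        (X.d (1 ⊗ₜ m₀)) := by
  induction l with
  | nil =>
    have : freeIncl A M (ι K m₀) = ι K (1 ⊗ₜ m₀) := by
      rw [← mul_one (ι K m₀), freeIncl_ι_mul, map_one, mul_one]
    simp [this, codiff_ι, proj_ι]
  | cons c l ih =>
    have ih := ih fun c' hc' => hl c' (List.mem_cons_of_mem _ hc')
    have hc := 𝒜.one_tmul_mem_gr ℳ (hl c List.mem_cons_self)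
    -- The term of `codiff_op` in which the differential hits the first letter drops out: the
    -- remaining word has a length one part only if it is a single generator, and that is killed by
    -- the derivation.
    have hp : (𝔞.ρ (X.d (1 ⊗ₜ[K] c.2))).rTensor M
        (proj (freeIncl A M (word l * ι K m₀))) = 0 := by
      cases l with
      | nil =>
        have : freeIncl A M (ι K m₀) = ι K (1 ⊗ₜ m₀) := by
          rw [← mul_one (ι K m₀), freeIncl_ι_mul, map_one, mul_one]
        rw [word_nil, one_mul, this, proj_ι, rTensor_one_tmul]
      | cons c' l =>
        rw [word_cons, mul_assoc, freeIncl_ι_mul, proj_ι_mul, aug_freeIncl_append, zero_smul,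
          map_zero]
    rw [word_cons, mul_assoc, ← op_freeIncl, codiff_op, map_add, proj_op, proj_op,
      aug_freeIncl_append, 𝔞.isCoder_codiff.aug_apply, zero_smul, zero_smul, zero_add, zero_add, hp,
      zero_add, ih, (𝒜.tensor ℳ).sg_apply hc, one_mul, List.map_cons, List.prod_cons, wordDeg_cons,
      Int.negOnePow_add, mul_smul]
    have h := fun z => map_negOnePow_smul (LinearMap.applyₗ z ∘ₗ LinearMap.rTensorHom M ∘ₗ 𝔞.ρ)
      c.1 (1 ⊗ₜ c.2)
    rw [map_negOnePow_smul]
    refine (congrArg ((wordDeg l).negOnePow • ·) (h _)).trans ?_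
    rw [smul_smul, smul_smul, _root_.mul_comm]
    rfl

/-- The Leibniz infinity algebra defined by an anchored module. -/
def leibniz : LeibnizInftyAlg 𝒜.gr D (𝒜.tensor ℳ).gr where
  br := family (proj ∘ₗ 𝔞.codiff)
  br_zero := family_zero (by simp)
  br_mem n e x hx := by
    have := (hasDeg_proj (𝒜.tensor ℳ)).comp 𝔞.isCoder_codiff.hasDeg
    exact family_mem _ this e x hx
  br_one_smul p a y ha := by
    rw [proj_family_one, proj_family_one, LinearMap.comp_apply, LinearMap.comp_apply, codiff_ι,
      codiff_ι, proj_ι, proj_ι, X.d_smul, 𝒜.sg_smul ha, one_mul]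
  br_smul n hn e x hx i p a ha := by
    obtain ⟨x₁, h₁, x₂, h, h₀⟩ := exists_prod_update_eq (𝒜.tensor ℳ) e x hx i
    have h' := h (x i)
    rw [Function.update_eq_self] at h'
    -- Over A the scalar comes out in front and `freeCodiff` produces an extra term with `D a`. This
    -- term multiplies the length one part of a word with at least two letters, so it vanishes by
    -- `h₀`.
    rw [family_apply, family_apply, h, h', LinearMap.comp_apply, LinearMap.comp_apply,
      ← 𝒜.freeProj_toFree ℳ, ← freeCodiff_toFree, 𝒜.toFree_mul_smul ℳ ha, freeCodiff_smul, map_add,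
      freeProj_smul, freeProj_smul, freeProj_toFree, (signedGrading _).sg_apply h₁,
      smul_mul_assoc, smul_mul_assoc, map_negOnePow_smul, h₀ hn, smul_zero, smul_zero, zero_add,
      map_negOnePow_smul, map_negOnePow_smul, map_negOnePow_smul, freeCodiff_toFree,
      freeProj_toFree, 𝒜.sg_smul ha, one_mul, mul_add, mul_one, Int.negOnePow_add, mul_smul,
      Int.smul_negOnePow_smul]
  jacobi n _ e x hx := by
    rw [insertSum_family 𝔞.isCoder_codiff 𝔞.codiff_one _ e x hx, family_apply]
    simp [codiff_codiff]

variable {𝔞 𝔟}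

/-- A morphism of Leibniz infinity algebras from a morphism of coalgebras. -/
def leibnizHom (F : TensorAlgebra K (A ⊗[K] M) →ₗ[K] TensorAlgebra K (A ⊗[K] N))
    (hF : IsComor (𝒜.tensor ℳ) (𝒜.tensor 𝒩) F) (hQ : ∀ x, F (𝔞.codiff x) = 𝔟.codiff (F x))
    (hA : ∀ p, ∀ a ∈ 𝒜.gr p, ∀ x₁ u x₂, 𝒜.toFree 𝒩 (F (x₁ * ι K (a • u) * x₂)) =
      a • 𝒜.toFree 𝒩 (F ((signedGrading (𝒜.tensor ℳ)).sg p x₁ * ι K u * x₂))) :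
    LeibnizInftyHom 𝔞.leibniz 𝔟.leibniz where
  map := family (proj ∘ₗ F)
  map_zero := family_zero (by simp [hF.map_one, proj_one])
  map_mem n e x hx := by
    have := family_mem _ ((hasDeg_proj (𝒜.tensor 𝒩)).comp hF.hasDeg) e x hx
    simpa using this
  map_smul n e x hx i p a ha := by
    obtain ⟨x₁, h₁, x₂, h, -⟩ := exists_prod_update_eq (𝒜.tensor ℳ) e x hx i
    have h' := h (x i)
    rw [Function.update_eq_self] at h'
    rw [family_apply, family_apply, h, h', LinearMap.comp_apply, LinearMap.comp_apply,
      ← 𝒜.freeProj_toFree 𝒩, hA p a ha, freeProj_smul, (signedGrading _).sg_apply h₁,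
      smul_mul_assoc, smul_mul_assoc, map_negOnePow_smul, map_negOnePow_smul, map_negOnePow_smul,
      freeProj_toFree, Int.smul_negOnePow_smul]
  compat n _ e x hx := by
    have h₁ := compSum_family hF (proj ∘ₗ 𝔟.codiff) e x hx
    have h₂ := insertSum_family 𝔞.isCoder_codiff 𝔞.codiff_one (proj ∘ₗ F) e x hx
    refine h₁.trans (Eq.trans ?_ h₂.symm)
    rw [family_apply, family_apply]
    simp [hQ]

end Anchor

/-! ### Morphisms of anchored modules and functoriality -/

/-- A morphism of anchored modules. -/
structure AnchorHom (𝔞 : X.Anchor) (𝔟 : Y.Anchor) where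
  φ : A ⊗[K] M →ₗ[K] A ⊗[K] N
  hasDeg : HasDeg (𝒜.tensor ℳ) (𝒜.tensor 𝒩) 0 φ
  map_smul : ∀ (a : A) z, φ (a • z) = a • φ z
  map_d : ∀ z, φ (X.d z) = Y.d (φ z)
  map_anchor : ∀ u, 𝔟.ρ (φ u) = 𝔞.ρ u

namespace AnchorHom

variable {𝔞 : X.Anchor} {𝔟 : Y.Anchor} {𝔠 : Z.Anchor} (f : AnchorHom 𝔞 𝔟) (h : AnchorHom 𝔟 𝔠)

omit [CharZero K] in
theorem map_sg (e : ℤ) (u : A ⊗[K] M) :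
    f.φ ((𝒜.tensor ℳ).sg e u) = (𝒜.tensor 𝒩).sg e (f.φ u) := by
  rw [f.hasDeg.map_sg, mul_zero, Int.negOnePow_zero, one_smul]

/-- The induced map of tensor algebras. -/
def onWords : TensorAlgebra K (A ⊗[K] M) →ₗ[K] TensorAlgebra K (A ⊗[K] N) :=
  letterRec (mulLetter ∘ₗ f.φ) 1

omit [CharZero K] in
theorem onWords_one : f.onWords 1 = 1 := letterRec_one _ _

omit [CharZero K] in
theorem onWords_ι_mul (u : A ⊗[K] M) (x : TensorAlgebra K (A ⊗[K] M)) :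
    f.onWords (ι K u * x) = ι K (f.φ u) * f.onWords x := letterRec_ι_mul _ _ _ _

theorem isComor_onWords : IsComor (𝒜.tensor ℳ) (𝒜.tensor 𝒩) f.onWords := by
  refine isComor_letterRec (θ := f.φ) (fun n u hu => ?_) (fun u => ?_)
  · have := f.hasDeg n u hu
    rw [add_zero] at this
    exact isCoder_mulLetter this
  · simp

omit [CharZero K] in
theorem onWords_der (x : TensorAlgebra K (A ⊗[K] M)) :
    f.onWords (der (𝒜.tensor ℳ) 1 X.d x) = der (𝒜.tensor 𝒩) 1 Y.d (f.onWords x) := by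
  refine LinearMap.congr_fun (word_hom_ext (𝒜.tensor ℳ) (f := f.onWords ∘ₗ der (𝒜.tensor ℳ) 1 X.d)
    (g := der (𝒜.tensor 𝒩) 1 Y.d ∘ₗ f.onWords) (by simp [onWords_one]) fun n u _ x hx => ?_) x
  rw [LinearMap.comp_apply, LinearMap.comp_apply] at hx ⊢
  rw [der_ι_mul, map_add, onWords_ι_mul, onWords_ι_mul, onWords_ι_mul, der_ι_mul, hx, f.map_d,
    f.map_sg]

/-- The morphism of coalgebras induced by a morphism of anchored modules. -/
def comor : TensorAlgebra K (A ⊗[K] M) →ₗ[K] TensorAlgebra K (A ⊗[K] N) :=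
  𝔟.theta ∘ₗ f.onWords ∘ₗ 𝔞.thetaInv

theorem comor_apply (x : TensorAlgebra K (A ⊗[K] M)) :
    f.comor x = 𝔟.theta (f.onWords (𝔞.thetaInv x)) := rfl

theorem isComor_comor : IsComor (𝒜.tensor ℳ) (𝒜.tensor 𝒩) f.comor :=
  𝔟.isComor_theta.comp (f.isComor_onWords.comp 𝔞.isComor_thetaInv)

theorem comor_codiff (x : TensorAlgebra K (A ⊗[K] M)) :
    f.comor (𝔞.codiff x) = 𝔟.codiff (f.comor x) := by
  rw [comor_apply, comor_apply, Anchor.codiff_theta, Anchor.codiff_apply, Anchor.thetaInv_theta,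
    onWords_der]

/-- In the coordinates given by the two maps `theta` the morphism acts letter by letter; undoing
these coordinates replaces letters by `op`. -/
theorem comor_op (u : A ⊗[K] M) (x : TensorAlgebra K (A ⊗[K] M)) :
    f.comor (𝔞.op u x) = 𝔟.op (f.φ u) (f.comor x) := by
  obtain ⟨x, rfl⟩ := 𝔞.isUnipotent_theta.bijective.2 x
  rw [← Anchor.theta_ι_mul, comor_apply, comor_apply, Anchor.thetaInv_theta, Anchor.thetaInv_theta,
    onWords_ι_mul, Anchor.theta_ι_mul]

theorem comor_ι (u : A ⊗[K] M) : f.comor (ι K u) = ι K (f.φ u) := by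
  rw [← 𝔞.op_one, comor_op, f.isComor_comor.map_one, 𝔟.op_one]

/-- Preservation of the anchor makes the operators on both sides have the same symbol, so the
morphism descends to tensor algebras over A and scalars can be pulled out there. -/
theorem comor_smul {p : ℤ} {a : A} (ha : a ∈ 𝒜.gr p) (x₁ : TensorAlgebra K (A ⊗[K] M))
    (u : A ⊗[K] M) (x₂ : TensorAlgebra K (A ⊗[K] M)) :
    𝒜.toFree 𝒩 (f.comor (x₁ * ι K (a • u) * x₂)) =
      a • 𝒜.toFree 𝒩 (f.comor ((signedGrading (𝒜.tensor ℳ)).sg p x₁ * ι K u * x₂)) := by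
  have H := 𝔞.toFree_apply_eq_linExt (𝒩 := 𝒩) (F := f.comor) (E := 𝔟.op ∘ₗ f.φ)
    (E' := 𝔟.freeOp ∘ₗ f.φ) f.comor_op (fun u y => 𝔟.toFree_op _ _)
    (fun a u z => by
      rw [LinearMap.comp_apply, f.map_smul, 𝔟.freeOp_smul]
      rfl)
    (fun n u hu a z => by
      have := f.hasDeg n u hu
      rw [add_zero] at this
      rw [LinearMap.comp_apply, 𝔟.freeOp_apply_smul this, f.map_anchor])
  rw [H, 𝒜.toFree_mul_smul ℳ ha, linExt_smul, ← H]

/-- The morphism of Leibniz infinity algebras induced by a morphism of anchored modules. -/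
def leibnizHom : LeibnizInftyHom 𝔞.leibniz 𝔟.leibniz :=
  Anchor.leibnizHom f.comor f.isComor_comor f.comor_codiff fun _ _ ha => f.comor_smul ha

theorem proj_comor_word (l : List (ℤ × M)) (m₀ : M) :
    proj (f.comor (freeIncl A M (word l * ι K m₀))) =
      (l.map fun c => ((𝔟.ρ (f.φ (1 ⊗ₜ c.2))).rTensor N : Module.End K (A ⊗[K] N))).prod
        (f.φ (1 ⊗ₜ m₀)) := by
  induction l with
  | nil =>
    have : freeIncl A M (ι K m₀) = ι K (1 ⊗ₜ m₀) := by
      rw [← mul_one (ι K m₀), freeIncl_ι_mul, map_one, mul_one]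
    simp [this, comor_ι, proj_ι]
  | cons c l ih =>
    rw [word_cons, mul_assoc, ← 𝔞.op_freeIncl, comor_op, Anchor.proj_op, f.isComor_comor.aug_apply,
      Anchor.aug_freeIncl_append, zero_smul, zero_add, ih, List.map_cons, List.prod_cons,
      Module.End.mul_apply]

/-- In the composite of the two coalgebra maps, the middle `thetaInv` and `theta` cancel, and the
letterwise maps compose. -/
theorem isComposite {g : AnchorHom 𝔞 𝔠} (hg : ∀ u, g.φ u = h.φ (f.φ u)) :
    IsComposite (𝒜.tensor ℳ).gr g.leibnizHom.map h.leibnizHom.map f.leibnizHom.map := by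
  intro n _ e x hx
  refine Eq.trans ?_ (compSum_family f.isComor_comor (proj ∘ₗ h.comor) e x hx).symm
  have : g.onWords = h.onWords ∘ₗ f.onWords := word_hom_ext (𝒜.tensor ℳ)
    (by simp [onWords_one]) fun n u _ x hx => by
      rw [LinearMap.comp_apply] at hx ⊢
      rw [onWords_ι_mul, onWords_ι_mul, onWords_ι_mul, hx, hg]
  change family (proj ∘ₗ g.comor) n x = _
  congr 2
  refine LinearMap.ext fun x => ?_
  simp [comor_apply, this]

theorem map_eq_idFamily {g : AnchorHom 𝔞 𝔞} (hg : ∀ u, g.φ u = u) :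
    g.leibnizHom.map = idFamily K (A ⊗[K] M) := by
  have : g.onWords = LinearMap.id := word_hom_ext (𝒜.tensor ℳ)
    (by simp [onWords_one]) fun n u _ x hx => by
      rw [LinearMap.id_apply] at hx ⊢
      rw [onWords_ι_mul, hx, hg]
  rw [← family_proj]
  change family (proj ∘ₗ g.comor) = _
  congr 1
  refine LinearMap.ext fun x => ?_
  simp [comor_apply, this]

end AnchorHom

end FreeDGModule

/-! ### Homotopic anchors give isomorphic Leibniz∞[1] algebras -/

open SignedGrading TensorAlgebra SignedAlgebra

variable {K : Type*} [Field K] [CharZero K] {A : Type*} [Ring A] [Algebra K A]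
  {𝒜 : SignedAlgebra K A} {D : A →ₗ[K] A}
  {M : Type*} [AddCommGroup M] [Module K M] {ℳ : SignedGrading K M}

namespace FreeDGModule

variable {X : FreeDGModule 𝒜 D ℳ}

/-- A homotopy between two anchors. -/
structure AnchorHomotopy (𝔞 𝔟 : X.Anchor) where
  η : A ⊗[K] M →ₗ[K] Module.End K A
  isDer : 𝒜.IsDerFamily ℳ (-1) η
  smul_apply : ∀ a u b, η (a • u) b = 𝒜.sg 1 a * η u b
  comm : ∀ n, ∀ u ∈ (𝒜.tensor ℳ).gr n, ∀ b,
    𝔟.ρ u b = 𝔞.ρ u b + (D (η u b) + n.negOnePow • η u (D b)) + η (X.d u) b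

namespace AnchorHomotopy

variable {𝔞 𝔟 : X.Anchor} (h : AnchorHomotopy 𝔞 𝔟)

/-- The operators on the tensor algebra induced by a homotopy. -/
abbrev hop : A ⊗[K] M →ₗ[K] Module.End K (TensorAlgebra K (A ⊗[K] M)) := 𝒜.derFamily ℳ (-1) h.η

/-- The graded commutators of the codifferential with the operators induced by a homotopy. -/
def commOp : A ⊗[K] M →ₗ[K] Module.End K (TensorAlgebra K (A ⊗[K] M)) :=
  LinearMap.mulLeft K 𝔞.codiff ∘ₗ h.hop +
    LinearMap.mulRight K 𝔞.codiff ∘ₗ h.hop ∘ₗ (𝒜.tensor ℳ).sg 1 + h.hop ∘ₗ X.d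

theorem commOp_apply (u : A ⊗[K] M) (x : TensorAlgebra K (A ⊗[K] M)) :
    h.commOp u x = 𝔞.codiff (h.hop u x) + h.hop ((𝒜.tensor ℳ).sg 1 u) (𝔞.codiff x) +
      h.hop (X.d u) x := rfl

theorem isCoder_commOp {n : ℤ} {u : A ⊗[K] M} (hu : u ∈ (𝒜.tensor ℳ).gr n) :
    IsCoder (𝒜.tensor ℳ) n (h.commOp u) := by
  have h₁ : IsCoder (𝒜.tensor ℳ) (n + -1) (h.hop u) := h.isDer.isCoder hu
  have h₂ : IsCoder (𝒜.tensor ℳ) (n + 1 + -1) (h.hop (X.d u)) := h.isDer.isCoder (X.hasDeg n u hu)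
  have h₃ := 𝔞.isCoder_codiff.comm h₁
    (C := 𝔞.codiff ∘ₗ h.hop u + h.hop ((𝒜.tensor ℳ).sg 1 u) ∘ₗ 𝔞.codiff) (by
      rw [(𝒜.tensor ℳ).sg_apply hu, map_negOnePow_smul, one_mul, one_mul,
        show n = n + -1 + 1 by ring, Int.negOnePow_succ]
      refine LinearMap.ext fun x => ?_
      simp)
  rw [show 1 + (n + -1) = n by ring] at h₃
  rw [show n + 1 + -1 = n by ring] at h₂
  exact h₃.add h₂

theorem commOp_mem_lenFil (u : A ⊗[K] M) {k : ℕ} {x : TensorAlgebra K (A ⊗[K] M)}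
    (hx : x ∈ lenFil K _ k) : h.commOp u x ∈ lenFil K _ k := by
  have h₁ := 𝔞.codiff_mem_lenFil (𝒜.derFamily_mem_lenFil ℳ (-1) h.η u hx)
  have h₂ := 𝒜.derFamily_mem_lenFil ℳ (-1) h.η ((𝒜.tensor ℳ).sg 1 u) (𝔞.codiff_mem_lenFil hx)
  have h₃ := 𝒜.derFamily_mem_lenFil ℳ (-1) h.η (X.d u) hx
  rw [commOp_apply]
  exact add_mem (add_mem h₁ h₂) h₃

/-- `commOp` is the boundary of the family `hop` in the complex of maps from letters to operators,
so it is closed. Adding it to the operators of the anchor therefore preserves their commutation rule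
with the codifferential. -/
theorem codiff_commOp (u : A ⊗[K] M) (x : TensorAlgebra K (A ⊗[K] M)) :
    𝔞.codiff (h.commOp u x) =
      h.commOp (X.d u) x + h.commOp ((𝒜.tensor ℳ).sg 1 u) (𝔞.codiff x) := by
  rw [commOp_apply, commOp_apply, commOp_apply, map_add, map_add, 𝔞.codiff_codiff,
    𝔞.codiff_codiff, X.d_d, X.d_sg, map_zero, map_neg, map_zero]
  simp only [LinearMap.neg_apply, LinearMap.zero_apply]
  abel

/-- The corrected letters deformed by a homotopy. -/
def op : A ⊗[K] M →ₗ[K] Module.End K (TensorAlgebra K (A ⊗[K] M)) := 𝔞.op + h.commOp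

theorem op_apply (u : A ⊗[K] M) (x : TensorAlgebra K (A ⊗[K] M)) :
    h.op u x = 𝔞.op u x + h.commOp u x := rfl

/-- Each term of the correction contains a derivation or the codifferential acting on the unit. This
keeps the first component of the isomorphism equal to the identity. -/
theorem op_one (u : A ⊗[K] M) : h.op u 1 = ι K u := by
  rw [op_apply, commOp_apply, 𝔞.op_one, derFamily_one, derFamily_one, 𝔞.codiff_one, map_zero,
    map_zero, add_zero, add_zero, add_zero]

theorem isCoder_op {n : ℤ} {u : A ⊗[K] M} (hu : u ∈ (𝒜.tensor ℳ).gr n) :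
    IsCoder (𝒜.tensor ℳ) n (h.op u) := (𝔞.isCoder_op hu).add (h.isCoder_commOp hu)

theorem op_sub_mem (u : A ⊗[K] M) (k : ℕ) (x : TensorAlgebra K (A ⊗[K] M))
    (hx : x ∈ lenFil K _ k) : h.op u x - ι K u * x ∈ lenFil K _ k := by
  rw [op_apply, add_sub_right_comm]
  exact add_mem (𝔞.op_sub_mem u k x hx) (h.commOp_mem_lenFil u hx)

theorem codiff_op (u : A ⊗[K] M) (x : TensorAlgebra K (A ⊗[K] M)) :
    𝔞.codiff (h.op u x) = h.op (X.d u) x + h.op ((𝒜.tensor ℳ).sg 1 u) (𝔞.codiff x) := by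
  rw [op_apply, op_apply, op_apply, map_add, 𝔞.codiff_op, codiff_commOp]
  abel

/-- The operators on the tensor algebra over `A` induced by a homotopy. -/
abbrev freeHop : A ⊗[K] M →ₗ[K] Module.End K (A ⊗[K] TensorAlgebra K M) :=
  LinearMap.rTensorHom _ ∘ₗ h.η

/-- The operators on the tensor algebra over `A` induced by `commOp`. -/
def freeCommOp : A ⊗[K] M →ₗ[K] Module.End K (A ⊗[K] TensorAlgebra K M) :=
  LinearMap.mulLeft K 𝔞.freeCodiff ∘ₗ h.freeHop +
    LinearMap.mulRight K 𝔞.freeCodiff ∘ₗ h.freeHop ∘ₗ (𝒜.tensor ℳ).sg 1 + h.freeHop ∘ₗ X.d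

theorem freeCommOp_apply (u : A ⊗[K] M) (z : A ⊗[K] TensorAlgebra K M) :
    h.freeCommOp u z = 𝔞.freeCodiff (h.freeHop u z) +
      h.freeHop ((𝒜.tensor ℳ).sg 1 u) (𝔞.freeCodiff z) + h.freeHop (X.d u) z := rfl

theorem toFree_hop (u : A ⊗[K] M) (x : TensorAlgebra K (A ⊗[K] M)) :
    𝒜.toFree ℳ (h.hop u x) = h.freeHop u (𝒜.toFree ℳ x) := h.isDer.toFree_derFamily u x

theorem toFree_commOp (u : A ⊗[K] M) (x : TensorAlgebra K (A ⊗[K] M)) :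
    𝒜.toFree ℳ (h.commOp u x) = h.freeCommOp u (𝒜.toFree ℳ x) := by
  rw [commOp_apply, freeCommOp_apply, map_add, map_add, toFree_hop, toFree_hop,
    ← 𝔞.freeCodiff_toFree, ← 𝔞.freeCodiff_toFree, toFree_hop]

omit [CharZero K] in
theorem freeHop_smul (a : A) (u : A ⊗[K] M) (z : A ⊗[K] TensorAlgebra K M) :
    h.freeHop (a • u) z = 𝒜.sg 1 a • h.freeHop u z :=
  Anchor.rTensor_smul_left h.η (f := 𝒜.sg 1) (h.smul_apply a u) z

omit [CharZero K] in
theorem freeHop_apply_smul {n : ℤ} {u : A ⊗[K] M} (hu : u ∈ (𝒜.tensor ℳ).gr n) (a : A)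
    (z : A ⊗[K] TensorAlgebra K M) :
    h.freeHop u (a • z) = h.η u a • z + 𝒜.sg (n + -1) a • h.freeHop u z :=
  𝒜.rTensor_smul (h.isDer n u hu) a z

omit [CharZero K] in
theorem sg_one_sg_one (a : A) : 𝒜.sg 1 (𝒜.sg 1 a) = a := by
  rw [𝒜.sg_sg, 𝒜.sg_eq_of_even (f := 0) (by decide), 𝒜.sg_zero, LinearMap.id_apply]

/-- The term with `D a` from the commutator cancels the one from the differential of `a • u`, thanks
to the sign in the linearity of `η`. -/
theorem freeCommOp_smul (a : A) (u : A ⊗[K] M) (z : A ⊗[K] TensorAlgebra K M) :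
    h.freeCommOp (a • u) z = a • h.freeCommOp u z := by
  rw [freeCommOp_apply, freeCommOp_apply, freeHop_smul, 𝔞.freeCodiff_smul, 𝒜.tensor_sg_smul,
    freeHop_smul, X.d_smul, map_add, LinearMap.add_apply, freeHop_smul, freeHop_smul, X.D_sg,
    sg_one_sg_one, smul_add, smul_add, neg_smul]
  abel

/-- The symbol of the correction is the boundary of `η`, that is, the difference of the two anchors;
the mixed terms cancel. The deformed operators thus have symbol `𝔟.ρ` although they are built on the
codifferential of `𝔞`. -/
theorem freeCommOp_apply_smul {n : ℤ} {u : A ⊗[K] M} (hu : u ∈ (𝒜.tensor ℳ).gr n) (a : A)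
    (z : A ⊗[K] TensorAlgebra K M) :
    h.freeCommOp u (a • z) =
      (𝔟.ρ u a - 𝔞.ρ u a) • z + 𝒜.sg n a • h.freeCommOp u z := by
  have e₁ : D (𝒜.sg (n + -1) a) = -(n.negOnePow • 𝒜.sg (n + -1) (D a)) := by
    rw [X.isDer.hasDeg.map_sg, mul_one, ← sub_eq_add_neg, Int.negOnePow_sub, Int.negOnePow_one]
    simp
  have e₂ : 𝒜.sg 1 (h.η u a) = -(n.negOnePow • h.η u (𝒜.sg 1 a)) := by
    rw [(h.isDer n u hu).hasDeg.sg_map, one_mul, ← sub_eq_add_neg, Int.negOnePow_sub,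
      Int.negOnePow_one]
    simp
  have e₃ : 𝒜.sg (1 + (n + -1)) a = 𝒜.sg n a := by rw [show 1 + (n + -1) = n by ring]
  have e₄ : 𝒜.sg (n + -1 + 1) a = 𝒜.sg n a := by rw [show n + -1 + 1 = n by ring]
  have e₅ : 𝒜.sg (n + 1 + -1) a = 𝒜.sg n a := by rw [show n + 1 + -1 = n by ring]
  have e₆ : 𝔟.ρ u a - 𝔞.ρ u a = D (h.η u a) + n.negOnePow • h.η u (D a) + h.η (X.d u) a := by
    rw [h.comm n u hu]
    abel
  rw [freeCommOp_apply, freeCommOp_apply, h.freeHop_apply_smul hu, map_add, 𝔞.freeCodiff_smul,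
    𝔞.freeCodiff_smul, 𝔞.freeCodiff_smul, map_add,
    h.freeHop_apply_smul ((𝒜.tensor ℳ).sg_mem hu), h.freeHop_apply_smul ((𝒜.tensor ℳ).sg_mem hu),
    h.freeHop_apply_smul (X.hasDeg n u hu), e₁, e₂, e₆, 𝒜.sg_sg, 𝒜.sg_sg, e₃, e₄, e₅,
    (𝒜.tensor ℳ).sg_apply hu]
  simp only [one_mul, smul_add, add_smul, neg_smul, smul_assoc, Units.smul_def, map_zsmul,
    LinearMap.smul_apply, smul_comm _ (n.negOnePow : ℤ)]
  abel

/-- The operators on the tensor algebra over `A` induced by `op`. -/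
def freeOp : A ⊗[K] M →ₗ[K] Module.End K (A ⊗[K] TensorAlgebra K M) := 𝔞.freeOp + h.freeCommOp

theorem freeOp_apply (u : A ⊗[K] M) (z : A ⊗[K] TensorAlgebra K M) :
    h.freeOp u z = 𝔞.freeOp u z + h.freeCommOp u z := rfl

/-- The change of coordinates on the tensor algebra defined by a homotopy. -/
def xi : TensorAlgebra K (A ⊗[K] M) →ₗ[K] TensorAlgebra K (A ⊗[K] M) := letterRec h.op 1

theorem xi_ι_mul (u : A ⊗[K] M) (x : TensorAlgebra K (A ⊗[K] M)) :
    h.xi (ι K u * x) = h.op u (h.xi x) := letterRec_ι_mul _ _ _ _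

theorem isUnipotent_xi : IsUnipotent (lenFil K (A ⊗[K] M)) h.xi :=
  isUnipotent_letterRec h.op_sub_mem

theorem isComor_xi : IsComor (𝒜.tensor ℳ) (𝒜.tensor ℳ) h.xi :=
  isComor_letterRec (θ := LinearMap.id) (fun _ _ hu => h.isCoder_op hu) h.op_one

theorem xi_ι (u : A ⊗[K] M) : h.xi (ι K u) = ι K u := by
  rw [← mul_one (ι K u), xi_ι_mul, h.isComor_xi.map_one, h.op_one, mul_one]

/-- So `xi` conjugates the linear codifferential into that of `𝔞`, just as `theta` does; composing
it with the inverse of `theta` for `𝔟` relates the two codifferentials. -/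
theorem codiff_xi (x : TensorAlgebra K (A ⊗[K] M)) :
    𝔞.codiff (h.xi x) = h.xi (der (𝒜.tensor ℳ) 1 X.d x) := by
  refine LinearMap.congr_fun (word_hom_ext (𝒜.tensor ℳ) (f := 𝔞.codiff ∘ₗ h.xi)
    (g := h.xi ∘ₗ der (𝒜.tensor ℳ) 1 X.d) (by simp [h.isComor_xi.map_one])
    fun n u _ x hx => ?_) x
  rw [LinearMap.comp_apply, LinearMap.comp_apply] at hx ⊢
  rw [xi_ι_mul, codiff_op, der_ι_mul, map_add, xi_ι_mul, xi_ι_mul, hx]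

/-- The isomorphism of coalgebras induced by a homotopy. -/
def comor : TensorAlgebra K (A ⊗[K] M) →ₗ[K] TensorAlgebra K (A ⊗[K] M) := h.xi ∘ₗ 𝔟.thetaInv

theorem comor_apply (x : TensorAlgebra K (A ⊗[K] M)) : h.comor x = h.xi (𝔟.thetaInv x) := rfl

theorem isComor_comor : IsComor (𝒜.tensor ℳ) (𝒜.tensor ℳ) h.comor :=
  h.isComor_xi.comp 𝔟.isComor_thetaInv

theorem isUnipotent_comor : IsUnipotent (lenFil K (A ⊗[K] M)) h.comor :=
  h.isUnipotent_xi.comp 𝔟.isUnipotent_theta.isUnipotent_inv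

theorem comor_ι (u : A ⊗[K] M) : h.comor (ι K u) = ι K u := by
  rw [comor_apply, 𝔟.thetaInv_ι, xi_ι]

theorem comor_codiff (x : TensorAlgebra K (A ⊗[K] M)) :
    h.comor (𝔟.codiff x) = 𝔞.codiff (h.comor x) := by
  rw [comor_apply, comor_apply, Anchor.codiff_apply, Anchor.thetaInv_theta, codiff_xi]

theorem comor_op (u : A ⊗[K] M) (x : TensorAlgebra K (A ⊗[K] M)) :
    h.comor (𝔟.op u x) = h.op u (h.comor x) := by
  obtain ⟨x, rfl⟩ := 𝔟.isUnipotent_theta.bijective.2 x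
  rw [← Anchor.theta_ι_mul, comor_apply, comor_apply, Anchor.thetaInv_theta, Anchor.thetaInv_theta,
    xi_ι_mul]

/-- The map of tensor algebras over `A` induced by `comor`. -/
def freeComor : A ⊗[K] TensorAlgebra K M →ₗ[K] A ⊗[K] TensorAlgebra K M :=
  linExt A (𝒜.toFree ℳ ∘ₗ h.comor ∘ₗ (freeIncl A M).toLinearMap)

/-- Here `𝔟.op` is carried to the deformed operators. Both have symbol `𝔟.ρ`, which is the condition
for descent to A. -/
theorem toFree_comor (x : TensorAlgebra K (A ⊗[K] M)) :
    𝒜.toFree ℳ (h.comor x) = h.freeComor (𝒜.toFree ℳ x) := by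
  refine 𝔟.toFree_apply_eq_linExt (E := h.op) (E' := h.freeOp) h.comor_op (fun u y => ?_)
    (fun a u z => ?_) (fun n u hu a z => ?_) x
  · rw [op_apply, freeOp_apply, map_add, 𝔞.toFree_op, toFree_commOp]
  · rw [freeOp_apply, freeOp_apply, 𝔞.freeOp_smul, freeCommOp_smul, smul_add]
  · rw [freeOp_apply, freeOp_apply, 𝔞.freeOp_apply_smul hu, h.freeCommOp_apply_smul hu, smul_add,
      sub_smul]
    abel

theorem comor_smul {p : ℤ} {a : A} (ha : a ∈ 𝒜.gr p) (x₁ : TensorAlgebra K (A ⊗[K] M))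
    (u : A ⊗[K] M) (x₂ : TensorAlgebra K (A ⊗[K] M)) :
    𝒜.toFree ℳ (h.comor (x₁ * ι K (a • u) * x₂)) =
      a • 𝒜.toFree ℳ (h.comor ((signedGrading (𝒜.tensor ℳ)).sg p x₁ * ι K u * x₂)) := by
  rw [toFree_comor, 𝒜.toFree_mul_smul ℳ ha, freeComor, linExt_smul, ← freeComor, ← toFree_comor]

/-- The length filtration of a tensor algebra over `A`. -/
def freeFil (A M : Type*) [Ring A] [Algebra K A] [AddCommGroup M] [Module K M] (k : ℕ) :
    Submodule K (A ⊗[K] TensorAlgebra K M) :=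
  Submodule.span K {z | ∃ a : A, ∃ x ∈ lenFil K M k, z = a ⊗ₜ x}

omit [CharZero K] in
theorem freeFil_smul_mem {k : ℕ} (a : A) {z : A ⊗[K] TensorAlgebra K M}
    (hz : z ∈ freeFil A M k) : a • z ∈ freeFil A M k := by
  suffices H : freeFil A M k ≤ (freeFil A M k).comap (Module.toModuleEnd K _ a) from H hz
  refine Submodule.span_le.2 ?_
  rintro _ ⟨b, x, hx, rfl⟩
  exact Submodule.subset_span ⟨a * b, x, hx, rfl⟩

variable (𝒜) in
theorem freeLetter_mem_freeFil {k : ℕ} (u : A ⊗[K] M) {z : A ⊗[K] TensorAlgebra K M}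
    (hz : z ∈ freeFil A M k) : 𝒜.freeLetter ℳ u z ∈ freeFil A M (k + 1) := by
  suffices H : freeFil A M k ≤ (freeFil A M (k + 1)).comap (𝒜.freeLetter ℳ u) from H hz
  refine Submodule.span_le.2 ?_
  rintro _ ⟨b, x, hx, rfl⟩
  refine free_induction (ℳ := ℳ) (S := (freeFil A M (k + 1)).comap
    (LinearMap.applyₗ (b ⊗ₜ x) ∘ₗ 𝒜.freeLetter ℳ)) (fun q m hm a => ?_) u
  change 𝒜.freeLetter ℳ (a ⊗ₜ m) (b ⊗ₜ x) ∈ freeFil A M (k + 1)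
  rw [𝒜.freeLetter_tmul ℳ hm]
  exact Submodule.subset_span ⟨_, _, ι_mul_mem_lenFil m hx, rfl⟩

theorem toFree_mem_freeFil {k : ℕ} {x : TensorAlgebra K (A ⊗[K] M)} (hx : x ∈ lenFil K _ k) :
    𝒜.toFree ℳ x ∈ freeFil A M k := by
  refine lenFil_induction (F := freeFil A M) (fun k => ?_) (fun k u x _ h => ?_) hx
  · rw [toFree_one]
    exact Submodule.subset_span ⟨1, 1, one_mem_lenFil k, rfl⟩
  · rw [toFree_ι_mul]
    exact freeLetter_mem_freeFil 𝒜 u h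

omit [CharZero K] in
theorem freeIncl_mem_lenFil {k : ℕ} {x : TensorAlgebra K M} (hx : x ∈ lenFil K M k) :
    freeIncl A M x ∈ lenFil K (A ⊗[K] M) k := by
  refine lenFil_induction (f := (freeIncl A M).toLinearMap) (F := lenFil K (A ⊗[K] M))
    (fun k => ?_) (fun k u x _ h => ?_) hx
  · rw [AlgHom.toLinearMap_apply, map_one]
    exact one_mem_lenFil k
  · rw [AlgHom.toLinearMap_apply, freeIncl_ι_mul]
    exact ι_mul_mem_lenFil _ h

/-- Only injectivity is used: it lets A-multilinearity pass from the isomorphism to its inverse. -/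
theorem isUnipotent_freeComor : IsUnipotent (freeFil A M) h.freeComor where
  zero := by
    refine eq_bot_iff.2 (Submodule.span_le.2 ?_)
    rintro _ ⟨a, x, hx, rfl⟩
    rw [lenFil_zero, Submodule.mem_bot] at hx
    simp [hx]
  mono k m hkm := Submodule.span_mono fun _ ⟨a, x, hx, hz⟩ => ⟨a, x, lenFil_mono hkm hx, hz⟩
  exists_mem z := by
    have mono : Monotone (freeFil (K := K) A M) := fun k m hkm =>
      Submodule.span_mono fun _ ⟨a, x, hx, hz⟩ => ⟨a, x, lenFil_mono hkm hx, hz⟩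
    induction z using TensorProduct.induction_on with
    | zero => exact ⟨0, zero_mem _⟩
    | add y z hy hz =>
      obtain ⟨k, hk⟩ := hy
      obtain ⟨m, hm⟩ := hz
      exact ⟨max k m, add_mem (mono (le_max_left _ _) hk) (mono (le_max_right _ _) hm)⟩
    | tmul a x =>
      obtain ⟨k, hk⟩ := exists_mem_lenFil x
      exact ⟨k, Submodule.subset_span ⟨a, x, hk, rfl⟩⟩
  lowers k z hz := by
    suffices H : freeFil A M (k + 1) ≤ (freeFil A M k).comap (h.freeComor - LinearMap.id) from H hz
    refine Submodule.span_le.2 ?_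
    rintro _ ⟨a, x, hx, rfl⟩
    have e : (h.freeComor - LinearMap.id : Module.End K (A ⊗[K] TensorAlgebra K M)) (a ⊗ₜ x) =
        a • 𝒜.toFree ℳ (h.comor (freeIncl A M x) - freeIncl A M x) := by
      rw [map_sub, toFree_freeIncl, smul_sub, TensorProduct.smul_tmul', smul_eq_mul, mul_one]
      rfl
    rw [SetLike.mem_coe, Submodule.mem_comap, e]
    exact freeFil_smul_mem a (toFree_mem_freeFil
      (h.isUnipotent_comor.lowers k _ (freeIncl_mem_lenFil hx)))

/-- The inverse of `comor`. -/
def comorInv : TensorAlgebra K (A ⊗[K] M) →ₗ[K] TensorAlgebra K (A ⊗[K] M) :=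
  h.isUnipotent_comor.inv

theorem comor_comorInv (x : TensorAlgebra K (A ⊗[K] M)) : h.comor (h.comorInv x) = x :=
  h.isUnipotent_comor.apply_inv x

theorem comorInv_comor (x : TensorAlgebra K (A ⊗[K] M)) : h.comorInv (h.comor x) = x :=
  h.isUnipotent_comor.inv_apply x

theorem isComor_comorInv : IsComor (𝒜.tensor ℳ) (𝒜.tensor ℳ) h.comorInv :=
  Anchor.isComor_inv h.isComor_comor h.isUnipotent_comor

theorem comorInv_codiff (x : TensorAlgebra K (A ⊗[K] M)) :
    h.comorInv (𝔞.codiff x) = 𝔟.codiff (h.comorInv x) := by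
  rw [← h.comor_comorInv x, ← comor_codiff, comorInv_comor, comorInv_comor]

theorem comorInv_smul {p : ℤ} {a : A} (ha : a ∈ 𝒜.gr p) (x₁ : TensorAlgebra K (A ⊗[K] M))
    (u : A ⊗[K] M) (x₂ : TensorAlgebra K (A ⊗[K] M)) :
    𝒜.toFree ℳ (h.comorInv (x₁ * ι K (a • u) * x₂)) =
      a • 𝒜.toFree ℳ (h.comorInv ((signedGrading (𝒜.tensor ℳ)).sg p x₁ * ι K u * x₂)) := by
  -- After applying `freeComor`, both sides become the rule for pulling a scalar out of a word.
  apply h.isUnipotent_freeComor.injective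
  rw [← toFree_comor, comor_comorInv, 𝒜.toFree_mul_smul ℳ ha]
  conv_rhs => rw [freeComor, linExt_smul, ← freeComor, ← toFree_comor, comor_comorInv]

/-- The isomorphism of Leibniz infinity algebras induced by a homotopy. -/
def leibnizHom : LeibnizInftyHom 𝔟.leibniz 𝔞.leibniz :=
  Anchor.leibnizHom h.comor h.isComor_comor h.comor_codiff fun _ _ ha => h.comor_smul ha

/-- The inverse of the isomorphism of Leibniz infinity algebras induced by a homotopy. -/
def leibnizInv : LeibnizInftyHom 𝔞.leibniz 𝔟.leibniz :=
  Anchor.leibnizHom h.comorInv h.isComor_comorInv h.comorInv_codiff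
    fun _ _ ha => h.comorInv_smul ha

theorem isComposite_inv_hom :
    IsComposite (𝒜.tensor ℳ).gr (idFamily K (A ⊗[K] M)) h.leibnizInv.map h.leibnizHom.map := by
  intro n _ e x hx
  refine Eq.trans ?_ (compSum_family h.isComor_comor (proj ∘ₗ h.comorInv) e x hx).symm
  rw [← family_proj]
  congr 2
  exact LinearMap.ext fun x => by simp [comorInv_comor]

theorem isComposite_hom_inv :
    IsComposite (𝒜.tensor ℳ).gr (idFamily K (A ⊗[K] M)) h.leibnizHom.map h.leibnizInv.map := by
  intro n _ e x hx
  refine Eq.trans ?_ (compSum_family h.isComor_comorInv (proj ∘ₗ h.comor) e x hx).symm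
  rw [← family_proj]
  congr 2
  exact LinearMap.ext fun x => by simp [comor_comorInv]

theorem leibnizHom_one (z : A ⊗[K] M) : h.leibnizHom.map 1 (fun _ => z) = z := by
  change family (proj ∘ₗ h.comor) 1 _ = z
  rw [proj_family_one, LinearMap.comp_apply, comor_ι, proj_ι]

end AnchorHomotopy

end FreeDGModule

/-! ### The Chevalley–Eilenberg algebra as a graded commutative algebra with derivations -/

/-- The signed grading defined by a direct sum decomposition, shifted by `s`. -/
def DirectSum.IsInternal.signedGrading {K V : Type*} [Field K] [AddCommGroup V] [Module K V]
    {𝒱 : ℤ → Submodule K V} (h : DirectSum.IsInternal 𝒱) (s : ℤ) : SignedGrading K V where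
  gr n := 𝒱 (n + s)
  -- An element of the original piece `𝒱 n` has degree `n - s` in the shifted grading.
  sg e := DirectSum.toModule K ℤ V (fun n => (e * (n - s)).negOnePow • (𝒱 n).subtype) ∘ₗ
    (LinearEquiv.ofBijective (DirectSum.coeLinearMap 𝒱) h).symm.toLinearMap
  sg_apply {e n x} hx := by
    have : (LinearEquiv.ofBijective (DirectSum.coeLinearMap 𝒱) h).symm x =
        DirectSum.lof K ℤ (fun i => 𝒱 i) (n + s) ⟨x, hx⟩ := by
      rw [LinearEquiv.symm_apply_eq]
      exact (DirectSum.coeLinearMap_lof 𝒱 (n + s) ⟨x, hx⟩).symm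
    rw [LinearMap.comp_apply, LinearEquiv.coe_coe, this, DirectSum.toModule_lof, add_sub_cancel_right]
    rfl
  iSup_gr := by
    rw [← h.submodule_iSup_eq_top]
    exact (Equiv.addRight s).iSup_comp (g := 𝒱)

namespace SignedAlgebra

open SignedGrading

variable {K : Type*} [Field K] {A : Type*} [Ring A] [Algebra K A] {𝒜 : SignedAlgebra K A}

theorem IsDer.add {e : ℤ} {p q : A →ₗ[K] A} (hp : 𝒜.IsDer e p) (hq : 𝒜.IsDer e q) :
    𝒜.IsDer e (p + q) where
  hasDeg := hp.hasDeg.add hq.hasDeg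
  map_mul a b := by
    rw [LinearMap.add_apply, LinearMap.add_apply, LinearMap.add_apply, hp.map_mul, hq.map_mul,
      add_mul, mul_add]
    abel

theorem IsDer.smul {e : ℤ} {p : A →ₗ[K] A} (hp : 𝒜.IsDer e p) (c : K) :
    𝒜.IsDer e (c • p) where
  hasDeg n x hx := Submodule.smul_mem _ c (hp.hasDeg n x hx)
  map_mul a b := by
    simp only [LinearMap.smul_apply, hp.map_mul, smul_add, smul_mul_assoc, mul_smul_comm]

theorem isDer_zero (e : ℤ) : 𝒜.IsDer e 0 where
  hasDeg n x hx := zero_mem _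
  map_mul a b := by simp

theorem IsDer.mulLeft {e k : ℤ} {p : A →ₗ[K] A} (hp : 𝒜.IsDer e p) {a : A} (ha : a ∈ 𝒜.gr k) :
    𝒜.IsDer (k + e) (LinearMap.mulLeft K a ∘ₗ p) where
  hasDeg n x hx := by
    have := 𝒜.mul_mem ha (hp.hasDeg n x hx)
    rwa [show k + (n + e) = n + (k + e) by ring] at this
  map_mul b c := by
    simp only [LinearMap.comp_apply, LinearMap.mulLeft_apply]
    rw [hp.map_mul, mul_add, ← mul_assoc, ← mul_assoc a (𝒜.sg e b),
      𝒜.mul_eq_sg_mul ha (𝒜.sg e b), 𝒜.sg_sg, mul_assoc _ a]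

theorem IsDer.comm {e f : ℤ} {p q : A →ₗ[K] A} (hp : 𝒜.IsDer e p) (hq : 𝒜.IsDer f q) :
    𝒜.IsDer (e + f) (p ∘ₗ q - (e * f).negOnePow • q ∘ₗ p) where
  hasDeg := by
    refine (hp.hasDeg.comp hq.hasDeg).sub (HasDeg.smul ?_ _)
    rw [add_comm]
    exact hq.hasDeg.comp hp.hasDeg
  map_mul a b := by
    simp only [LinearMap.sub_apply, LinearMap.smul_apply, LinearMap.comp_apply, hp.map_mul,
      hq.map_mul, map_add, hq.hasDeg.sg_map, hp.hasDeg.sg_map, 𝒜.sg_sg, smul_add,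
      smul_mul_assoc, sub_mul, mul_sub, mul_smul_comm, smul_smul, ← Int.negOnePow_add]
    rw [_root_.mul_comm f e, add_comm f e, Int.negOnePow_even (e * f + e * f) ⟨_, rfl⟩, one_smul]
    abel

end SignedAlgebra

namespace DGLieAlgebra

open SignedGrading SignedAlgebra

variable {K : Type u} [Field K] {L : Type v} [AddCommGroup L] [Module K L]
  [FiniteDimensional K L] (g : DGLieAlgebra K L)

omit [FiniteDimensional K L] in
/-- Induction on products of homogeneous generators. -/
theorem ceGr_induction {S : ℤ → Submodule K g.CE} (h₁ : 1 ∈ S 0)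
    (h : ∀ p n, ∀ ξ ∈ g.dualGr p, ∀ a ∈ g.ceGr n, a ∈ S n → g.ceGen ξ * a ∈ S (1 - p + n))
    {n : ℤ} {a : g.CE} (ha : a ∈ g.ceGr n) : a ∈ S n := by
  suffices H : ∀ k, g.biGr k n ≤ S n from (iSup_le H : g.ceGr n ≤ _) ha
  intro k
  refine Submodule.span_le.2 ?_
  rintro _ ⟨l, hl, -, rfl, rfl⟩
  clear ha
  suffices H : (l.map fun c => g.ceGen c.2).prod ∈ g.ceGr (l.map fun c => 1 - c.1).sum ∧
      (l.map fun c => g.ceGen c.2).prod ∈ S (l.map fun c => 1 - c.1).sum from H.2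
  induction l with
  | nil => exact ⟨by simpa using g.one_mem_ceGr, by simpa using h₁⟩
  | cons c l ih =>
    have ih := ih fun c' hc' => hl c' (List.mem_cons_of_mem _ hc')
    have hc := hl c List.mem_cons_self
    simp only [List.map_cons, List.prod_cons, List.sum_cons]
    exact ⟨g.mul_mem_ceGr (g.biGr_le_ceGr _ _ (g.ceGen_mem_biGr hc)) ih.1, h _ _ _ hc _ ih.1 ih.2⟩

omit [FiniteDimensional K L] in
theorem ceGr_mul_comm {m n : ℤ} {a b : g.CE} (ha : a ∈ g.ceGr m) (hb : b ∈ g.ceGr n) :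
    a * b = (m * n).negOnePow • (b * a) := by
  refine g.ceGr_induction (S := fun n => LinearMap.eqLocus (LinearMap.mulLeft K a)
    ((m * n).negOnePow • LinearMap.mulRight K a)) (by simp) (fun p n ξ hξ b _ h => ?_) hb
  simp only [LinearMap.mem_eqLocus, LinearMap.mulLeft_apply, LinearMap.smul_apply,
    LinearMap.mulRight_apply] at h ⊢
  rw [← mul_assoc, g.mul_ceGen_comm ha hξ, smul_mul_assoc, mul_assoc, h, mul_smul_comm, smul_smul,
    ← Int.negOnePow_add, mul_add, mul_assoc]

/-- The graded algebra `C(𝔤)`. -/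
def ceAlgebra : SignedAlgebra K g.CE where
  gr := g.ceGr
  sg e := (g.parity e).toLinearMap
  sg_apply := g.parity_apply _
  iSup_gr := by
    refine eq_top_iff.2 fun a _ => ?_
    induction a using g.ce_induction with
    | hs c =>
      rw [Algebra.algebraMap_eq_smul_one]
      exact Submodule.smul_mem _ _ (Submodule.mem_iSup_of_mem 0 g.one_mem_ceGr)
    | hg ξ =>
      rw [ceGen_eq_sum]
      exact sum_mem fun i _ => Submodule.smul_mem _ _
        (Submodule.mem_iSup_of_mem (1 - i.1) (g.biGr_le_ceGr _ _ (g.eta_mem i)))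
    | hm a b ha hb =>
      have := Submodule.mul_mem_mul (ha trivial) (hb trivial)
      rw [Submodule.iSup_mul] at this
      refine (iSup_le fun m => ?_ : _ ≤ (⨆ n, g.ceGr n)) this
      rw [Submodule.mul_iSup]
      refine iSup_le fun n => Submodule.mul_le.2 fun x hx y hy => ?_
      exact Submodule.mem_iSup_of_mem (m + n) (g.mul_mem_ceGr hx hy)
    | ha a b ha hb => exact add_mem (ha trivial) (hb trivial)
  one_mem := g.one_mem_ceGr
  mul_mem := g.mul_mem_ceGr
  mul_comm := g.ceGr_mul_comm

theorem isDer_of_ceGen {s : ℤ} {p : g.CE →ₗ[K] g.CE}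
    (hm : ∀ a b, p (a * b) = p a * b + g.parity s a * p b)
    (hg : ∀ q, ∀ ξ ∈ g.dualGr q, p (g.ceGen ξ) ∈ g.ceGr (1 - q + s)) : g.ceAlgebra.IsDer s p where
  hasDeg n x hx := by
    have h₁ : p 1 = 0 := by
      have := hm 1 1
      rwa [mul_one, mul_one, map_one (g.parity s), one_mul, left_eq_add] at this
    refine g.ceGr_induction (S := fun n => (g.ceGr (n + s)).comap p) ?_ (fun q n ξ hξ a ha h => ?_) hx
    · rw [Submodule.mem_comap, h₁]
      exact zero_mem _
    · rw [Submodule.mem_comap, hm]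
      have hξ' := g.biGr_le_ceGr _ _ (g.ceGen_mem_biGr hξ)
      have e₁ := g.mul_mem_ceGr (hg q ξ hξ) ha
      have e₂ := g.mul_mem_ceGr (g.ceAlgebra.sg_mem (e := s) hξ') h
      rw [show 1 - q + s + n = 1 - q + n + s by ring] at e₁
      rw [show 1 - q + (n + s) = 1 - q + n + s by ring] at e₂
      exact add_mem e₁ e₂
  map_mul := hm

variable {g} in
-- Reduces Cartan's formula to a check on the generators of C(𝔤).
theorem isDer_ext {s : ℤ} {p q : g.CE →ₗ[K] g.CE} (hp : g.ceAlgebra.IsDer s p)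
    (hq : g.ceAlgebra.IsDer s q) (h : ∀ r, ∀ ξ ∈ g.dualGr r, p (g.ceGen ξ) = q (g.ceGen ξ)) :
    p = q := by
  refine LinearMap.ext fun a => ?_
  induction a using g.ce_induction with
  | hs c => rw [Algebra.algebraMap_eq_smul_one, map_smul, map_smul, hp.map_one, hq.map_one]
  | hg ξ =>
    rw [ceGen_eq_sum, map_sum, map_sum]
    refine Finset.sum_congr rfl fun i _ => ?_
    rw [map_smul, map_smul, eta, h _ _ (g.coord_mem i)]
  | hm a b ha hb => rw [hp.map_mul, hq.map_mul, ha, hb]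
  | ha a b ha hb => rw [map_add, map_add, ha, hb]

theorem isDer_ceD : g.ceAlgebra.IsDer 1 g.ceD :=
  g.isDer_of_ceGen (g.der_mul 1 _ g.ceDGen_mem) fun q ξ hξ => by
    rw [ceD, der_ceGen]
    exact g.ceDGen_mem q ξ hξ

theorem isDer_contr {p : ℤ} {x : L} (hx : x ∈ g.gr p) : g.ceAlgebra.IsDer (p - 1) (g.contr x) :=
  g.isDer_of_ceGen (g.contr_mul hx) fun q ξ hξ => by
    rw [contr_ceGen, Algebra.algebraMap_eq_smul_one]
    by_cases h : p = q
    · rw [show 1 - q + (p - 1) = 0 by omega]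
      exact Submodule.smul_mem _ _ g.one_mem_ceGr
    · rw [hξ p h x hx, zero_smul]
      exact zero_mem _

/-- The operator `ι_z` on `C(𝔤)` along `z ∈ C(𝔤, 𝔤)`. -/
def contrDer : g.Coch L →ₗ[K] Module.End K g.CE :=
  TensorProduct.lift (LinearMap.mk₂ K (fun a x => LinearMap.mulLeft K a ∘ₗ g.contr x)
    (fun a b x => LinearMap.ext fun c => by simp [add_mul])
    (fun c a x => LinearMap.ext fun b => by simp)
    (fun a x y => by rw [map_add, LinearMap.comp_add])
    (fun c a x => by rw [map_smul, LinearMap.comp_smul]))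

theorem contrDer_tmul (a : g.CE) (x : L) (b : g.CE) :
    g.contrDer (a ⊗ₜ x) b = a * g.contr x b := rfl

theorem contrDer_smul (a : g.CE) (z : g.Coch L) (b : g.CE) :
    g.contrDer (a • z) b = a * g.contrDer z b := by
  induction z using TensorProduct.induction_on with
  | zero => simp
  | add y z hy hz => simp only [smul_add, map_add, LinearMap.add_apply, hy, hz, mul_add]
  | tmul c x => rw [TensorProduct.smul_tmul', smul_eq_mul, contrDer_tmul, contrDer_tmul, mul_assoc]

theorem contrCoch_eq_rTensor (V : Type w) [AddCommGroup V] [Module K V] (z : g.Coch L) :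
    g.contrCoch V z = (g.contrDer z).rTensor V := by
  induction z using TensorProduct.induction_on with
  | zero => rw [map_zero, map_zero, LinearMap.rTensor_zero]
  | add y z hy hz => rw [map_add, map_add, LinearMap.rTensor_add, hy, hz]
  | tmul a x => exact TensorProduct.ext' fun b m => rfl

theorem isDer_contrDer {n : ℤ} {z : g.Coch L} (hz : z ∈ g.cochGr g.gr n) :
    g.ceAlgebra.IsDer (n - 1) (g.contrDer z) := by
  induction hz using Submodule.span_induction with
  | mem z hz =>
    obtain ⟨p, q, a, ha, x, hx, rfl, rfl⟩ := hz
    have := (g.isDer_contr hx).mulLeft (𝒜 := g.ceAlgebra) ha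
    rwa [← add_sub_assoc] at this
  | zero => rw [map_zero]; exact isDer_zero _
  | add y z _ _ hy hz => rw [map_add]; exact hy.add hz
  | smul c z _ hz => rw [map_smul]; exact hz.smul c

theorem total_adjoint (x : L) :
    g.adjoint.total x = 1 ⊗ₜ g.d x + ∑ i, g.eta i ⊗ₜ[K] g.bracket (g.basis i) x := by
  rw [LFMap.total_eq_sum (N := 2) g.adjoint (fun k hk => by
    obtain ⟨k, rfl⟩ := Nat.exists_eq_add_of_le' hk
    rfl), Finset.sum_range_succ, Finset.sum_range_one]
  simp [adjoint, adjointComp]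

theorem contr_basis_eta (k i : g.Idx) :
    g.contr (g.basis k) (g.eta i) = if i = k then 1 else 0 := by
  rw [eta, contr_ceGen, Module.Basis.coord_apply, Module.Basis.repr_self, Finsupp.single_apply]
  split_ifs <;> simp_all

end DGLieAlgebra

/-! ### Cartan's formula -/

namespace DGLieAlgebra

open SignedGrading SignedAlgebra

variable {K : Type u} [Field K] [CharZero K] {L : Type v} [AddCommGroup L] [Module K L]
  [FiniteDimensional K L] (g : DGLieAlgebra K L)

omit [CharZero K] in
theorem sign_smul {V : Type*} [AddCommGroup V] [Module K V] (i k : ℤ) (c : K) (y : V) :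
    i.negOnePow • (-((k * i).negOnePow • c)) • ((k - 1) * (1 - i)).negOnePow • y =
      k.negOnePow • c • y := by
  have h : (k + 1).negOnePow = i.negOnePow * (k * i).negOnePow * ((k - 1) * (1 - i)).negOnePow := by
    rw [← Int.negOnePow_add, ← Int.negOnePow_add, Int.negOnePow_eq_iff]
    exact ⟨1 - i, by ring⟩
  rw [Int.negOnePow_succ] at h
  rw [neg_smul, smul_neg, ← neg_neg (k.negOnePow), h, Units.neg_smul, mul_smul, mul_smul]
  simp only [Units.smul_def, smul_assoc, smul_comm c]

/-- The contraction of the differential of a generator. -/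
theorem contr_basis_ceDGen (k : g.Idx) (ξ : Module.Dual K L) :
    g.contr (g.basis k) (g.ceDGen ξ) =
      k.1.negOnePow • g.contrDer (g.adjoint.total (g.basis k)) (g.ceGen ξ) := by
  have hk := g.basis_mem k
  have e₁ : g.contr (g.basis k) (∑ i : g.Idx, i.1.negOnePow • (ξ (g.d (g.basis i)) • g.eta i)) =
      k.1.negOnePow • (ξ (g.d (g.basis k)) • (1 : g.CE)) := by
    rw [map_sum, Finset.sum_eq_single_of_mem k (Finset.mem_univ k)]
    · rw [map_negOnePow_smul, map_smul, contr_basis_eta, if_pos rfl]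
    · intro i _ hi
      rw [map_negOnePow_smul, map_smul, contr_basis_eta, if_neg hi, smul_zero, smul_zero]
  have e₂ : g.contr (g.basis k) (∑ i : g.Idx, ∑ j : g.Idx,
      i.1.negOnePow • (ξ (g.bracket (g.basis j) (g.basis i)) • (g.eta i * g.eta j))) =
      k.1.negOnePow • (2 : K) • ∑ j, ξ (g.bracket (g.basis j) (g.basis k)) • g.eta j := by
    -- Contracting the quadratic part hits either factor. By the skew symmetry of the bracket the
    -- two contributions coincide, which cancels the coefficient 1/2 in the differential.
    have h : ∀ i j : g.Idx, g.contr (g.basis k)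
        (i.1.negOnePow • (ξ (g.bracket (g.basis j) (g.basis i)) • (g.eta i * g.eta j))) =
        (if i = k then k.1.negOnePow • (ξ (g.bracket (g.basis j) (g.basis k)) • g.eta j) else 0) +
        (if j = k then k.1.negOnePow • (ξ (g.bracket (g.basis i) (g.basis k)) • g.eta i) else 0) := by
      intro i j
      rw [map_negOnePow_smul, map_smul, g.contr_mul hk, contr_basis_eta, contr_basis_eta,
        g.parity_apply _ (g.biGr_le_ceGr _ _ (g.eta_mem i)), smul_add, smul_add]
      congr 1
      · split_ifs with h
        · rw [h, one_mul]
        · rw [zero_mul, smul_zero, smul_zero]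
      · split_ifs with h
        · rw [h, mul_one, g.skew hk (g.basis_mem i), map_neg, map_negOnePow_smul, sign_smul]
        · rw [mul_zero, smul_zero, smul_zero]
    simp only [map_sum, h, Finset.sum_add_distrib, Finset.sum_ite_eq', Finset.sum_ite_irrel,
      Finset.sum_const_zero, Finset.mem_univ, if_true]
    rw [two_smul, smul_add, Finset.smul_sum]
  rw [total_adjoint, map_add, LinearMap.add_apply, contrDer_tmul, contr_ceGen, one_mul, map_sum,
    LinearMap.sum_apply]
  simp only [ceDGen, LinearMap.add_apply, LinearMap.smul_apply, LinearMap.sum_apply,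
    LinearMap.smulRight_apply, LinearMap.applyₗ_apply_apply, map_add, map_smul, e₁, e₂, contrDer_tmul,
    contr_ceGen]
  rw [smul_add, Algebra.algebraMap_eq_smul_one]
  congr 1
  rw [smul_comm (2⁻¹ : K), smul_smul, inv_mul_cancel₀ two_ne_zero, one_smul]
  congr 1
  refine Finset.sum_congr rfl fun j _ => ?_
  rw [Algebra.algebraMap_eq_smul_one, mul_smul_comm, mul_one]

/-- For a basis vector, the graded commutator of the differential with the contraction and the
contraction along the adjoint differential are derivations of the same degree. On a generator the
contraction is a scalar, which the differential kills, so `contr_basis_ceDGen` decides. -/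
theorem ceD_contrDer_one_tmul {p : ℤ} {x : L} (hx : x ∈ g.gr p) (b : g.CE) :
    g.ceD (g.contr x b) = (p - 1).negOnePow • g.contr x (g.ceD b) +
      g.contrDer (g.adjoint.total x) b := by
  have H : ∀ k : g.Idx, g.ceD ∘ₗ g.contr (g.basis k) -
      (1 * (k.1 - 1)).negOnePow • g.contr (g.basis k) ∘ₗ g.ceD =
        g.contrDer (g.adjoint.total (g.basis k)) := by
    intro k
    have hk := g.basis_mem k
    have h₁ := g.isDer_ceD.comm (g.isDer_contr hk)
    have ht : g.adjoint.total (g.basis k) ∈ g.cochGr g.gr (k.1 + 1) := by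
      rw [total_adjoint]
      refine add_mem (g.adjoint.comp_mem_gr 0 _ _ hk) ?_
      have := g.adjoint.comp_mem_gr 1 _ _ hk
      simpa [adjoint, adjointComp] using this
    have h₂ := g.isDer_contrDer ht
    rw [show 1 + (k.1 - 1) = k.1 + 1 - 1 by ring] at h₁
    refine isDer_ext h₁ h₂ fun r ξ _ => ?_
    simp only [LinearMap.sub_apply, LinearMap.smul_apply, LinearMap.comp_apply, contr_ceGen]
    have hD : g.ceD (g.ceGen ξ) = g.ceDGen ξ := g.der_ceGen _ _ _ _
    rw [hD, contr_basis_ceDGen, Algebra.algebraMap_eq_smul_one, map_smul, g.isDer_ceD.map_one,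
      smul_zero, zero_sub, smul_smul, ← Int.negOnePow_add,
      show 1 * (k.1 - 1) + k.1 = k.1 + k.1 + -1 by ring, Int.negOnePow_add,
      Int.negOnePow_even (k.1 + k.1) ⟨_, rfl⟩]
    simp
  have hs := g.basis.sum_repr x
  rw [← hs]
  simp only [map_sum, map_smul, LinearMap.sum_apply, LinearMap.smul_apply]
  rw [Finset.smul_sum, ← Finset.sum_add_distrib]
  refine Finset.sum_congr rfl fun k _ => ?_
  -- Only basis vectors of the degree of `x` occur in its expansion, so the sign is the same for all
  -- nonzero terms.
  by_cases hk : k.1 = p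
  · have := LinearMap.congr_fun (H k) b
    simp only [LinearMap.sub_apply, LinearMap.smul_apply, LinearMap.comp_apply, one_mul] at this
    rw [← this, ← hk, smul_sub, smul_comm (g.basis.repr x k) (k.1 - 1).negOnePow]
    abel
  · have : g.basis.repr x k = 0 := g.coord_mem k p (Ne.symm hk) x hx
    simp [this]

/-- Extension of the previous identity to coefficients in C(𝔤): when the differential hits the
coefficient, it produces the Chevalley–Eilenberg part of the total differential. This yields the
compatibility axiom of the anchor. -/
theorem ceD_contrDer {n : ℤ} {z : g.Coch L} (hz : z ∈ g.cochGr g.gr n) (b : g.CE) :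
    g.ceD (g.contrDer z b) = (n - 1).negOnePow • g.contrDer z (g.ceD b) +
      g.contrDer (g.totalD g.adjoint z) b := by
  suffices H : g.cochGr g.gr n ≤ LinearMap.eqLocus (g.ceD ∘ₗ LinearMap.applyₗ b ∘ₗ g.contrDer)
      ((n - 1).negOnePow • (LinearMap.applyₗ (g.ceD b) ∘ₗ g.contrDer) +
        LinearMap.applyₗ b ∘ₗ g.contrDer ∘ₗ g.totalD g.adjoint) from H hz
  refine Submodule.span_le.2 ?_
  rintro _ ⟨p, q, a, ha, x, hx, rfl, rfl⟩
  change g.ceD (g.contrDer (a ⊗ₜ x) b) = (p + q - 1).negOnePow • g.contrDer (a ⊗ₜ x) (g.ceD b) +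
      g.contrDer (g.ceD a ⊗ₜ x + g.parity 1 a • g.adjoint.total x) b
  rw [map_add, LinearMap.add_apply, contrDer_smul, contrDer_tmul, contrDer_tmul, contrDer_tmul,
    g.isDer_ceD.map_mul, ceD_contrDer_one_tmul g hx]
  change _ + g.parity 1 a * _ = _
  rw [g.parity_apply 1 ha, mul_add, one_mul, add_sub_assoc, Int.negOnePow_add]
  simp only [smul_mul_assoc, mul_smul_comm, mul_smul, smul_comm (q - 1).negOnePow p.negOnePow]
  abel

end DGLieAlgebra

/-! ### Anchored modules and homotopies obtained from weak Loday–Pirashvili modules -/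

namespace DGLieAlgebra

open SignedGrading SignedAlgebra

variable {K : Type u} [Field K] {L : Type v} [AddCommGroup L] [Module K L]
  [FiniteDimensional K L] (g : DGLieAlgebra K L)
  {V : Type*} [AddCommGroup V] [Module K V] {𝒱 : ℤ → Submodule K V}
  {W : Type*} [AddCommGroup W] [Module K W] {𝒲 : ℤ → Submodule K W}

omit [FiniteDimensional K L] in
theorem cochGr_shift (n : ℤ) : g.cochGr (fun q => 𝒱 (q + 1)) n = g.cochGr 𝒱 (n + 1) := by
  refine le_antisymm (Submodule.span_le.2 ?_) (Submodule.span_le.2 ?_)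
  · rintro _ ⟨p, q, a, ha, x, hx, rfl, rfl⟩
    exact g.tmul_mem_cochGr ha hx (by ring)
  · rintro _ ⟨p, q, a, ha, x, hx, h, rfl⟩
    exact g.tmul_mem_cochGr (𝒱 := fun q => 𝒱 (q + 1)) (q := q - 1) ha (by simpa using hx)
      (by omega)

variable {g}

omit [FiniteDimensional K L] in
theorem LFMap.total_mem {r : ℤ} (t : g.LFMap 𝒱 𝒲 r) {n : ℤ} {x : V} (hx : x ∈ 𝒱 n) :
    t.total x ∈ g.cochGr 𝒲 (n + r) := by
  obtain ⟨N, hN⟩ := t.locallyFinite x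
  rw [t.total_eq_sum hN]
  exact sum_mem fun k _ => t.comp_mem_gr k n x hx

omit [FiniteDimensional K L] in
theorem LFMap.lin_mem (t : g.LFMap 𝒱 𝒲 0) {n : ℤ} {z : g.Coch V} (hz : z ∈ g.cochGr 𝒱 n) :
    t.lin z ∈ g.cochGr 𝒲 n := by
  have := g.extend_mem_cochGr (u := t.total) (fun q x hx => t.total_mem hx) hz
  rwa [add_zero] at this

variable (g)

theorem totalD_tmul (t : g.LFMap 𝒱 𝒱 1) (a : g.CE) (x : V) :
    g.totalD t (a ⊗ₜ x) = g.ceD a ⊗ₜ x + g.parity 1 a • t.total x := rfl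

theorem totalD_one_tmul (t : g.LFMap 𝒱 𝒱 1) (x : V) : g.totalD t (1 ⊗ₜ x) = t.total x := by
  rw [totalD_tmul, g.isDer_ceD.map_one, TensorProduct.zero_tmul, zero_add, map_one, one_smul]

theorem totalD_smul (t : g.LFMap 𝒱 𝒱 1) (a : g.CE) (z : g.Coch V) :
    g.totalD t (a • z) = g.ceD a • z + g.parity 1 a • g.totalD t z := by
  induction z using TensorProduct.induction_on with
  | zero => simp
  | add y z hy hz =>
    simp only [smul_add, map_add, hy, hz]
    abel
  | tmul b x =>
    have := g.isDer_ceD.map_mul a b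
    rw [TensorProduct.smul_tmul', smul_eq_mul, totalD_tmul, totalD_tmul, this, map_mul,
      TensorProduct.add_tmul, mul_smul, smul_add, TensorProduct.smul_tmul',
      TensorProduct.smul_tmul', smul_eq_mul, smul_eq_mul, add_assoc]
    rfl

theorem totalD_mem (t : g.LFMap 𝒱 𝒱 1) {n : ℤ} {z : g.Coch V} (hz : z ∈ g.cochGr 𝒱 n) :
    g.totalD t z ∈ g.cochGr 𝒱 (n + 1) := by
  suffices H : g.cochGr 𝒱 n ≤ (g.cochGr 𝒱 (n + 1)).comap (g.totalD t) from H hz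
  refine Submodule.span_le.2 ?_
  rintro _ ⟨p, q, a, ha, x, hx, rfl, rfl⟩
  rw [SetLike.mem_coe, Submodule.mem_comap, totalD_tmul]
  refine add_mem (g.tmul_mem_cochGr (g.isDer_ceD.hasDeg _ _ ha) hx (by ring)) ?_
  have := g.smul_mem_cochGr (g.ceAlgebra.sg_mem (e := 1) ha) (t.total_mem hx)
  rwa [← add_assoc] at this

variable {g}

/-- The differential graded `C(𝔤)`-module `C(𝔤, M[1])`. -/
def LFModule.freeDGModule (M : LFModule.{u, v, w} g) :
    FreeDGModule g.ceAlgebra g.ceD (M.internal.signedGrading 1) where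
  d := g.totalD M.str
  isDer := g.isDer_ceD
  hasDeg n z hz := by
    change z ∈ g.cochGr (fun q => M.gr (q + 1)) n at hz
    change g.totalD M.str z ∈ g.cochGr (fun q => M.gr (q + 1)) (n + 1)
    rw [cochGr_shift] at hz ⊢
    exact g.totalD_mem M.str hz
  d_smul := g.totalD_smul M.str
  d_d := M.sq_zero

theorem LFModule.mem_shiftGr {M : LFModule.{u, v, w} g} {n : ℤ} {z : g.Coch M.carrier}
    (hz : z ∈ (g.ceAlgebra.tensor (M.internal.signedGrading 1)).gr n) :
    z ∈ g.cochGr M.gr (n + 1) := by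
  rw [← cochGr_shift]
  exact hz

theorem signCoch_smul (a : g.CE) (z : g.Coch V) :
    g.signCoch V (a • z) = g.parity 1 a • g.signCoch V z := by
  induction z using TensorProduct.induction_on with
  | zero => simp
  | add y z hy hz => simp only [smul_add, map_add, hy, hz]
  | tmul b x =>
    rw [TensorProduct.smul_tmul', smul_eq_mul]
    change g.parity 1 (a * b) ⊗ₜ x = g.parity 1 a • g.parity 1 b ⊗ₜ x
    rw [map_mul, TensorProduct.smul_tmul', smul_eq_mul]

theorem parity_one_parity_one (a : g.CE) : g.parity 1 (g.parity 1 a) = a := by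
  refine (g.ceAlgebra.sg_sg 1 1 a).trans ?_
  rw [g.ceAlgebra.sg_eq_of_even (e := 1 + 1) (f := 0) (by decide), sg_zero]
  rfl

theorem signCoch_signCoch (z : g.Coch V) : g.signCoch V (g.signCoch V z) = z := by
  induction z using TensorProduct.induction_on with
  | zero => simp
  | add y z hy hz => rw [map_add, map_add, hy, hz]
  | tmul b x =>
    change g.parity 1 (g.parity 1 b) ⊗ₜ x = b ⊗ₜ x
    rw [parity_one_parity_one]

/-- The `t`-component of an element of the path object. -/
def pathFst (V : Type w) [AddCommGroup V] [Module K V] : V × V × V →ₗ[K] V :=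
  LinearMap.fst K V V ∘ₗ LinearMap.snd K V (V × V)

/-- The `dt`-component of an element of the path object. -/
def pathSnd (V : Type w) [AddCommGroup V] [Module K V] : V × V × V →ₗ[K] V :=
  LinearMap.snd K V V ∘ₗ LinearMap.snd K V (V × V)

omit [FiniteDimensional K L] in
theorem lTensor_smul' {V W : Type*} [AddCommGroup V] [Module K V] [AddCommGroup W] [Module K W]
    (p : V →ₗ[K] W) (a : g.CE) (z : g.Coch V) :
    p.lTensor g.CE (a • z) = a • p.lTensor g.CE z := by
  induction z using TensorProduct.induction_on with
  | zero => simp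
  | add y z hy hz => simp only [smul_add, map_add, hy, hz]
  | tmul b x => rfl

theorem pathSnd_pathComp {V : Type w} [AddCommGroup V] [Module K V] {𝒱 : ℤ → Submodule K V}
    (t : g.LFMap 𝒱 𝒱 1) (k : ℕ) (x : V × V × V) :
    (pathSnd V).lTensor g.CE (g.pathComp t k x) =
      (if k = 0 then 1 ⊗ₜ pathFst (K := K) V x else 0) - g.signCoch V (t.comp k (pathSnd (K := K) V x)) := by
  have h₀ : pathSnd V ∘ₗ pathIn₀ (K := K) V = 0 := rfl
  have h₁ : pathSnd V ∘ₗ pathIn₁ (K := K) V = 0 := rfl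
  have h₂ : pathSnd V ∘ₗ pathIn₂ (K := K) V = LinearMap.id := rfl
  simp only [pathComp, LinearMap.add_apply, LinearMap.comp_apply, map_add,
    ← LinearMap.lTensor_comp_apply, h₀, h₁, h₂, LinearMap.lTensor_zero, LinearMap.zero_apply,
    LinearMap.lTensor_id, LinearMap.id_apply, zero_add, LinearMap.sub_apply]
  split_ifs <;> rfl

theorem pathSnd_total {V : Type w} [AddCommGroup V] [Module K V] {𝒱 : ℤ → Submodule K V}
    (t : g.LFMap 𝒱 𝒱 1) (x : V × V × V) :
    (pathSnd V).lTensor g.CE ((g.path t).total x) =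
      1 ⊗ₜ pathFst (K := K) V x - g.signCoch V (t.total (pathSnd (K := K) V x)) := by
  obtain ⟨N₁, h₁⟩ := (g.path t).locallyFinite x
  obtain ⟨N₂, h₂⟩ := t.locallyFinite (pathSnd (K := K) V x)
  rw [(g.path t).total_eq_sum (N := N₁ + N₂ + 1) fun k hk => h₁ k (by omega),
    t.total_eq_sum (N := N₁ + N₂ + 1) fun k hk => h₂ k (by omega), map_sum, map_sum]
  have h : ∀ k, (pathSnd V).lTensor g.CE ((g.path t).comp k x) =
      (if k = 0 then 1 ⊗ₜ pathFst (K := K) V x else 0) - g.signCoch V (t.comp k (pathSnd (K := K) V x)) :=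
    fun k => pathSnd_pathComp t k x
  simp only [h, Finset.sum_sub_distrib]
  congr 1
  simp

/-- The third component of the differential of the path object. -/
theorem signCoch_pathSnd_totalD {V : Type w} [AddCommGroup V] [Module K V]
    {𝒱 : ℤ → Submodule K V} (t : g.LFMap 𝒱 𝒱 1) (z : g.Coch (V × V × V)) :
    g.signCoch V ((pathSnd V).lTensor g.CE (g.totalD (g.path t) z)) =
      (pathFst V).lTensor g.CE z -
        g.totalD t (g.signCoch V ((pathSnd V).lTensor g.CE z)) := by
  induction z using TensorProduct.induction_on with
  | zero => simp
  | add y z hy hz =>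
    simp only [map_add, hy, hz]
    abel
  | tmul a x =>
    have e : g.parity 1 (g.ceD a) = -g.ceD (g.parity 1 a) := by
      have := g.isDer_ceD.hasDeg.sg_map 1 a
      rw [mul_one, Int.negOnePow_one, Units.neg_smul, one_smul] at this
      exact this
    -- The sign operator undoes the sign from moving `dt` past the coefficients, leaving the
    -- `t`-component minus the ordinary total differential.
    rw [totalD_tmul, map_add, map_add, lTensor_smul', signCoch_smul, parity_one_parity_one,
      pathSnd_total, map_sub, signCoch_signCoch]
    change g.parity 1 (g.ceD a) ⊗ₜ pathSnd (K := K) V x + a • (g.parity 1 1 ⊗ₜ pathFst (K := K) V x - _) =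
      a ⊗ₜ pathFst (K := K) V x - (g.ceD (g.parity 1 a) ⊗ₜ pathSnd (K := K) V x +
        g.parity 1 (g.parity 1 a) • t.total (pathSnd (K := K) V x))
    rw [e, map_one, parity_one_parity_one, smul_sub, TensorProduct.smul_tmul', smul_eq_mul, mul_one,
      TensorProduct.neg_tmul]
    abel

omit [FiniteDimensional K L] in
theorem LFMap.lTensor_lin {V W X : Type*} [AddCommGroup V] [Module K V] [AddCommGroup W]
    [Module K W] [AddCommGroup X] [Module K X] {𝒱 : ℤ → Submodule K V} {𝒲 : ℤ → Submodule K W}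
    {𝒳 : ℤ → Submodule K X} {H : g.LFMap 𝒱 𝒲 0} {f : g.LFMap 𝒱 𝒳 0} {p : W →ₗ[K] X}
    (h : ∀ k x, p.lTensor g.CE (H.comp k x) = f.comp k x) (z : g.Coch V) :
    p.lTensor g.CE (H.lin z) = f.lin z := by
  have ht : ∀ x, p.lTensor g.CE (H.total x) = f.total x := by
    intro x
    obtain ⟨N, hN⟩ := H.locallyFinite x
    rw [H.total_eq_sum hN, f.total_eq_sum fun k hk => by rw [← h, hN k hk, map_zero], map_sum]
    exact Finset.sum_congr rfl fun k _ => h k x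
  induction z using TensorProduct.induction_on with
  | zero => simp
  | add y z hy hz => simp only [map_add, hy, hz]
  | tmul a x => rw [lin, extend_tmul, lTensor_smul', ht, lin, extend_tmul]

omit [FiniteDimensional K L] in
theorem pathSnd_mem {V : Type w} [AddCommGroup V] [Module K V] {𝒱 : ℤ → Submodule K V} {n : ℤ}
    {z : g.Coch (V × V × V)} (hz : z ∈ g.cochGr (pathGr 𝒱) (n + 1)) :
    (pathSnd V).lTensor g.CE z ∈ g.cochGr 𝒱 n := by
  have := g.lTensor_mem_cochGr (𝒱 := pathGr 𝒱) (𝒲 := 𝒱) (r := -1) (pathSnd V)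
    (fun q x hx => hx.2.2) hz
  rwa [add_neg_cancel_right] at this

variable [CharZero K]

/-- The anchor of `C(𝔤, M[1])` defined by a weak Loday-Pirashvili module `f : M ⇝ 𝔤`. -/
def WLP.anchor (X : WLP.{u, v, w} g) : X.mod.freeDGModule.Anchor where
  ρ := g.contrDer ∘ₗ X.f.lin
  isDer n u hu := by
    have := g.isDer_contrDer (X.f.lin_mem (LFModule.mem_shiftGr hu))
    rwa [add_sub_cancel_right, ← add_zero n] at this
  smul_apply a u b := by
    rw [LinearMap.comp_apply, LFMap.lin, extend_smul, contrDer_smul]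
    rfl
  comm n u hu b := by
    have := g.ceD_contrDer (X.f.lin_mem (LFModule.mem_shiftGr hu)) b
    -- The shift by one in M[1] cancels the degree drop of a contraction, and the ∞-morphism
    -- property replaces the adjoint differential of `f u` by `f` of the differential of `u`.
    rw [add_sub_cancel_right, ← X.f_hom] at this
    exact this

/-- The morphism of anchored modules defined by a morphism of weak Loday-Pirashvili modules. -/
def WLP.Hom.anchorHom {X Y : WLP.{u, v, w} g} (φ : WLP.Hom g X Y) :
    FreeDGModule.AnchorHom X.anchor Y.anchor where
  φ := φ.φ.lin
  hasDeg n z hz := by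
    change z ∈ g.cochGr (fun q => X.mod.gr (q + 1)) n at hz
    change φ.φ.lin z ∈ g.cochGr (fun q => Y.mod.gr (q + 1)) (n + 0)
    rw [add_zero]
    rw [cochGr_shift] at hz ⊢
    exact φ.φ.lin_mem hz
  map_smul := g.extend_smul _
  map_d := φ.φ_hom
  map_anchor u := by
    change g.contrDer (Y.f.lin (φ.φ.lin u)) = g.contrDer (X.f.lin u)
    rw [← LFMap.lin_compose, φ.comm]

/-- The homotopy of anchors defined by a homotopy of `∞`-morphisms. -/
def anchorHomotopy {M : LFModule.{u, v, w} g} {f f' : g.LFMap M.gr g.gr 0}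
    (hf : g.IsInftyHom M.str g.adjoint f) (hf' : g.IsInftyHom M.str g.adjoint f')
    (H : g.LFMap M.gr (pathGr g.gr) 0) (hH : g.IsInftyHom M.str (g.path g.adjoint) H)
    (h₀ : ∀ k x, (pathEval₀ L).lTensor g.CE (H.comp k x) = f.comp k x)
    (h₁ : ∀ k x, (pathEval₁ L).lTensor g.CE (H.comp k x) = f'.comp k x) :
    FreeDGModule.AnchorHomotopy (WLP.anchor ⟨M, f, hf⟩) (WLP.anchor ⟨M, f', hf'⟩) where
  η := g.contrDer ∘ₗ g.signCoch L ∘ₗ (pathSnd L).lTensor g.CE ∘ₗ H.lin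
  isDer n u hu := g.isDer_contrDer (g.signCoch_mem_cochGr (pathSnd_mem
    (H.lin_mem (LFModule.mem_shiftGr hu))))
  smul_apply a u b := by
    change g.contrDer (g.signCoch L ((pathSnd L).lTensor g.CE (g.extend H.total (a • u)))) b = _
    rw [extend_smul, lTensor_smul', signCoch_smul, contrDer_smul]
    rfl
  comm n u hu b := by
    have hu' := g.signCoch_mem_cochGr (pathSnd_mem (H.lin_mem (LFModule.mem_shiftGr hu)))
    have e₁ := g.ceD_contrDer hu' b
    have e₂ := signCoch_pathSnd_totalD g.adjoint (H.lin u)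
    rw [← hH] at e₂
    -- The `t`-component of `H` is the difference of the endpoints. By `e₂` it is also the boundary
    -- of the signed `dt`-component, and Cartan's formula `e₁` turns this into the homotopy relation
    -- between anchors.
    have e₃ : f'.lin u = f.lin u + (pathFst L).lTensor g.CE (H.lin u) := by
      rw [← LFMap.lTensor_lin h₀, ← LFMap.lTensor_lin h₁, ← LinearMap.add_apply,
        ← LinearMap.lTensor_add]
      rfl
    change g.contrDer (f'.lin u) b = g.contrDer (f.lin u) b +
      (g.ceD (g.contrDer (g.signCoch L ((pathSnd L).lTensor g.CE (H.lin u))) b) +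
        n.negOnePow • g.contrDer (g.signCoch L ((pathSnd L).lTensor g.CE (H.lin u))) (g.ceD b)) +
      g.contrDer (g.signCoch L ((pathSnd L).lTensor g.CE (H.lin (g.totalD M.str u)))) b
    rw [e₁, e₂, e₃, Int.negOnePow_sub, Int.negOnePow_one, map_add, map_sub, LinearMap.add_apply,
      LinearMap.sub_apply]
    simp only [mul_neg, mul_one, Units.neg_smul]
    abel

end DGLieAlgebra

/-! ### Explicit formulas on generators and the theorem -/

namespace TensorAlgebra

open SignedAlgebra

theorem prod_ofFn_snoc_one_tmul {K A M : Type*} [Field K] [CharZero K] [Ring A] [Algebra K A] [AddCommGroup M]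
    [Module K M] {n : ℕ} (e : Fin n → ℤ) (m : Fin n → M) (m₀ : M) :
    (List.ofFn fun i => ι K ((Fin.snoc (fun i => (1 : A) ⊗ₜ[K] m i) (1 ⊗ₜ[K] m₀) :
      Fin (n + 1) → A ⊗[K] M) i)).prod =
      freeIncl A M (word (List.ofFn fun i => (e i, m i)) * ι K m₀) := by
  rw [List.ofFn_succ', List.concat_eq_append, List.prod_append, List.prod_singleton, map_mul,
    word_ofFn, map_list_prod, List.map_ofFn]
  simp [freeIncl, Function.comp_def]

end TensorAlgebra

namespace DGLieAlgebra

open SignedGrading SignedAlgebra TensorAlgebra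

variable {K : Type u} [Field K] {L : Type v} [AddCommGroup L] [Module K L]
  [FiniteDimensional K L] {g : DGLieAlgebra K L}

omit [FiniteDimensional K L] in
theorem LFMap.lin_one_tmul {V W : Type*} [AddCommGroup V] [Module K V] [AddCommGroup W]
    [Module K W] {𝒱 : ℤ → Submodule K V} {𝒲 : ℤ → Submodule K W} (t : g.LFMap 𝒱 𝒲 0) (x : V) :
    t.lin (1 ⊗ₜ x) = t.total x := by
  rw [lin, extend_tmul, one_smul]

variable [CharZero K]

theorem WLP.leibniz_br_one (X : WLP.{u, v, w} g) (z : g.Coch X.mod.carrier) :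
    X.anchor.leibniz.br 1 (fun _ => z) = g.totalD X.mod.str z := by
  refine (proj_family_one _ z).trans ?_
  rw [LinearMap.comp_apply, FreeDGModule.Anchor.codiff_ι, proj_ι]
  rfl

/-- The sum on the right includes the weight zero part of the differential of `m₀`. As soon as one
contraction is applied this part contributes nothing, since contractions kill constants, so the sum
may equally be taken over positive weights. -/
theorem WLP.leibniz_br_snoc (X : WLP.{u, v, w} g) {n : ℕ} (e : Fin n → ℤ)
    (m : Fin n → X.mod.carrier) (m₀ : X.mod.carrier) (hm : ∀ i, m i ∈ X.mod.gr (e i)) :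
    X.anchor.leibniz.br (n + 1) (Fin.snoc (fun i => 1 ⊗ₜ[K] m i) (1 ⊗ₜ[K] m₀)) =
      (∑ i, (e i - 1)).negOnePow •
        (List.ofFn fun i => g.contrCoch X.mod.carrier (X.f.total (m i))).prod
          (X.mod.str.total m₀) := by
  refine (family_apply _ _).trans ?_
  -- The letters live in M[1], hence have degrees `e i - 1`; their sum is the exponent of the sign.
  rw [prod_ofFn_snoc_one_tmul (fun i => e i - 1), LinearMap.comp_apply,
    FreeDGModule.Anchor.proj_codiff_word _ _ fun c hc => ?_]
  · have h₁ : X.mod.freeDGModule.d (1 ⊗ₜ m₀) = X.mod.str.total m₀ := totalD_one_tmul _ _ _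
    have h₂ : ∀ x : X.mod.carrier, (X.anchor.ρ (1 ⊗ₜ x)).rTensor X.mod.carrier =
        g.contrCoch X.mod.carrier (X.f.total x) := fun x => by
      rw [contrCoch_eq_rTensor, ← LFMap.lin_one_tmul]
      rfl
    rw [h₁, List.map_ofFn, wordDeg, List.map_ofFn, List.sum_ofFn]
    simp only [Function.comp_def, h₂]
  · obtain ⟨i, rfl⟩ := (List.mem_ofFn' _ _).1 hc
    change m i ∈ X.mod.gr (e i - 1 + 1)
    rw [sub_add_cancel]
    exact hm i

theorem WLP.Hom.leibnizHom_map_one {X Y : WLP.{u, v, w} g} (φ : WLP.Hom g X Y)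
    (z : g.Coch X.mod.carrier) : φ.anchorHom.leibnizHom.map 1 (fun _ => z) = φ.φ.lin z := by
  refine (proj_family_one _ z).trans ?_
  rw [LinearMap.comp_apply, FreeDGModule.AnchorHom.comor_ι, proj_ι]
  rfl

theorem WLP.Hom.leibnizHom_map_snoc {X Y : WLP.{u, v, w} g} (φ : WLP.Hom g X Y) {n : ℕ}
    (m : Fin n → X.mod.carrier) (m₀ : X.mod.carrier) :
    φ.anchorHom.leibnizHom.map (n + 1) (Fin.snoc (fun i => 1 ⊗ₜ[K] m i) (1 ⊗ₜ[K] m₀)) =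
      (List.ofFn fun i => g.contrCoch Y.mod.carrier (X.f.total (m i))).prod (φ.φ.total m₀) := by
  refine (family_apply _ _).trans ?_
  -- No sign occurs in degree 0 morphisms, so the degrees attached to the letters play no role and
  -- are set to 0.
  rw [prod_ofFn_snoc_one_tmul 0, LinearMap.comp_apply, FreeDGModule.AnchorHom.proj_comor_word]
  have h₁ : φ.anchorHom.φ (1 ⊗ₜ m₀) = φ.φ.total m₀ := LFMap.lin_one_tmul _ _
  have h₂ : ∀ x : X.mod.carrier, (Y.anchor.ρ (φ.anchorHom.φ (1 ⊗ₜ x))).rTensor Y.mod.carrier =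
      g.contrCoch Y.mod.carrier (X.f.total x) := fun x => by
    rw [contrCoch_eq_rTensor, ← LFMap.lin_one_tmul, φ.anchorHom.map_anchor]
    rfl
  rw [h₁, List.map_ofFn]
  simp only [Function.comp_def, h₂]

theorem WLP.leibnizHom_id (X : WLP.{u, v, w} g) :
    (WLP.Hom.anchorHom (CategoryTheory.CategoryStruct.id X)).leibnizHom.map =
      idFamily K (g.Coch X.mod.carrier) :=
  FreeDGModule.AnchorHom.map_eq_idFamily fun u => LFMap.lin_id u

theorem WLP.isComposite_leibnizHom {X Y Z : WLP.{u, v, w} g} (φ : X ⟶ Y) (ψ : Y ⟶ Z) :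
    IsComposite (LFModule.shiftGr g X.mod)
      (WLP.Hom.anchorHom (CategoryTheory.CategoryStruct.comp φ ψ)).leibnizHom.map
      (WLP.Hom.anchorHom ψ).leibnizHom.map (WLP.Hom.anchorHom φ).leibnizHom.map :=
  FreeDGModule.AnchorHom.isComposite φ.anchorHom ψ.anchorHom
    (g := WLP.Hom.anchorHom (CategoryTheory.CategoryStruct.comp φ ψ))
    fun u => LFMap.lin_compose ψ.φ φ.φ u

end DGLieAlgebra

end

theorem theorem4p4 {K : Type u} [RCLike K] {L : Type v} [AddCommGroup L] [Module K L]
    [FiniteDimensional K L] (g : DGLieAlgebra K L) :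
    ∃ (G : ∀ X : DGLieAlgebra.WLP.{u, v, w} g,
          LeibnizInftyAlg g.ceGr g.ceD (DGLieAlgebra.LFModule.shiftGr g X.mod))
      (Gmap : ∀ {X Y : DGLieAlgebra.WLP.{u, v, w} g}, (X ⟶ Y) → LeibnizInftyHom (G X) (G Y)),
      -- the unary bracket is the total differential
      (∀ X z, (G X).br 1 (fun _ => z) = g.totalD X.mod.str z) ∧
      -- the higher brackets on `m_1, …, m_n, m₀`
      (∀ X, ∀ n ≥ 1, ∀ (e : Fin n → ℤ) (m : Fin n → X.mod.carrier) (m₀ : X.mod.carrier),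
        (∀ i, m i ∈ X.mod.gr (e i)) →
        (G X).br (n + 1) (Fin.snoc (fun i => 1 ⊗ₜ[K] m i) (1 ⊗ₜ[K] m₀)) =
          (∑ i, (e i - 1)).negOnePow •
            (List.ofFn fun i => g.contrCoch X.mod.carrier (X.f.total (m i))).prod
              (X.mod.str.total m₀)) ∧
      -- the components of the morphism induced by `φ`
      (∀ X Y, ∀ φ : X ⟶ Y, (∀ z, (Gmap φ).map 1 (fun _ => z) = φ.φ.lin z) ∧
        ∀ (n : ℕ) (m : Fin n → X.mod.carrier) (m₀ : X.mod.carrier),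
          (Gmap φ).map (n + 1) (Fin.snoc (fun i => 1 ⊗ₜ[K] m i) (1 ⊗ₜ[K] m₀)) =
            (List.ofFn fun i => g.contrCoch Y.mod.carrier (X.f.total (m i))).prod
              (φ.φ.total m₀)) ∧
      -- functoriality
      (∀ X, (Gmap (CategoryTheory.CategoryStruct.id X)).map = idFamily K (g.Coch X.mod.carrier)) ∧
      (∀ X Y Z, ∀ (φ : X ⟶ Y) (ψ : Y ⟶ Z),
        IsComposite (DGLieAlgebra.LFModule.shiftGr g X.mod)
          (Gmap (CategoryTheory.CategoryStruct.comp φ ψ)).map (Gmap ψ).map (Gmap φ).map) ∧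
      -- homotopy invariance
      (∀ (M : DGLieAlgebra.LFModule.{u, v, w} g) (f f' : g.LFMap M.gr g.gr 0)
        (hf : g.IsInftyHom M.str g.adjoint f) (hf' : g.IsInftyHom M.str g.adjoint f'),
        g.Homotopic M.str g.adjoint f f' →
        ∃ (Φ : LeibnizInftyHom (G ⟨M, f', hf'⟩) (G ⟨M, f, hf⟩))
          (Ψ : LeibnizInftyHom (G ⟨M, f, hf⟩) (G ⟨M, f', hf'⟩)),
          IsComposite (DGLieAlgebra.LFModule.shiftGr g M) (idFamily K (g.Coch M.carrier))
            Ψ.map Φ.map ∧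
          IsComposite (DGLieAlgebra.LFModule.shiftGr g M) (idFamily K (g.Coch M.carrier))
            Φ.map Ψ.map ∧
          ∀ z, Φ.map 1 (fun _ => z) = z) := by
  refine ⟨fun X => X.anchor.leibniz, fun φ => (DGLieAlgebra.WLP.Hom.anchorHom φ).leibnizHom,
    fun X z => X.leibniz_br_one z, fun X n _ e m m₀ hm => X.leibniz_br_snoc e m m₀ hm,
    fun X Y φ => ⟨fun z => DGLieAlgebra.WLP.Hom.leibnizHom_map_one φ z,
      fun n m m₀ => DGLieAlgebra.WLP.Hom.leibnizHom_map_snoc φ m m₀⟩,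
    fun X => X.leibnizHom_id, fun X Y Z φ ψ => DGLieAlgebra.WLP.isComposite_leibnizHom φ ψ, ?_⟩
  rintro M f f' hf hf' ⟨H, hH, h₀, h₁⟩
  -- The anchor of `f` is the one being deformed and that of `f'` the target symbol, so the
  -- isomorphism runs from the algebra of `f'` to that of `f`.
  have h := DGLieAlgebra.anchorHomotopy hf hf' H hH h₀ h₁
  exact ⟨h.leibnizHom, h.leibnizInv, h.isComposite_inv_hom, h.isComposite_hom_inv,
    h.leibnizHom_one⟩
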